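/- **Conventions.** Write $\tilde I=\begin{bmatrix}0&-1\\1&0\end{bmatrix}$, $\tilde J=\begin{bmatrix}1&0\\0&-1\end{bmatrix}$, $\tilde K=\begin{bmatrix}0&1\\1&0\end{bmatrix}$, $R(\alpha)=\exp(\alpha\tilde I)$ (rotation by $\alpha$), and $\tilde{\mathbb K}=\{-\sin\beta\,\tilde J+\cos\beta\,\tilde K:\beta\in[0,2\pi)\}$. An ordered measure on $[a,b]$ is a countably additive $\mathrm M_2(\mathbb R)$-valued Borel measure $\phi$ of finite variation and without atoms, supported on $[a,b]$; $\int\|\phi\|_2$ is its total variation in the Euclidean operator norm, and $$\mathrm{Lexp}(\phi)=\mathrm{Id}+\sum_{n\ge1}\int_{t_1\le\dots\le t_n}\phi(t_n)\cdots\phi(t_1).$$ The real Magnus exponent of $A\in\mathrm M_2(\mathbb R)$ is $\mathcal M(A)=\inf\{\int\|\phi\|_2:\mathrm{Lexp}(\phi)=A\}\in[0,\infty]$ (with $\mathcal M(A)=+\infty$ if there is no such $\phi$), and $\phi$ is a minimal Magnus presentation of $A$ if $\mathrm{Lexp}(\phi)=A$ and $\int\|\phi\|_2=\mathcal M(A)$.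 For $\phi$ on $[a,b]$ put $s_\phi(x)=\int\|\phi|_{[a,x]}\|_2$. Two ordered measures are reparametrizations of each other if their push-forwards by $s_\phi$ (their mass-normalized versions) are equal. The chiral disk $\mathrm{CD}(A)$ of $A=\begin{bmatrix}a_{11}&a_{12}\\a_{21}&a_{22}\end{bmatrix}$ is the closed, possibly degenerate disk in $\mathbb C$ with center $\frac{a_{11}+a_{22}}2+\mathrm i\frac{a_{21}-a_{12}}2$ and radius $\sqrt{\left(\frac{a_{11}-a_{22}}2\right)^2+\left(\frac{a_{12}+a_{21}}2\right)^2}$; $A$ is quasicomplex if this is a point. Let $p=\mathcal M(A)<\pi$. Then $\mathrm{CD}(A)$ is contained in the image of the closed disk $\bar D(0,p)$ under $\exp$, whose boundary is the curve $\gamma_p(t)=\mathrm e^{p\cos t+\mathrm ip\sin t}$. $A$ is Magnus hyperbolic if $\det A=1$ and $\mathrm{CD}(A)$ meets this curve in at least two distinct points; $A$ is Magnus parabolic if $\det A=1$ and, for $t=\pi/2$ or $t=-\pi/2$, $\mathrm{CD}(A)$ contains $\gamma_p(t)$ and is the (nondegenerate) osculating disk of $\gamma_p$ there. Finally, for $p_1,p_2\ge0$,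 $t\in\mathbb R$, $\tilde F\in\tilde{\mathbb K}$, let $$\mathrm{NW}(p_1,p_2,t,\tilde F)=\mathrm e^{p_1\cos t}\left[R\bigl((p_1+p_2)\sin t\bigr)\left(\cosh(p_2\cos t)\,\mathrm{Id}-\tfrac{\sinh(p_2\cos t)}{\cos t}\sin t\,\tilde I\right)+\tfrac{\sinh(p_2\cos t)}{\cos t}\tilde F\right],$$ where $\frac{\sinh(p_2\cos t)}{\cos t}$ means $p_2$ if $\cos t=0$. **Theorem.** Let $A\in\mathrm M_2(\mathbb R)$, $A\ne\mathrm{Id}$, $p=\mathcal M(A)<\pi$. (a) Suppose that $A$ is Magnus hyperbolic or parabolic. Then there are $t\in[-\pi/2,\pi/2]$ and $\tilde F\in\tilde{\mathbb K}$, depending only on $A$, such that for every minimal presentation $\phi$ of $A$, on an interval $[a,b]$, $$\mathrm{Lexp}(\phi|_{[a,x]})=\mathrm{NW}\bigl(0,\,s,\,t,\,R(s\sin t)\tilde F\bigr),\qquad s=s_\phi(x),\quad x\in[a,b];$$ and, for each such $\phi$, $t$ and $\tilde F$ are the only elements of these sets with this property. Any two minimal presentations of $A$ are reparametrizations of each other.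 (b) Suppose that $A$ is quasicomplex. Then there is $t\in[0,2\pi)$, depending only on $A$, such that for every minimal presentation $\phi$ of $A$, on an interval $[a,b]$, $$\mathrm{Lexp}(\phi|_{[a,x]})=\exp\bigl(s_\phi(x)(\mathrm{Id}\cos t+\tilde I\sin t)\bigr),\qquad x\in[a,b];$$ and, for each such $\phi$, $t$ is the only element of $[0,2\pi)$ with this property. Any two minimal presentations of $A$ are reparametrizations of each other. (c) Suppose that $A$ is of neither kind. Then there are $t\in[0,2\pi)$, $p_1,p_2>0$ and $\tilde F\in\tilde{\mathbb K}$, depending only on $A$, such that for every minimal presentation $\phi$ of $A$, on an interval $[a,b]$, there are monotone increasing surjective functions $\varpi_i:[0,p]\to[0,p_i]$ ($i=1,2$) with $\varpi_1(s)+\varpi_2(s)=s$ for $s\in[0,p]$ and $$\mathrm{Lexp}(\phi|_{[a,x]})=\mathrm{NW}\bigl(\varpi_1(s),\,\varpi_2(s),\,t,\,R(s\sin t)\tilde F\bigr),\qquad s=s_\phi(x),\quad x\in[a,b];$$ and, for each such $\phi$, the data $t,p_1,p_2,\tilde F,\varpi_1,\varpi_2$ with these properties are unique. Two minimal presentations of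 $A$ with the same data are reparametrizations of each other. (That is, minimal presentations are unique up to displacement of the elliptic parts.) -/

import Mathlib

open MeasureTheory Set
open scoped ENNReal Matrix Matrix.Norms.L2Operator

namespace Magnus

noncomputable section

/-! ### Real 2 × 2 matrices -/

/-- Real `2 × 2` matrices. With the scope opened above, they carry the Euclidean operator norm. -/
abbrev M2 : Type := Matrix (Fin 2) (Fin 2) ℝ

/-- The matrix `Ĩ`, rotation by a right angle. -/
def mI : M2 := !![0, -1; 1, 0]

/-- The matrix `J̃`. -/
def mJ : M2 := !![1, 0; 0, -1]

/-- The matrix `K̃`. -/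
def mK : M2 := !![0, 1; 1, 0]

/-- Rotation by the angle `α`, i.e. `exp (α Ĩ) = cos α Id + sin α Ĩ`. -/
def rot (α : ℝ) : M2 := Real.cos α • (1 : M2) + Real.sin α • mI

/-- The conjugates of `K̃` by orthogonal matrices, `{-sin β J̃ + cos β K̃ : β ∈ [0, 2π)}`. -/
def kSet : Set M2 :=
  {F | ∃ β ∈ Ico (0 : ℝ) (2 * Real.pi), F = -(Real.sin β) • mJ + Real.cos β • mK}

/-! ### Ordered measures and the time-ordered exponential -/

/-- `φ` is an ordered `M2`-valued measure supported on the interval `[a, b]`: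
a countably additive matrix-valued Borel measure of finite variation and without atoms. -/
structure IsOrderedMeasure (φ : VectorMeasure ℝ M2) (a b : ℝ) : Prop where
  le : a ≤ b
  supported : φ.restrict (Icc a b) = φ
  atomless : ∀ x, φ {x} = 0
  finite_variation : φ.variation univ ≠ ∞

/-- The total variation `∫ ‖φ‖₂` with respect to the operator norm. -/
def mass (φ : VectorMeasure ℝ M2) : ℝ≥0∞ := φ.variation univ

/-- The pairing `(U, m) ↦ m * U`: integrating a matrix function `U` against a matrix measure with
it gives `∫ φ(ds) U(s)`. -/
def leftMul : M2 →L[ℝ] M2 →L[ℝ] M2 := (ContinuousLinearMap.mul ℝ M2).flip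

/-- The iterated integrals `∫_{t₁ ≤ ⋯ ≤ tₙ ≤ x} φ(tₙ) ⋯ φ(t₁)` (later times on the left). -/
def iterInt (φ : VectorMeasure ℝ M2) : ℕ → ℝ → M2
  | 0, _ => 1
  | n + 1, x => (φ.restrict (Iic x)).integral (fun s => iterInt φ n s) leftMul

/-- The left time-ordered exponential
`Lexp φ = 1 + ∑_{n ≥ 1} ∫_{t₁ ≤ ⋯ ≤ tₙ} φ(tₙ) ⋯ φ(t₁)`. -/
def Lexp (φ : VectorMeasure ℝ M2) : M2 :=
  1 + ∑' n : ℕ, φ.integral (fun s => iterInt φ n s) leftMul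

/-- The real Magnus exponent `inf {∫ ‖φ‖₂ : Lexp φ = A}` (`+∞` if `A` has no presentation). -/
def magnusExponent (A : M2) : ℝ≥0∞ :=
  ⨅ (φ : VectorMeasure ℝ M2) (a : ℝ) (b : ℝ) (_ : IsOrderedMeasure φ a b) (_ : Lexp φ = A), mass φ

/-- `φ` is a minimal Magnus presentation of `A`, supported on `[a, b]`. -/
structure IsMinimalPresentation (A : M2) (φ : VectorMeasure ℝ M2) (a b : ℝ) : Prop where
  isOrdered : IsOrderedMeasure φ a b
  lexp_eq : Lexp φ = A
  mass_eq : mass φ = magnusExponent A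

/-- The cumulative norm `∫ ‖φ|_{[a,x]}‖₂`, as a real number. -/
def cumMass (φ : VectorMeasure ℝ M2) (a x : ℝ) : ℝ := (mass (φ.restrict (Icc a x))).toReal

/-- The mass-normalized version of `φ`: `φ` transported by its cumulative norm, so that it lives
on `[0, ∫ ‖φ‖₂]` and has norm density one there. -/
def massNormalized (φ : VectorMeasure ℝ M2) (a : ℝ) : VectorMeasure ℝ M2 :=
  φ.map (cumMass φ a)

/-- Two ordered measures (with intervals starting at `a` and `c`) are reparametrizations
of each other: their mass-normalized versions agree. -/
def ReparamEquiv (φ : VectorMeasure ℝ M2) (a : ℝ) (ψ : VectorMeasure ℝ M2) (c : ℝ) : Prop :=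
  massNormalized φ a = massNormalized ψ c

/-! ### Chiral disks and the classification of matrices -/

/-- The center of the chiral disk. -/
def chiralCenter (A : M2) : ℂ := ⟨(A 0 0 + A 1 1) / 2, (A 1 0 - A 0 1) / 2⟩

/-- The radius of the chiral disk. -/
def chiralRadius (A : M2) : ℝ :=
  Real.sqrt (((A 0 0 - A 1 1) / 2) ^ 2 + ((A 0 1 + A 1 0) / 2) ^ 2)

/-- The chiral disk, a possibly degenerate closed disk of the complex plane. -/
def chiralDisk (A : M2) : Set ℂ := Metric.closedBall (chiralCenter A) (chiralRadius A)

/-- The curve `γ_p(t) = exp (p cos t + i p sin t)`, parametrizing `exp ∂D(0,p)`. -/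
def gammaCurve (p t : ℝ) : ℂ := Complex.exp (p * Complex.exp (t * Complex.I))

/-- The points where the chiral disk of `A` touches `exp ∂D(0,p)`, for the Magnus exponent `p`
of `A` (if `p < π`, the chiral disk is contained in `exp D(0,p)`). -/
def touchSet (A : M2) : Set ℂ := chiralDisk A ∩ range (gammaCurve (magnusExponent A).toReal)

/-- The circle with center `c` and radius `r > 0` is the osculating circle of the plane curve `γ`
at the parameter `t`: it has contact of order two with the curve there. -/
def IsOsculating (γ : ℝ → ℂ) (t : ℝ) (c : ℂ) (r : ℝ) : Prop :=
  0 < r ∧ ‖γ t - c‖ = r ∧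
    deriv (fun τ => ‖γ τ - c‖ ^ 2) t = 0 ∧
    deriv (deriv (fun τ => ‖γ τ - c‖ ^ 2)) t = 0

/-- Magnus hyperbolic: determinant one, and the chiral disk touches `exp ∂D(0,p)` at
two distinct points. -/
def IsMagnusHyperbolic (A : M2) : Prop :=
  A.det = 1 ∧ ∃ z ∈ touchSet A, ∃ w ∈ touchSet A, z ≠ w

/-- Magnus parabolic: determinant one, and the chiral disk touches `exp ∂D(0,p)` at `exp (ip)` or
at `exp (-ip)`, being the osculating disk there. -/
def IsMagnusParabolic (A : M2) : Prop :=
  A.det = 1 ∧ ∃ t : ℝ, (t = Real.pi / 2 ∨ t = -(Real.pi / 2)) ∧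
    gammaCurve (magnusExponent A).toReal t ∈ touchSet A ∧
    IsOsculating (gammaCurve (magnusExponent A).toReal) t (chiralCenter A) (chiralRadius A)

/-! ### The normal form -/

/-- `sinh (q c) / c`, understood as `q` for `c = 0`. -/
def sinhDiv (q c : ℝ) : ℝ := if c = 0 then q else Real.sinh (q * c) / c

/-- The normal form `NW(p₁, p₂, t, F)`. -/
def NW (p₁ p₂ t : ℝ) (F : M2) : M2 :=
  Real.exp (p₁ * Real.cos t) •
    (rot ((p₁ + p₂) * Real.sin t) *
        (Real.cosh (p₂ * Real.cos t) • (1 : M2)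
          - (sinhDiv p₂ (Real.cos t) * Real.sin t) • mI)
      + sinhDiv p₂ (Real.cos t) • F)

/-- `φ`, on `[a, b]`, is a hyperbolic or parabolic development with parameter `t` and initial
phase `F`. -/
def IsHyperbolicDevelopment (φ : VectorMeasure ℝ M2) (a b t : ℝ) (F : M2) : Prop :=
  ∀ x ∈ Icc a b, Lexp (φ.restrict (Icc a x)) =
    NW 0 (cumMass φ a x) t (rot (cumMass φ a x * Real.sin t) * F)

/-- `φ`, on `[a, b]`, develops as a complex exponential of direction `t`. -/
def IsComplexDevelopment (φ : VectorMeasure ℝ M2) (a b t : ℝ) : Prop :=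
  ∀ x ∈ Icc a b, Lexp (φ.restrict (Icc a x)) =
    NormedSpace.exp (cumMass φ a x • (Real.cos t • (1 : M2) + Real.sin t • mI))

/-- `φ`, on `[a, b]` and of total mass `p`, develops along the normal form with direction `t`,
elliptic length `p₁`, hyperbolic length `p₂`, and initial phase `F`,
where of the first `s` units of mass the amount `w₁ s` is spent on the elliptic part and the
amount `w₂ s` is spent on the hyperbolic part. -/
structure IsMixedDevelopment (φ : VectorMeasure ℝ M2) (a b p t p₁ p₂ : ℝ) (F : M2)
    (w₁ w₂ : ℝ → ℝ) : Prop where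
  t_mem : t ∈ Ico (0 : ℝ) (2 * Real.pi)
  p₁_pos : 0 < p₁
  p₂_pos : 0 < p₂
  F_mem : F ∈ kSet
  mono₁ : MonotoneOn w₁ (Icc 0 p)
  mono₂ : MonotoneOn w₂ (Icc 0 p)
  image₁ : w₁ '' Icc 0 p = Icc 0 p₁
  image₂ : w₂ '' Icc 0 p = Icc 0 p₂
  add_eq : ∀ s ∈ Icc 0 p, w₁ s + w₂ s = s
  lexp_eq : ∀ x ∈ Icc a b, Lexp (φ.restrict (Icc a x)) =
    NW (w₁ (cumMass φ a x)) (w₂ (cumMass φ a x)) t (rot (cumMass φ a x * Real.sin t) * F)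

end

end Magnus

namespace Magnus

/-! ### Complex coordinates on real matrices -/

noncomputable section

/-! A real matrix acts on ℂ by u ↦ zu + w·conj u. Its operator norm is |z| + |w|, and the quotients
Mu/u fill the circle with center z and radius |w|, which is the boundary of the chiral disk.

Reduction to flows. The push-forward of the variation of an ordered measure by its cumulative norm
is Lebesgue measure on [0, p]. After this change of variable the measure has a density f with ‖f‖ ≤
1, and the partial time-ordered exponentials are the values of the solution of U' = fU, U(0) = 1
(`IsOrderedMeasure.exists_density`). Since U is invertible, it determines f almost everywhere, so
equal developments give reparametrizations of each other.

Rigidity. A trajectory x = Uu has logarithmic derivative g with |g| ≤ 1, so Uu/u is the exponential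
of a number of modulus at most p. By the maximum principle for the logarithm the whole chiral disk
lies in exp D(0, p) (`logBounded_flow`). If Au/u = exp(p e^{it}), then the integral of g is p
e^{it}, because exp is injective on |ζ| < π, and hence g = e^{it} almost everywhere. Equality in the
triangle inequality then fixes f up to the proportion |z(f)| of its linear part
(`ae_parts_of_extremal`). Solving the linear equation for such an f gives NW, whose elliptic length
is the integral of |z(f)| (`IsDensity.flow_eq_NW`).

Existence of a touching point. Let q ≤ p be the maximum of |log| on the chiral disk. The disk then
touches exp ∂D(0, q) from inside. First-order conditions put its center on the inner normal. The
mirrored boundary point, or the second derivative when cos t = 0, bounds the radius by that of a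
normal form without elliptic part (`le_relRadius`). Hence A is itself a normal form of total length
q, which is realized by an explicit density, and minimality gives q = p
(`exists_act_eq_gammaCurve`).

Classification. The relative radius is strictly increasing in the hyperbolic length, so A determines
how p splits into the two lengths. Zero hyperbolic length is the quasicomplex case. Zero elliptic
length is the hyperbolic or parabolic case: the extremal radius yields determinant one and a second
touching point or osculation, and conversely two touching directions or osculation exclude an
elliptic part. In the mixed case the direction is unique for the same reason, and the moduli of the
antilinear parts recover the two length functions. -/

/-- The complex antilinear part of a real matrix: `M` acts on `ℂ = ℝ²` as
`u ↦ chiralCenter M * u + antilin M * conj u`. -/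
def antilin (M : M2) : ℂ := ⟨(M 0 0 - M 1 1) / 2, (M 0 1 + M 1 0) / 2⟩

/-- The real matrix acting as `u ↦ z * u + w * conj u`. -/
def ofParts (z w : ℂ) : M2 := !![z.re + w.re, w.im - z.im; z.im + w.im, z.re - w.re]

local notation "conj" => starRingEnd ℂ

/-- The action of a real matrix on `ℂ = ℝ²`. -/
def act (M : M2) (u : ℂ) : ℂ := chiralCenter M * u + antilin M * conj u

@[simp] lemma chiralCenter_ofParts (z w : ℂ) : chiralCenter (ofParts z w) = z := by
  apply Complex.ext <;> simp [chiralCenter, ofParts]; ring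

@[simp] lemma antilin_ofParts (z w : ℂ) : antilin (ofParts z w) = w := by
  apply Complex.ext <;> simp [antilin, ofParts]; ring

lemma ofParts_parts (M : M2) : ofParts (chiralCenter M) (antilin M) = M := by
  ext i j
  fin_cases i <;> fin_cases j <;> simp [antilin, chiralCenter, ofParts] <;> ring

lemma ext_parts {M N : M2} (hz : chiralCenter M = chiralCenter N) (hw : antilin M = antilin N) :
    M = N := by
  rw [← ofParts_parts M, ← ofParts_parts N, hz, hw]

@[simp] lemma chiralCenter_one : chiralCenter 1 = 1 := by
  apply Complex.ext <;> simp [chiralCenter]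

@[simp] lemma antilin_one : antilin 1 = 0 := by
  apply Complex.ext <;> simp [antilin]

@[simp] lemma chiralCenter_mI : chiralCenter mI = Complex.I := by
  apply Complex.ext <;> norm_num [chiralCenter, mI]

@[simp] lemma antilin_mI : antilin mI = 0 := by
  apply Complex.ext <;> norm_num [antilin, mI]

@[simp] lemma chiralCenter_add (M N : M2) :
    chiralCenter (M + N) = chiralCenter M + chiralCenter N := by
  apply Complex.ext <;> simp [chiralCenter] <;> ring

@[simp] lemma antilin_add (M N : M2) : antilin (M + N) = antilin M + antilin N := by
  apply Complex.ext <;> simp [antilin] <;> ring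

@[simp] lemma chiralCenter_sub (M N : M2) :
    chiralCenter (M - N) = chiralCenter M - chiralCenter N := by
  apply Complex.ext <;> simp [chiralCenter] <;> ring

@[simp] lemma antilin_sub (M N : M2) : antilin (M - N) = antilin M - antilin N := by
  apply Complex.ext <;> simp [antilin] <;> ring

@[simp] lemma chiralCenter_smul (c : ℝ) (M : M2) :
    chiralCenter (c • M) = c * chiralCenter M := by
  apply Complex.ext <;> simp [chiralCenter] <;> ring

@[simp] lemma antilin_smul (c : ℝ) (M : M2) : antilin (c • M) = c * antilin M := by
  apply Complex.ext <;> simp [antilin] <;> ring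

@[simp] lemma chiralCenter_mul (M N : M2) :
    chiralCenter (M * N) = chiralCenter M * chiralCenter N + antilin M * conj (antilin N) := by
  apply Complex.ext <;>
    simp [chiralCenter, antilin, Matrix.mul_apply, Fin.sum_univ_two] <;> ring

@[simp] lemma antilin_mul (M N : M2) :
    antilin (M * N) = chiralCenter M * antilin N + antilin M * conj (chiralCenter N) := by
  apply Complex.ext <;>
    simp [chiralCenter, antilin, Matrix.mul_apply, Fin.sum_univ_two] <;> ring

lemma act_mul (M N : M2) (u : ℂ) : act (M * N) u = act M (act N u) := by
  simp only [act, chiralCenter_mul, antilin_mul, map_add, map_mul, Complex.conj_conj]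
  ring

@[simp] lemma act_one (u : ℂ) : act 1 u = u := by simp [act]

lemma chiralRadius_eq (M : M2) : chiralRadius M = ‖antilin M‖ := by
  rw [chiralRadius, Complex.norm_def, Complex.normSq_apply, antilin]
  congr 1
  ring

lemma det_eq (M : M2) : M.det = ‖chiralCenter M‖ ^ 2 - ‖antilin M‖ ^ 2 := by
  rw [← Complex.normSq_eq_norm_sq, ← Complex.normSq_eq_norm_sq, Complex.normSq_apply,
    Complex.normSq_apply, Matrix.det_fin_two]
  simp only [antilin, chiralCenter]
  ring

/-- The real and imaginary parts of a complex number as a vector of the Euclidean plane. -/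
def toPlane (u : ℂ) : EuclideanSpace ℝ (Fin 2) := !₂[u.re, u.im]

lemma norm_toPlane (u : ℂ) : ‖toPlane u‖ = ‖u‖ := by
  rw [EuclideanSpace.norm_eq, Complex.norm_def, Complex.normSq_apply]
  simp [toPlane, Fin.sum_univ_two, sq]

lemma toPlane_act (M : M2) (u : ℂ) :
    (EuclideanSpace.equiv (Fin 2) ℝ).symm (M *ᵥ (toPlane u).ofLp) = toPlane (act M u) := by
  ext i
  fin_cases i <;>
    simp [toPlane, act, chiralCenter, antilin] <;> ring

lemma norm_act_le (M : M2) (u : ℂ) : ‖act M u‖ ≤ ‖M‖ * ‖u‖ := by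
  have h := Matrix.l2_opNorm_mulVec M (toPlane u)
  rwa [toPlane_act, norm_toPlane, norm_toPlane] at h

/-- Every complex number of modulus one is of the form `conj u / u`. -/
lemma exists_unit_conj_div (ω : ℂ) (hω : ‖ω‖ = 1) : ∃ u : ℂ, ‖u‖ = 1 ∧ conj u / u = ω := by
  refine ⟨Complex.exp (-(ω.arg / 2 : ℝ) * Complex.I), ?_, ?_⟩
  · rw [← Complex.ofReal_neg, Complex.norm_exp_ofReal_mul_I]
  · rw [← Complex.exp_conj, ← Complex.exp_sub]
    have : ω = Complex.exp (ω.arg * Complex.I) := by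
      conv_lhs => rw [← Complex.norm_mul_exp_arg_mul_I ω, hω]
      simp
    conv_rhs => rw [this]
    congr 1
    simp only [map_mul, map_neg, Complex.conj_ofReal, Complex.conj_I]
    push_cast
    ring

lemma norm_conj_div_self {u : ℂ} (hu : u ≠ 0) : ‖conj u / u‖ = 1 := by
  rw [norm_div, Complex.norm_conj, div_self (norm_ne_zero_iff.2 hu)]

lemma act_div_self (M : M2) {u : ℂ} (hu : u ≠ 0) :
    act M u / u = chiralCenter M + antilin M * (conj u / u) := by
  rw [act]; field_simp

/-- A unit ω that aligns the arguments of z and wω turns the triangle inequality into an equality,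
and every unit ω is conj u / u for some unit vector u. Together with `norm_le_add_norm` this
computes the operator norm. -/
lemma norm_add_norm_le (M : M2) : ‖chiralCenter M‖ + ‖antilin M‖ ≤ ‖M‖ := by
  obtain ⟨ω, hω, h⟩ : ∃ ω : ℂ, ‖ω‖ = 1 ∧
      ‖chiralCenter M + antilin M * ω‖ = ‖chiralCenter M‖ + ‖antilin M‖ := by
    set z := chiralCenter M
    set w := antilin M
    have hz := Complex.norm_mul_exp_arg_mul_I z
    have hw := Complex.norm_mul_exp_arg_mul_I w
    refine ⟨Complex.exp ((z.arg - w.arg : ℝ) * Complex.I), Complex.norm_exp_ofReal_mul_I _, ?_⟩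
    have : z + w * Complex.exp ((z.arg - w.arg : ℝ) * Complex.I) =
        (‖z‖ + ‖w‖ : ℝ) * Complex.exp (z.arg * Complex.I) := by
      nth_rw 1 [← hz]
      nth_rw 1 [← hw]
      rw [mul_assoc (‖w‖ : ℂ), ← Complex.exp_add]
      push_cast
      ring_nf
    rw [this, norm_mul, Complex.norm_exp_ofReal_mul_I, mul_one, Complex.norm_real,
      Real.norm_of_nonneg (by positivity)]
  obtain ⟨u, hu, rfl⟩ := exists_unit_conj_div ω hω
  have hu0 : u ≠ 0 := by rintro rfl; simp at hu
  rw [← h, ← act_div_self M hu0, norm_div, hu, div_one]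
  simpa [hu] using norm_act_le M u

lemma norm_le_add_norm (M : M2) : ‖M‖ ≤ ‖chiralCenter M‖ + ‖antilin M‖ := by
  rw [Matrix.l2_opNorm_def]
  refine ContinuousLinearMap.opNorm_le_bound _ (by positivity) fun x => ?_
  have hx : x = toPlane ⟨x 0, x 1⟩ := by
    ext i; fin_cases i <;> simp [toPlane]
  have : (Matrix.toEuclideanLin ≪≫ₗ LinearMap.toContinuousLinearMap) M x =
      toPlane (act M ⟨x 0, x 1⟩) := by
    rw [← toPlane_act, ← hx]
    rfl
  rw [this, hx, norm_toPlane, norm_toPlane, act]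
  refine (norm_add_le _ _).trans ?_
  rw [norm_mul, norm_mul, Complex.norm_conj, add_mul]
  simp [toPlane]

/-! ### Components of the normal form -/

lemma chiralCenter_rot (α : ℝ) : chiralCenter (rot α) = Complex.exp (α * Complex.I) := by
  simp [rot, Complex.exp_mul_I, Complex.ofReal_cos, Complex.ofReal_sin]

lemma antilin_rot (α : ℝ) : antilin (rot α) = 0 := by
  simp [rot]

lemma chiralCenter_phase (β : ℝ) :
    chiralCenter (-(Real.sin β) • mJ + Real.cos β • mK) = 0 := by
  apply Complex.ext <;> simp [chiralCenter, mJ, mK]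

lemma antilin_phase (β : ℝ) : antilin (-(Real.sin β) • mJ + Real.cos β • mK) =
    Complex.I * Complex.exp (β * Complex.I) := by
  rw [Complex.exp_mul_I, ← Complex.ofReal_cos, ← Complex.ofReal_sin]
  apply Complex.ext
  · simp [antilin, mJ, mK, -Complex.ofReal_sin, -Complex.ofReal_cos]; ring
  · simp [antilin, mJ, mK, -Complex.ofReal_sin, -Complex.ofReal_cos]

/-- Allows the initial phase F to be handled as a complex number of modulus one. -/
lemma mem_kSet_iff {F : M2} : F ∈ kSet ↔ chiralCenter F = 0 ∧ ‖antilin F‖ = 1 := by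
  constructor
  · rintro ⟨β, -, rfl⟩
    refine ⟨chiralCenter_phase β, ?_⟩
    rw [antilin_phase, norm_mul, Complex.norm_exp_ofReal_mul_I, Complex.norm_I, mul_one]
  · rintro ⟨h0, h1⟩
    have hpi := Real.two_pi_pos
    set β := toIcoMod hpi 0 (-Complex.I * antilin F).arg with hβ
    have hmem : β ∈ Ico (0 : ℝ) (2 * Real.pi) := by
      have := toIcoMod_mem_Ico hpi 0 (-Complex.I * antilin F).arg
      rwa [zero_add] at this
    have hexp : Complex.exp (β * Complex.I) = -Complex.I * antilin F := by
      have h2 : ‖-Complex.I * antilin F‖ = 1 := by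
        rw [norm_mul, norm_neg, Complex.norm_I, h1, mul_one]
      conv_rhs => rw [← Complex.norm_mul_exp_arg_mul_I (-Complex.I * antilin F), h2]
      rw [hβ, toIcoMod, Complex.ofReal_one, one_mul, Complex.exp_eq_exp_iff_exists_int]
      refine ⟨-toIcoDiv hpi 0 (-Complex.I * antilin F).arg, ?_⟩
      simp only [zsmul_eq_mul]
      push_cast
      ring
    refine ⟨β, hmem, ext_parts ?_ ?_⟩
    · rw [h0, chiralCenter_phase]
    · rw [antilin_phase, hexp]
      linear_combination antilin F * Complex.I_sq

lemma chiralCenter_NW {F : M2} (hF : chiralCenter F = 0) (p₁ p₂ s t : ℝ) :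
    chiralCenter (NW p₁ p₂ t (rot s * F)) = Real.exp (p₁ * Real.cos t) *
      (Complex.exp (((p₁ + p₂) * Real.sin t : ℝ) * Complex.I) *
        (Real.cosh (p₂ * Real.cos t) -
          Real.sin t * sinhDiv p₂ (Real.cos t) * Complex.I)) := by
  simp only [NW, chiralCenter_smul, chiralCenter_add, chiralCenter_mul, chiralCenter_rot,
    antilin_rot, hF, chiralCenter_sub, chiralCenter_one, chiralCenter_mI]
  push_cast
  ring

lemma antilin_NW (F : M2) (p₁ p₂ s t : ℝ) :
    antilin (NW p₁ p₂ t (rot s * F)) = Real.exp (p₁ * Real.cos t) *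
      sinhDiv p₂ (Real.cos t) * Complex.exp (s * Complex.I) * antilin F := by
  simp only [NW, antilin_smul, antilin_add, antilin_mul, chiralCenter_rot, antilin_rot,
    antilin_sub, antilin_one, antilin_mI]
  push_cast
  ring

end

end Magnus

namespace Magnus

noncomputable section

/-! ### Locally Lipschitz functions on the line -/

section LocallyLipschitz

variable {E : Type*} [NormedAddCommGroup E] [NormedSpace ℝ E]

/-- On a compact interval F is Lipschitz, hence absolutely continuous, so an almost everywhere
vanishing derivative suffices. -/
lemma eq_of_ae_hasDerivAt_zero {F : ℝ → E} (hF : LocallyLipschitz F) {a b : ℝ} (hab : a ≤ b)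
    (h : ∀ᵐ s, s ∈ Icc a b → HasDerivAt F 0 s) {s : ℝ} (hs : s ∈ Icc a b) : F s = F a := by
  obtain ⟨K, hK⟩ := (hF.locallyLipschitzOn (s := uIcc a b)).exists_lipschitzOnWith_of_compact
    isCompact_uIcc
  obtain ⟨C, hC⟩ := hK.absolutelyContinuousOnInterval.const_of_ae_hasDerivAt_zero
    (by rwa [uIcc_of_le hab])
  rw [uIcc_of_le hab] at hC
  rw [hC s hs, hC a (left_mem_Icc.2 hab)]

lemma locallyLipschitz_integral {h : ℝ → E} (hm : AEStronglyMeasurable h volume) {B : ℝ → ℝ}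
    (hB : Continuous B) (hb : ∀ s, ‖h s‖ ≤ B s) (c : ℝ) :
    LocallyLipschitz (fun s => ∫ σ in c..s, h σ) := by
  have hint : ∀ x y, IntervalIntegrable h volume x y := fun x y =>
    (hB.intervalIntegrable x y).mono_fun' hm.restrict (.of_forall hb)
  intro x
  obtain ⟨M, hM⟩ := (isCompact_Icc (a := x - 1) (b := x + 1)).exists_bound_of_continuousOn
    hB.continuousOn
  refine ⟨M.toNNReal, Icc (x - 1) (x + 1), Icc_mem_nhds (by linarith) (by linarith), ?_⟩
  refine LipschitzOnWith.of_dist_le_mul fun s hs t ht => ?_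
  rw [dist_eq_norm, intervalIntegral.integral_interval_sub_left (hint _ _) (hint _ _),
    Real.dist_eq]
  refine intervalIntegral.norm_integral_le_of_norm_le_const fun σ hσ => ?_
  have hσ' : σ ∈ Icc (x - 1) (x + 1) :=
    (ordConnected_Icc.uIcc_subset ht hs) (uIoc_subset_uIcc hσ)
  exact (hb σ).trans (((le_abs_self _).trans (hM σ hσ')).trans (Real.le_coe_toNNReal M))

variable [CompleteSpace E]

lemma sub_eq_integral_deriv [SecondCountableTopology E] {F : ℝ → E} (hF : LocallyLipschitz F)
    {a b : ℝ} (hab : a ≤ b)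
    (h : ∀ᵐ s, s ∈ Icc a b → DifferentiableAt ℝ F s) :
    (∀ s ∈ Icc a b, F s - F a = ∫ σ in a..s, deriv F σ) := by
  obtain ⟨K, hK⟩ := (hF.locallyLipschitzOn (s := Icc (a - 1) (b + 1))).exists_lipschitzOnWith_of_compact
    isCompact_Icc
  -- The truncation is bounded everywhere by the Lipschitz constant of the slightly larger interval,
  -- so its primitive is locally Lipschitz and can be compared with F.
  set g : ℝ → E := (Icc a b).indicator (deriv F) with hg
  have hgm : AEStronglyMeasurable g volume :=
    ((stronglyMeasurable_deriv F).indicator measurableSet_Icc).aestronglyMeasurable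
  have hgb : ∀ s, ‖g s‖ ≤ K := by
    intro s
    by_cases hs : s ∈ Icc a b
    · rw [hg, indicator_of_mem hs]
      exact norm_deriv_le_of_lipschitzOn
        (Icc_mem_nhds (by linarith [hs.1]) (by linarith [hs.2])) hK
    · rw [hg, indicator_of_notMem hs, norm_zero]; exact K.2
  have hgi : LocallyIntegrable g volume := by
    refine (locallyIntegrable_const (K : ℝ)).mono hgm (.of_forall fun s => ?_)
    exact (hgb s).trans (le_abs_self _)
  have hG := locallyLipschitz_integral hgm continuous_const hgb a
  intro s hs
  have key := eq_of_ae_hasDerivAt_zero (F := fun s => F s - ∫ σ in a..s, g σ) (hF.sub hG) hab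
    (by
      filter_upwards [h, _root_.LocallyIntegrable.ae_hasDerivAt_integral hgi] with x hx hgx hxs
      have := (hx hxs).hasDerivAt.sub (hgx a)
      rw [hg, indicator_of_mem hxs, sub_self] at this
      exact this) hs
  have hcongr : ∫ σ in a..s, g σ = ∫ σ in a..s, deriv F σ := by
    refine intervalIntegral.integral_congr fun x hx => ?_
    rw [uIcc_of_le hs.1] at hx
    exact indicator_of_mem (show x ∈ Icc a b from ⟨hx.1, hx.2.trans hs.2⟩) _
  rw [intervalIntegral.integral_same, sub_zero] at key
  rw [← hcongr, ← key, sub_sub_cancel]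

/-- A form of Grönwall's lemma. -/
lemma eq_zero_of_norm_deriv_le [SecondCountableTopology E] {D D' : ℝ → E}
    (hD : LocallyLipschitz D) {a b : ℝ} (hab : a ≤ b) {K : ℝ}
    (h : ∀ᵐ s, s ∈ Icc a b → HasDerivAt D (D' s) s ∧ ‖D' s‖ ≤ K * ‖D s‖) (h0 : D a = 0)
    {s : ℝ} (hs : s ∈ Icc a b) : D s = 0 := by
  have hc : Continuous D := hD.continuous
  -- D is differentiable only almost everywhere. Grönwall's inequality is therefore applied to the
  -- C¹ function H, for which the integrated hypothesis reads H' ≤ K H.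
  set H : ℝ → ℝ := fun s => ∫ σ in a..s, ‖D σ‖
  have hH : ∀ s, HasDerivAt H ‖D s‖ s := fun s =>
    (hc.norm.integral_hasStrictDerivAt a s).hasDerivAt
  have hDH : ∀ s ∈ Icc a b, ‖D s‖ ≤ K * H s := by
    intro s hs
    have := sub_eq_integral_deriv hD hab
      (by filter_upwards [h] with x hx hxs using (hx hxs).1.differentiableAt) s hs
    rw [h0, sub_zero] at this
    rw [this, ← intervalIntegral.integral_const_mul]
    refine intervalIntegral.norm_integral_le_of_norm_le hs.1 ?_
      ((hc.norm.const_mul K).intervalIntegrable _ _)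
    filter_upwards [h] with x hx hxs
    have hx' := hx ⟨hxs.1.le, hxs.2.trans hs.2⟩
    rw [hx'.1.deriv]
    exact hx'.2
  have hH0 : ∀ s ∈ Icc a b, 0 ≤ H s := fun s hs =>
    intervalIntegral.integral_nonneg hs.1 fun _ _ => norm_nonneg _
  have := norm_le_gronwallBound_of_norm_deriv_right_le (f := H) (f' := fun s => ‖D s‖)
    (δ := 0) (K := K) (ε := 0) (a := a) (b := b)
    (fun s _ => (hH s).continuousAt.continuousWithinAt)
    (fun s _ => (hH s).hasDerivWithinAt) (by simp [H])
    (fun s hs => by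
      rw [add_zero, norm_norm, Real.norm_of_nonneg (hH0 s (Ico_subset_Icc_self hs))]
      exact hDH s (Ico_subset_Icc_self hs)) s hs
  rw [gronwallBound_ε0_δ0, norm_le_zero_iff] at this
  have h2 := hDH s hs
  rw [this, mul_zero] at h2
  exact norm_le_zero_iff.1 h2

end LocallyLipschitz

/-! ### Densities and their flows -/

/-- A measurable density of norm at most one, supported on `[0, p]`. -/
structure IsDensity (f : ℝ → M2) (p : ℝ) : Prop where
  meas : StronglyMeasurable f
  norm_le : ∀ s, ‖f s‖ ≤ 1
  eq_zero : ∀ s, s ∉ Icc 0 p → f s = 0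

/-- The iterated integrals of a density. -/
def picard (f : ℝ → M2) : ℕ → ℝ → M2
  | 0, _ => 1
  | n + 1, s => ∫ σ in (0 : ℝ)..s, f σ * picard f n σ

/-- The solution of `U' = f U`, `U 0 = 1`. -/
def flow (f : ℝ → M2) (s : ℝ) : M2 := ∑' n, picard f n s

namespace IsDensity

variable {f : ℝ → M2} {p : ℝ}

lemma intervalIntegrable_mul (hf : IsDensity f p) {g : ℝ → M2} (hg : Continuous g) (a b : ℝ) :
    IntervalIntegrable (fun s => f s * g s) volume a b := by
  refine (hg.norm.intervalIntegrable a b).mono_fun'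
    (hf.meas.mul hg.stronglyMeasurable).aestronglyMeasurable (.of_forall fun s => ?_)
  exact (norm_mul_le _ _).trans (mul_le_of_le_one_left (norm_nonneg _) (hf.norm_le s))

lemma continuous_picard (hf : IsDensity f p) (n : ℕ) : Continuous (picard f n) := by
  induction n with
  | zero => exact continuous_const
  | succ n ih => exact intervalIntegral.continuous_primitive (hf.intervalIntegrable_mul ih) 0

lemma integral_eq_zero (hf : IsDensity f p) {s : ℝ} (hs : s ≤ 0) (g : ℝ → M2) :
    ∫ σ in (0 : ℝ)..s, f σ * g σ = 0 := by
  rw [intervalIntegral.integral_of_ge hs, neg_eq_zero]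
  rw [integral_Ioc_eq_integral_Ioo]
  refine setIntegral_eq_zero_of_forall_eq_zero fun σ hσ => ?_
  rw [hf.eq_zero σ (fun h => absurd h.1 (not_le.2 hσ.2)), zero_mul]

/-- For s ≤ 0 all terms after the zeroth vanish, as the density is supported in [0, p]. For s > 0
this is the usual Picard estimate. -/
lemma norm_picard_le (hf : IsDensity f p) (n : ℕ) (s : ℝ) :
    ‖picard f n s‖ ≤ |s| ^ n / n.factorial := by
  induction n generalizing s with
  | zero => simp [picard]
  | succ n ih =>
    rcases le_or_gt s 0 with hs | hs
    · rw [picard, hf.integral_eq_zero hs, norm_zero]; positivity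
    · have hint : ∫ σ in (0 : ℝ)..s, σ ^ n / n.factorial = |s| ^ (n + 1) / (n + 1).factorial := by
        rw [intervalIntegral.integral_div, integral_pow, abs_of_pos hs, Nat.factorial_succ]
        push_cast
        field_simp
        simp
      rw [← hint, picard]
      refine intervalIntegral.norm_integral_le_of_norm_le hs.le (.of_forall fun σ hσ => ?_)
        (Continuous.intervalIntegrable (by fun_prop) _ _)
      have := ih σ
      rw [abs_of_pos hσ.1] at this
      exact (norm_mul_le _ _).trans
        ((mul_le_of_le_one_left (norm_nonneg _) (hf.norm_le σ)).trans this)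

lemma summable_picard (hf : IsDensity f p) (s : ℝ) : Summable (fun n => picard f n s) :=
  .of_norm_bounded (Real.summable_pow_div_factorial |s|) fun n => hf.norm_picard_le n s

lemma continuous_flow (hf : IsDensity f p) : Continuous (flow f) := by
  rw [continuous_iff_continuousAt]
  intro x
  have : ContinuousOn (flow f) (Icc (x - 1) (x + 1)) := by
    refine continuousOn_tsum (fun n => (hf.continuous_picard n).continuousOn)
      (Real.summable_pow_div_factorial (|x| + 1)) fun n s hs => ?_
    refine (hf.norm_picard_le n s).trans ?_
    gcongr
    rw [abs_le]
    constructor <;> linarith [hs.1, hs.2, neg_abs_le x, le_abs_self x]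
  exact this.continuousAt (Icc_mem_nhds (by linarith) (by linarith))

lemma flow_eq (hf : IsDensity f p) (s : ℝ) :
    flow f s = 1 + ∫ σ in (0 : ℝ)..s, f σ * flow f σ := by
  have h : HasSum (fun n => picard f (n + 1) s) (∫ σ in (0 : ℝ)..s, f σ * flow f σ) := by
    refine intervalIntegral.hasSum_integral_of_dominated_convergence
      (fun n _ => |s| ^ n / n.factorial)
      (fun n => (hf.meas.mul (hf.continuous_picard n).stronglyMeasurable).aestronglyMeasurable)
      (fun n => .of_forall fun σ hσ => ?_) (.of_forall fun _ _ =>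
        Real.summable_pow_div_factorial |s|) ?_
      (.of_forall fun σ _ => (hf.summable_picard σ).hasSum.mul_left (f σ))
    · refine (norm_mul_le _ _).trans
        ((mul_le_of_le_one_left (norm_nonneg _) (hf.norm_le σ)).trans
          ((hf.norm_picard_le n σ).trans ?_))
      have := abs_sub_left_of_mem_uIcc (uIoc_subset_uIcc hσ)
      rw [sub_zero, sub_zero] at this
      gcongr
    · exact intervalIntegrable_const
  rw [flow, (hf.summable_picard s).tsum_eq_zero_add, h.tsum_eq, picard]

lemma flow_zero (hf : IsDensity f p) : flow f 0 = 1 := by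
  rw [hf.flow_eq]; simp

lemma locallyLipschitz_flow (hf : IsDensity f p) : LocallyLipschitz (flow f) := by
  have h := locallyLipschitz_integral
    (hf.meas.mul hf.continuous_flow.stronglyMeasurable).aestronglyMeasurable
    hf.continuous_flow.norm (fun s => (norm_mul_le _ _).trans
        (mul_le_of_le_one_left (norm_nonneg _) (hf.norm_le s))) 0
  have : flow f = fun s => 1 + ∫ σ in (0 : ℝ)..s, f σ * flow f σ := funext hf.flow_eq
  rw [this]
  exact (LocallyLipschitz.const 1).add h

lemma ae_hasDerivAt_flow (hf : IsDensity f p) :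
    ∀ᵐ s, HasDerivAt (flow f) (f s * flow f s) s := by
  have hl : LocallyIntegrable (fun s => f s * flow f s) volume := by
    refine hf.continuous_flow.norm.locallyIntegrable.mono
      (hf.meas.mul hf.continuous_flow.stronglyMeasurable).aestronglyMeasurable
      (.of_forall fun s => ?_)
    rw [norm_norm]
    exact (norm_mul_le _ _).trans (mul_le_of_le_one_left (norm_nonneg _) (hf.norm_le s))
  filter_upwards [_root_.LocallyIntegrable.ae_hasDerivAt_integral hl] with s hs
  have : flow f = fun s => 1 + ∫ σ in (0 : ℝ)..s, f σ * flow f σ := funext hf.flow_eq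
  nth_rw 1 [this]
  exact (hs 0).const_add 1

end IsDensity

end

end Magnus

namespace Magnus

noncomputable section

/-! ### Integration against measures with density -/

section Density

variable {X E F G : Type*} [NormedAddCommGroup E] [NormedSpace ℝ E]
  [NormedAddCommGroup F] [NormedAddCommGroup G] [NormedSpace ℝ G] {f : X → F}

lemma integrable_of_norm_le_one [MeasurableSpace X] {ν : Measure X} [IsFiniteMeasure ν]
    (hm : StronglyMeasurable f) (hf : ∀ s, ‖f s‖ ≤ 1) : Integrable f ν :=
  .of_bound hm.aestronglyMeasurable 1 (.of_forall hf)

variable [NormedSpace ℝ F]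

lemma variation_withDensity_le [MeasurableSpace X] {ν : Measure X} [IsFiniteMeasure ν]
    [CompleteSpace F] (hm : StronglyMeasurable f) (hf : ∀ s, ‖f s‖ ≤ 1) :
    (ν.withDensityᵥ f).variation ≤ ν := by
  rw [Measure.variation_withDensityᵥ (integrable_of_norm_le_one hm hf)]
  calc ν.withDensity (fun x => ‖f x‖ₑ) ≤ ν.withDensity 1 := by
        refine withDensity_mono (.of_forall fun s => ?_)
        change ‖f s‖ₑ ≤ 1
        rw [← ofReal_norm]
        exact ENNReal.ofReal_le_one.2 (hf s)
    _ = ν := withDensity_one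

lemma norm_bilin_le (B : E →L[ℝ] F →L[ℝ] G) (hf : ∀ s, ‖f s‖ ≤ 1) (x : E) (s : X) :
    ‖B x (f s)‖ ≤ ‖B‖ * ‖x‖ :=
  (B.le_opNorm₂ x (f s)).trans (mul_le_of_le_one_right (by positivity) (hf s))

variable [MeasurableSpace X] {ν : Measure X}

lemma integrable_bilin (B : E →L[ℝ] F →L[ℝ] G) (hm : StronglyMeasurable f)
    (hf : ∀ s, ‖f s‖ ≤ 1) {g : X → E} (hg : Integrable g ν) :
    Integrable (fun s => B (g s) (f s)) ν := by
  refine (hg.norm.const_mul ‖B‖).mono' (B.aestronglyMeasurable_comp₂ hg.aestronglyMeasurable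
    hm.aestronglyMeasurable) (.of_forall fun s => norm_bilin_le B hf (g s) s)

/-- The vector-measure integral is built from the variation. As the variation is at most ν, it can
be rebuilt over ν, and both sides are then additive and continuous in the L¹(ν) norm, so indicator
functions suffice. -/
lemma integral_withDensity [IsFiniteMeasure ν] [CompleteSpace F] [CompleteSpace G]
    (B : E →L[ℝ] F →L[ℝ] G) (hm : StronglyMeasurable f)
    (hf : ∀ s, ‖f s‖ ≤ 1) {g : X → E} (hg : Integrable g ν) :
    (ν.withDensityᵥ f).integral g B = ∫ s, B (g s) (f s) ∂ν := by
  set φ := ν.withDensityᵥ f with hφ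
  have hle : φ.variation ≤ ν := variation_withDensity_le hm hf
  have hfi : Integrable f ν := integrable_of_norm_le_one hm hf
  have : IsFiniteMeasure φ.variation := isFiniteMeasure_of_le _ hle
  have hdom : DominatedFinMeasAdditive ν (φ.transpose B) ‖B‖ := by
    obtain ⟨h1, h2⟩ := dominatedFinMeasAdditive_cbmApplyMeasure φ B
    refine ⟨fun s t hs ht _ _ hd => h1 s t hs ht (measure_ne_top _ _) (measure_ne_top _ _) hd,
      fun s hs _ => (h2 s hs (measure_lt_top _ _)).trans ?_⟩
    gcongr
    exact ENNReal.toReal_mono (measure_ne_top _ _) (hle s)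
  have hint : φ.integral g B = setToFun ν (φ.transpose B) hdom g :=
    (setToFun_congr_measure_of_integrable 1 ENNReal.one_ne_top (by simpa using hle) hdom _ g
      hg).symm
  rw [hint]
  clear hint
  refine Integrable.induction (P := fun g => setToFun ν (φ.transpose B) hdom g =
    ∫ s, B (g s) (f s) ∂ν) ?_ ?_ ?_ ?_ hg
  · intro c s hs hνs
    rw [setToFun_indicator_const hdom hs hνs.ne]
    change B c (φ s) = _
    rw [hφ, withDensityᵥ_apply hfi hs]
    have : (fun x => B (s.indicator (fun _ => c) x) (f x)) =
        s.indicator (fun x => B c (f x)) := by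
      ext1 x
      by_cases hx : x ∈ s <;> simp [hx]
    rw [this, integral_indicator hs]
    exact ((B c).integral_comp_comm hfi.integrableOn).symm
  · intro g h _ hg hh h1 h2
    rw [setToFun_add hdom hg hh, h1, h2, ← integral_add
      (integrable_bilin B hm hf hg) (integrable_bilin B hm hf hh)]
    simp only [Pi.add_apply, map_add, add_apply]
  · refine isClosed_eq (continuous_setToFun hdom) ?_
    refine (LipschitzWith.of_dist_le_mul (K := ‖B‖₊) fun g h => ?_).continuous
    rw [dist_eq_norm, ← integral_sub (integrable_bilin B hm hf (L1.integrable_coeFn g))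
      (integrable_bilin B hm hf (L1.integrable_coeFn h)),
      dist_eq_norm, L1.norm_eq_integral_norm, coe_nnnorm, ← integral_const_mul]
    refine norm_integral_le_of_norm_le ((L1.integrable_coeFn _).norm.const_mul _) ?_
    filter_upwards [Lp.coeFn_sub g h] with s hs
    rw [hs, Pi.sub_apply, ← sub_apply, ← map_sub]
    exact norm_bilin_le B hf _ s
  · intro g h hgh _ h1
    rw [← setToFun_congr_ae hdom hgh, h1]
    refine integral_congr_ae ?_
    filter_upwards [hgh] with s hs
    rw [hs]

lemma restrict_withDensity (hf : Integrable f ν) {s : Set X}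
    (hs : MeasurableSet s) : (ν.withDensityᵥ f).restrict s = (ν.restrict s).withDensityᵥ f := by
  ext1 t ht
  rw [VectorMeasure.restrict_apply _ hs ht, withDensityᵥ_apply hf (ht.inter hs),
    withDensityᵥ_apply hf.integrableOn ht, Measure.restrict_restrict ht]

end Density

lemma integral_withDensity_leftMul {ν : Measure ℝ} [IsFiniteMeasure ν] {f g : ℝ → M2}
    (hm : StronglyMeasurable f) (hf : ∀ s, ‖f s‖ ≤ 1) (hg : Integrable g ν) :
    (ν.withDensityᵥ f).integral g leftMul = ∫ s, f s * g s ∂ν :=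
  integral_withDensity _ hm hf hg

/-! ### The time-ordered exponential as a flow -/

lemma IsDensity.integral_restrict {f : ℝ → M2} {p : ℝ} (hf : IsDensity f p) (y : ℝ)
    (g : ℝ → M2) : ∫ s in Iic y, f s * g s ∂(volume.restrict (Icc 0 p)) =
      ∫ s in (0 : ℝ)..y, f s * g s := by
  rw [Measure.restrict_restrict measurableSet_Iic]
  rcases le_or_gt y 0 with hy | hy
  · rw [hf.integral_eq_zero hy]
    have : (Iic y ∩ Icc 0 p : Set ℝ) =ᵐ[volume] (∅ : Set ℝ) := by
      rw [ae_eq_empty]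
      refine measure_mono_null (t := {0}) (fun s hs => ?_) Real.volume_singleton
      exact le_antisymm (le_trans hs.1 hy) hs.2.1
    rw [setIntegral_congr_set this, setIntegral_empty]
  · rw [intervalIntegral.integral_of_le hy.le, ← integral_Icc_eq_integral_Ioc]
    have h1 : Iic y ∩ Icc 0 p ⊆ Icc 0 y := fun s hs => ⟨hs.2.1, hs.1⟩
    refine (setIntegral_eq_of_subset_of_forall_sdiff_eq_zero measurableSet_Icc h1
      fun s hs => ?_).symm
    rw [hf.eq_zero s (fun h => hs.2 ⟨hs.1.2, h⟩), zero_mul]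

variable {φ : VectorMeasure ℝ M2} {f : ℝ → M2} {p : ℝ} {G : ℝ → ℝ}

/-- The change of variable G converts each iterated integral into the next Picard iterate. The
push-forward is prescribed for every restriction to a ray, because the preimage of a ray under G may
be larger than the ray where G is constant. -/
lemma iterInt_eq_picard (hf : IsDensity f p) (hfin : φ.variation univ ≠ ∞) (hG : Measurable G)
    (hmem : ∀ᵐ x ∂φ.variation, G x ∈ Icc 0 p)
    (hφ : ∀ x, (φ.restrict (Iic x)).map G =
      ((volume.restrict (Icc 0 p)).restrict (Iic (G x))).withDensityᵥ f) (n : ℕ) (x : ℝ) :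
    iterInt φ n x = picard f n (G x) := by
  have : IsFiniteMeasure φ.variation := ⟨hfin.lt_top⟩
  induction n generalizing x with
  | zero => rfl
  | succ n ih =>
    have hc := hf.continuous_picard n
    obtain ⟨C, hC⟩ := (isCompact_Icc (a := 0) (b := p)).exists_bound_of_continuousOn
      hc.continuousOn
    have hint : (φ.restrict (Iic x)).Integrable (picard f n ∘ G) := by
      refine .of_bound (hc.stronglyMeasurable.comp_measurable hG).aestronglyMeasurable C ?_
      rw [VectorMeasure.variation_restrict measurableSet_Iic]
      exact ae_restrict_of_ae (hmem.mono fun s hs => hC _ hs)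
    have hint' : Integrable (picard f n) ((volume.restrict (Icc 0 p)).restrict (Iic (G x))) := by
      refine .of_bound hc.aestronglyMeasurable C ?_
      exact ae_restrict_of_ae ((ae_restrict_mem measurableSet_Icc).mono fun s hs => hC _ hs)
    have hfun : (fun s => iterInt φ n s) = fun s => picard f n (G s) := funext ih
    rw [iterInt, hfun, ← VectorMeasure.integral_map hG hc.aestronglyMeasurable hint, hφ,
      integral_withDensity_leftMul hf.meas hf.norm_le hint', hf.integral_restrict, picard]

lemma iterInt_restrict_Iic (φ : VectorMeasure ℝ M2) (n : ℕ) {x y : ℝ} (hy : y ≤ x) :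
    iterInt (φ.restrict (Iic x)) n y = iterInt φ n y := by
  induction n generalizing y with
  | zero => rfl
  | succ n ih =>
    rw [iterInt, iterInt, VectorMeasure.restrict_restrict _ measurableSet_Iic measurableSet_Iic,
      Iic_inter_Iic, min_eq_left hy]
    exact VectorMeasure.setIntegral_congr_fun fun s hs => ih (le_trans hs hy)

lemma Lexp_restrict_Iic (hf : IsDensity f p) (hfin : φ.variation univ ≠ ∞) (hG : Measurable G)
    (hmem : ∀ᵐ x ∂φ.variation, G x ∈ Icc 0 p)
    (hφ : ∀ x, (φ.restrict (Iic x)).map G =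
      ((volume.restrict (Icc 0 p)).restrict (Iic (G x))).withDensityᵥ f) (x : ℝ) :
    Lexp (φ.restrict (Iic x)) = flow f (G x) := by
  rw [Lexp, flow, (hf.summable_picard _).tsum_eq_zero_add, picard]
  congr 2
  ext1 n
  rw [← iterInt_eq_picard hf hfin hG hmem hφ, iterInt]
  exact VectorMeasure.setIntegral_congr_fun fun s hs => iterInt_restrict_Iic φ n hs

end

end Magnus

namespace Magnus

noncomputable section

/-! ### The cumulative norm of an ordered measure -/

namespace IsOrderedMeasure

variable {φ : VectorMeasure ℝ M2} {a b : ℝ}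

lemma isFiniteMeasure (h : IsOrderedMeasure φ a b) : IsFiniteMeasure φ.variation :=
  ⟨h.finite_variation.lt_top⟩

lemma variation_eq_restrict (h : IsOrderedMeasure φ a b) :
    φ.variation = φ.variation.restrict (Icc a b) := by
  rw [← VectorMeasure.variation_restrict measurableSet_Icc, h.supported]

lemma variation_eq_zero (h : IsOrderedMeasure φ a b) {s : Set ℝ} (hs : s ⊆ (Icc a b)ᶜ) :
    φ.variation s = 0 := by
  refine measure_mono_null hs ?_
  rw [h.variation_eq_restrict, Measure.restrict_apply measurableSet_Icc.compl,
    compl_inter_self, measure_empty]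

/-- A singleton has only two subsets and φ vanishes on both, so its variation vanishes as well. -/
lemma noAtoms (h : IsOrderedMeasure φ a b) : NullSingletonClass φ.variation := by
  refine ⟨fun x => (VectorMeasure.variation_apply_eq_zero (measurableSet_singleton x)).2
    fun t ht _ => ?_⟩
  rcases subset_singleton_iff_eq.1 ht with rfl | rfl
  · exact φ.empty
  · exact h.atomless x

lemma variation_Iic_left (h : IsOrderedMeasure φ a b) {x : ℝ} (hx : x ≤ a) :
    φ.variation (Iic x) = 0 := by
  have := h.noAtoms
  rw [← measure_congr (Iio_ae_eq_Iic (μ := φ.variation))]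
  exact h.variation_eq_zero fun s hs hs' => absurd hs'.1 (not_le.2 (lt_of_lt_of_le hs hx))

lemma cumMass_eq (h : IsOrderedMeasure φ a b) (x : ℝ) :
    cumMass φ a x = φ.variation.real (Iic x) := by
  have := h.isFiniteMeasure
  rw [cumMass, mass, VectorMeasure.variation_restrict measurableSet_Icc,
    Measure.restrict_apply_univ, measureReal_def]
  congr 1
  refine le_antisymm (measure_mono Icc_subset_Iic_self) ?_
  calc φ.variation (Iic x) ≤ φ.variation (Icc a x ∪ Iio a) := by
        refine measure_mono fun s hs => ?_
        rcases lt_or_ge s a with h' | h'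
        · exact Or.inr h'
        · exact Or.inl ⟨h', hs⟩
    _ ≤ φ.variation (Icc a x) + φ.variation (Iio a) := measure_union_le _ _
    _ = φ.variation (Icc a x) := by
        rw [h.variation_eq_zero (s := Iio a) fun s hs hs' => absurd hs'.1 (not_le.2 hs), add_zero]

lemma ofReal_cumMass (h : IsOrderedMeasure φ a b) (x : ℝ) :
    ENNReal.ofReal (cumMass φ a x) = φ.variation (Iic x) := by
  have := h.isFiniteMeasure
  rw [h.cumMass_eq, ofReal_measureReal]

lemma monotone_cumMass (h : IsOrderedMeasure φ a b) : Monotone (cumMass φ a) := by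
  have := h.isFiniteMeasure
  intro x y hxy
  rw [h.cumMass_eq, h.cumMass_eq]
  exact measureReal_mono (Iic_subset_Iic.2 hxy)

lemma cumMass_left (h : IsOrderedMeasure φ a b) {x : ℝ} (hx : x ≤ a) : cumMass φ a x = 0 := by
  rw [h.cumMass_eq, measureReal_def, h.variation_Iic_left hx, ENNReal.toReal_zero]

lemma cumMass_right (h : IsOrderedMeasure φ a b) {x : ℝ} (hx : b ≤ x) :
    cumMass φ a x = (mass φ).toReal := by
  rw [h.cumMass_eq, measureReal_def, mass]
  congr 1
  refine le_antisymm (measure_mono (subset_univ _)) ?_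
  rw [← union_compl_self (Iic x)]
  refine (measure_union_le _ _).trans ?_
  rw [h.variation_eq_zero (s := (Iic x)ᶜ) fun s hs hs' => hs (hs'.2.trans hx), add_zero]

lemma cumMass_mem (h : IsOrderedMeasure φ a b) (x : ℝ) :
    cumMass φ a x ∈ Icc 0 (mass φ).toReal := by
  constructor
  · rw [h.cumMass_eq]; exact measureReal_nonneg
  · rw [← h.cumMass_right (le_max_right x b)]
    exact h.monotone_cumMass (le_max_left x b)

lemma continuous_cumMass (h : IsOrderedMeasure φ a b) : Continuous (cumMass φ a) := by
  have := h.isFiniteMeasure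
  have := h.noAtoms
  have hc := (integrable_const (μ := φ.variation) (1 : ℝ)).continuous_primitive a
  convert hc using 2 with x
  rcases le_total a x with hx | hx
  · rw [intervalIntegral.integral_of_le hx, setIntegral_const, smul_eq_mul, mul_one, h.cumMass_eq,
      ← Iic_union_Ioc_eq_Iic hx, measureReal_union (by
        rw [disjoint_left]; exact fun s hs hs' => absurd hs (not_le.2 hs'.1)) measurableSet_Ioc,
      measureReal_def _ (Iic a), h.variation_Iic_left le_rfl, ENNReal.toReal_zero, zero_add]
  · rw [intervalIntegral.integral_of_ge hx, setIntegral_const, smul_eq_mul, mul_one,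
      h.cumMass_left hx, measureReal_def, measure_mono_null Ioc_subset_Iic_self
        (h.variation_Iic_left le_rfl), ENNReal.toReal_zero, neg_zero]

lemma surjOn_cumMass (h : IsOrderedMeasure φ a b) :
    SurjOn (cumMass φ a) (Icc a b) (Icc 0 (mass φ).toReal) := by
  have := intermediate_value_Icc h.le h.continuous_cumMass.continuousOn
  rwa [h.cumMass_left le_rfl, h.cumMass_right le_rfl] at this

/-- The probability integral transform: for 0 ≤ s < p the sublevel set of the continuous
distribution function is a ray at whose endpoint the value s is attained, so its mass is exactly s.
-/
lemma map_cumMass (h : IsOrderedMeasure φ a b) :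
    φ.variation.map (cumMass φ a) = volume.restrict (Icc 0 (mass φ).toReal) := by
  have := h.isFiniteMeasure
  set p := (mass φ).toReal with hp
  have hmass : φ.variation univ = ENNReal.ofReal p := by
    rw [hp, mass, ENNReal.ofReal_toReal h.finite_variation]
  have hG := h.continuous_cumMass
  have : IsFiniteMeasure (φ.variation.map (cumMass φ a)) :=
    Measure.isFiniteMeasure_map _ _
  refine Measure.ext_of_Iic _ _ fun s => ?_
  rw [Measure.map_apply hG.measurable measurableSet_Iic, Measure.restrict_apply measurableSet_Iic]
  rcases lt_or_ge s 0 with hs | hs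
  · rw [(_ : cumMass φ a ⁻¹' Iic s = ∅), (_ : Iic s ∩ Icc 0 p = ∅), measure_empty, measure_empty]
    · exact eq_empty_of_forall_notMem fun x hx => absurd (hx.2.1.trans hx.1) (not_le.2 hs)
    · exact eq_empty_of_forall_notMem fun x hx =>
        absurd ((h.cumMass_mem x).1.trans hx) (not_le.2 hs)
  rcases le_or_gt p s with hps | hps
  · rw [(_ : cumMass φ a ⁻¹' Iic s = univ), (_ : Iic s ∩ Icc 0 p = Icc 0 p), hmass,
      Real.volume_Icc, sub_zero]
    · exact inter_eq_right.2 fun x hx => hx.2.trans hps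
    · exact eq_univ_of_forall fun x => (h.cumMass_mem x).2.trans hps
  set S := cumMass φ a ⁻¹' Iic s
  have hne : S.Nonempty := ⟨a, by simpa [S, h.cumMass_left le_rfl] using hs⟩
  have hbdd : BddAbove S := ⟨b, fun x hx => by
    by_contra hxb
    rw [not_le] at hxb
    have : cumMass φ a x ≤ s := hx
    rw [h.cumMass_right hxb.le] at this
    exact absurd this (not_le.2 hps)⟩
  have hmem : sSup S ∈ S := (isClosed_Iic.preimage hG).csSup_mem hne hbdd
  have hSeq : S = Iic (sSup S) := by
    refine Subset.antisymm (fun x hx => le_csSup hbdd hx) fun x hx => ?_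
    exact (h.monotone_cumMass hx).trans hmem
  have hval : cumMass φ a (sSup S) = s := by
    obtain ⟨y, -, hy⟩ := h.surjOn_cumMass ⟨hs, hps.le⟩
    exact le_antisymm hmem (hy ▸ h.monotone_cumMass (le_csSup hbdd hy.le))
  rw [hSeq, ← h.ofReal_cumMass, hval, (_ : Iic s ∩ Icc 0 p = Icc 0 s), Real.volume_Icc, sub_zero]
  ext x
  simp only [mem_inter_iff, mem_Iic, mem_Icc]
  exact ⟨fun hx => ⟨hx.2.1, hx.1⟩, fun hx => ⟨hx.2, hx.1, hx.2.trans hps.le⟩⟩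

end IsOrderedMeasure

/-! ### Densities of matrix measures -/

/-- A form of the Radon–Nikodym theorem for matrix measures. -/
lemma exists_density_of_variation_le {ν : Measure ℝ} [IsFiniteMeasure ν]
    {φ : VectorMeasure ℝ M2} (hφ : φ.variation ≤ ν) :
    ∃ f : ℝ → M2, StronglyMeasurable f ∧ (∀ s, ‖f s‖ ≤ 1) ∧ φ = ν.withDensityᵥ f := by
  have hfin : IsFiniteMeasure φ.variation := isFiniteMeasure_of_le _ hφ
  have hcont : ∀ i j, Continuous (Matrix.entryAddMonoidHom ℝ i j : M2 →+ ℝ) := fun i j =>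
    continuous_id.matrix_elem i j
  -- The scalar Radon–Nikodym theorem is applied to each entry; the norm bound is recovered
  -- afterwards from the variation of the assembled density.
  set σ : Fin 2 → Fin 2 → SignedMeasure ℝ := fun i j =>
    φ.mapRange (Matrix.entryAddMonoidHom ℝ i j) (hcont i j) with hσ
  have hac : ∀ i j, σ i j ≪ᵥ ν.toENNRealVectorMeasure := by
    intro i j
    refine VectorMeasure.AbsolutelyContinuous.mk fun s hs h0 => ?_
    rw [Measure.toENNRealVectorMeasure_apply_measurable hs] at h0
    have h1 := VectorMeasure.enorm_measure_le_variation φ s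
    rw [le_antisymm ((hφ s).trans h0.le) zero_le, nonpos_iff_eq_zero, enorm_eq_zero] at h1
    change φ s i j = 0
    rw [h1]; rfl
  set g : Fin 2 → Fin 2 → ℝ → ℝ := fun i j => (σ i j).rnDeriv ν
  have hgi : ∀ i j, Integrable (g i j) ν := fun i j => SignedMeasure.integrable_rnDeriv _ _
  have hgm : ∀ i j, StronglyMeasurable (g i j) := fun i j =>
    (SignedMeasure.measurable_rnDeriv _ _).stronglyMeasurable
  have hgσ : ∀ i j s, MeasurableSet s → φ s i j = ∫ x in s, g i j x ∂ν := by
    intro i j s hs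
    rw [← withDensityᵥ_apply (hgi i j) hs, SignedMeasure.withDensityᵥ_rnDeriv_eq _ _ (hac i j)]
    rfl
  set f₀ : ℝ → M2 := fun x => ∑ i, ∑ j, g i j x • (Matrix.single i j (1 : ℝ) : M2) with hf₀
  have hf₀m : StronglyMeasurable f₀ := by
    refine Finset.stronglyMeasurable_fun_sum _ fun i _ => ?_
    refine Finset.stronglyMeasurable_fun_sum _ fun j _ => ?_
    exact (hgm i j).smul_const _
  have hf₀i : Integrable f₀ ν :=
    integrable_finsetSum _ fun i _ => integrable_finsetSum _ fun j _ => (hgi i j).smul_const _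
  have hφf₀ : φ = ν.withDensityᵥ f₀ := by
    ext1 s hs
    rw [withDensityᵥ_apply hf₀i hs, hf₀, integral_finsetSum _ fun i _ =>
      integrable_finsetSum _ fun j _ => ((hgi i j).integrableOn (s := s)).smul_const _]
    conv_lhs => rw [Matrix.matrix_eq_sum_single (φ s)]
    refine Finset.sum_congr rfl fun i _ => ?_
    rw [integral_finsetSum _ fun j _ => ((hgi i j).integrableOn (s := s)).smul_const _]
    refine Finset.sum_congr rfl fun j _ => ?_
    rw [integral_smul_const, ← hgσ i j s hs, Matrix.smul_single, smul_eq_mul, mul_one]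
  have hle : ∀ᵐ x ∂ν, ‖f₀ x‖ ≤ 1 := by
    have := ae_le_of_forall_setLIntegral_le_of_sigmaFinite (μ := ν) (f := fun x => ‖f₀ x‖ₑ)
      (g := 1) hf₀m.enorm fun s hs _ => by
        rw [← withDensity_apply _ hs, ← Measure.variation_withDensityᵥ hf₀i, ← hφf₀]
        simpa using hφ s
    filter_upwards [this] with x hx
    have hx' : ‖f₀ x‖ₑ ≤ 1 := hx
    rwa [← ofReal_norm, ENNReal.ofReal_le_one] at hx'
  -- The bound holds only almost everywhere; replacing the density by zero on the exceptional null
  -- set makes it hold everywhere.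
  refine ⟨{x | ‖f₀ x‖ ≤ 1}.indicator f₀, ?_, fun s => ?_, ?_⟩
  · exact hf₀m.indicator (measurableSet_le hf₀m.norm.measurable measurable_const)
  · by_cases hs : ‖f₀ s‖ ≤ 1
    · rwa [indicator_of_mem (show s ∈ {x | ‖f₀ x‖ ≤ 1} from hs)]
    · rw [indicator_of_notMem (show s ∉ {x | ‖f₀ x‖ ≤ 1} from hs), norm_zero]; exact zero_le_one
  · rw [hφf₀]
    refine WithDensityᵥEq.congr_ae ?_
    filter_upwards [hle] with x hx
    rw [indicator_of_mem (show x ∈ {x | ‖f₀ x‖ ≤ 1} from hx)]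

/-! ### Reduction to flows -/

/-- An ordered measure is given, after normalization of mass, by a density of norm at most one. -/
theorem IsOrderedMeasure.exists_density {φ : VectorMeasure ℝ M2} {a b : ℝ}
    (h : IsOrderedMeasure φ a b) : ∃ f : ℝ → M2, IsDensity f (mass φ).toReal ∧
      massNormalized φ a = (volume.restrict (Icc 0 (mass φ).toReal)).withDensityᵥ f ∧
      Lexp φ = flow f (mass φ).toReal ∧
      ∀ x ∈ Icc a b, Lexp (φ.restrict (Icc a x)) = flow f (cumMass φ a x) := by
  have := h.isFiniteMeasure
  set p := (mass φ).toReal with hp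
  have hG := h.continuous_cumMass.measurable
  obtain ⟨f₀, hm, hf, hφ⟩ := exists_density_of_variation_le (ν := volume.restrict (Icc 0 p))
    (φ := φ.map (cumMass φ a)) (VectorMeasure.variation_map_le.trans h.map_cumMass.le)
  set f := (Icc 0 p).indicator f₀ with hf_def
  have hfd : IsDensity f p := by
    refine ⟨hm.indicator measurableSet_Icc, fun s => ?_, fun s hs => indicator_of_notMem hs _⟩
    rw [hf_def, norm_indicator_eq_indicator_norm]
    exact indicator_le' (fun _ _ => hf s) (fun _ _ => zero_le_one) s
  have hφf : φ.map (cumMass φ a) = (volume.restrict (Icc 0 p)).withDensityᵥ f := by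
    rw [hφ]
    refine WithDensityᵥEq.congr_ae ?_
    filter_upwards [ae_restrict_mem measurableSet_Icc] with s hs
    rw [hf_def, indicator_of_mem hs]
  have hfi : Integrable f (volume.restrict (Icc 0 p)) :=
    integrable_of_norm_le_one hfd.meas hfd.norm_le
  have hres : ∀ x, (φ.restrict (Iic x)).map (cumMass φ a) =
      ((volume.restrict (Icc 0 p)).restrict (Iic (cumMass φ a x))).withDensityᵥ f := by
    intro x
    rw [← restrict_withDensity hfi measurableSet_Iic, ← hφf]
    ext1 s hs
    rw [VectorMeasure.map_apply _ hG hs, VectorMeasure.restrict_apply _ measurableSet_Iic (hG hs),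
      VectorMeasure.restrict_apply _ measurableSet_Iic hs,
      VectorMeasure.map_apply _ hG (hs.inter measurableSet_Iic), preimage_inter]
    have hsub : Iic x ⊆ cumMass φ a ⁻¹' Iic (cumMass φ a x) := fun y hy =>
      h.monotone_cumMass hy
    -- The preimage of the ray may extend beyond x where the cumulative norm is constant, but that
    -- excess carries no mass.
    have hnull : φ.variation (cumMass φ a ⁻¹' Iic (cumMass φ a x) \ Iic x) = 0 := by
      rw [measure_sdiff hsub measurableSet_Iic.nullMeasurableSet (measure_ne_top _ _),
        ← Measure.map_apply hG measurableSet_Iic, h.map_cumMass,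
        Measure.restrict_apply measurableSet_Iic, ← h.ofReal_cumMass, tsub_eq_zero_iff_le]
      calc volume (Iic (cumMass φ a x) ∩ Icc 0 p) ≤ volume (Icc 0 (cumMass φ a x)) :=
            measure_mono fun y hy => ⟨hy.2.1, hy.1⟩
        _ = _ := by rw [Real.volume_Icc, sub_zero]
    have hdis : Disjoint (cumMass φ a ⁻¹' s ∩ Iic x)
        (cumMass φ a ⁻¹' s ∩ (cumMass φ a ⁻¹' Iic (cumMass φ a x) \ Iic x)) :=
      disjoint_left.2 fun y hy hy' => hy'.2.2 hy.2
    have hun : cumMass φ a ⁻¹' s ∩ cumMass φ a ⁻¹' Iic (cumMass φ a x) =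
        (cumMass φ a ⁻¹' s ∩ Iic x) ∪
          (cumMass φ a ⁻¹' s ∩ (cumMass φ a ⁻¹' Iic (cumMass φ a x) \ Iic x)) := by
      rw [← inter_union_distrib_left, union_sdiff_cancel hsub]
    rw [hun, VectorMeasure.of_union hdis ((hG hs).inter measurableSet_Iic)
      ((hG hs).inter ((hG measurableSet_Iic).diff measurableSet_Iic))]
    have h0 : φ (cumMass φ a ⁻¹' s ∩ (cumMass φ a ⁻¹' Iic (cumMass φ a x) \ Iic x)) = 0 := by
      have := VectorMeasure.enorm_measure_le_variation φ
        (cumMass φ a ⁻¹' s ∩ (cumMass φ a ⁻¹' Iic (cumMass φ a x) \ Iic x))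
      rwa [measure_mono_null inter_subset_right hnull, nonpos_iff_eq_zero, enorm_eq_zero] at this
    rw [h0, add_zero]
  have hL : ∀ x, Lexp (φ.restrict (Iic x)) = flow f (cumMass φ a x) :=
    Lexp_restrict_Iic hfd h.finite_variation hG (.of_forall h.cumMass_mem) hres
  have hIcc : ∀ x ≤ b, φ.restrict (Icc a x) = φ.restrict (Iic x) := by
    intro x hx
    conv_rhs => rw [← h.supported]
    rw [VectorMeasure.restrict_restrict _ measurableSet_Iic measurableSet_Icc]
    congr 1
    ext y
    simp only [mem_Icc, mem_inter_iff, mem_Iic]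
    exact ⟨fun hy => ⟨hy.2, hy.1, hy.2.trans hx⟩, fun hy => ⟨hy.2.1, hy.1⟩⟩
  refine ⟨f, hfd, hφf, ?_, fun x hx => by rw [hIcc x hx.2, hL]⟩
  rw [hp, ← h.cumMass_right le_rfl, ← hL, ← hIcc b le_rfl, h.supported]

/-- The values of flows at time `q` have Magnus exponent at most `q`. -/
theorem IsDensity.magnusExponent_flow_le {f : ℝ → M2} {q : ℝ} (hf : IsDensity f q) (hq : 0 ≤ q) :
    magnusExponent (flow f q) ≤ ENNReal.ofReal q := by
  set ν : Measure ℝ := volume.restrict (Icc 0 q)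
  have hfi : Integrable f ν := integrable_of_norm_le_one hf.meas hf.norm_le
  set φ := ν.withDensityᵥ f with hφ
  have hle : φ.variation ≤ ν := variation_withDensity_le hf.meas hf.norm_le
  have hmass : mass φ ≤ ENNReal.ofReal q := by
    refine (hle univ).trans ?_
    rw [Measure.restrict_apply_univ, Real.volume_Icc, sub_zero]
  have hfin : φ.variation univ ≠ ∞ := (hmass.trans_lt ENNReal.ofReal_lt_top).ne
  have hsupp : ∀ s, MeasurableSet s → Icc 0 q ⊆ s → φ.restrict s = φ := by
    intro s hs hsub
    rw [hφ, restrict_withDensity hfi hs, Measure.restrict_restrict hs, inter_eq_right.2 hsub]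
  have hord : IsOrderedMeasure φ 0 q := by
    refine ⟨hq, hsupp _ measurableSet_Icc le_rfl, fun x => ?_, hfin⟩
    rw [hφ, withDensityᵥ_apply hfi (measurableSet_singleton x),
      Measure.restrict_zero_set (by simp [ν]), integral_zero_measure]
  have hL : Lexp φ = flow f q := by
    have := Lexp_restrict_Iic hf hfin measurable_id
      (hle.absolutelyContinuous.ae_le (ae_restrict_mem measurableSet_Icc)) (fun x => by
        rw [hφ, restrict_withDensity hfi measurableSet_Iic, VectorMeasure.map_id]; rfl) q
    rwa [hsupp _ measurableSet_Iic Icc_subset_Iic_self] at this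
  refine le_trans ?_ hmass
  exact (iInf_le _ φ).trans <| (iInf_le _ 0).trans <| (iInf_le _ q).trans <|
    (iInf_le _ hord).trans (iInf_le _ hL)

end

end Magnus

namespace Magnus

noncomputable section

local notation "conj" => starRingEnd ℂ

/-! ### Trajectories of flows -/

lemma _root_.LocallyLipschitz.mul_exp_neg {x y : ℝ → ℂ} (hx : LocallyLipschitz x)
    (hy : LocallyLipschitz y) : LocallyLipschitz fun s => x s * Complex.exp (-y s) := by
  have hn : ContDiff ℝ 1 fun q : ℂ × ℂ => q.1 * Complex.exp (-q.2) := by fun_prop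
  have h := hn.locallyLipschitz
  exact h.comp (hx.prodMk hy)

/-- Evaluation of the action at a vector, as a continuous linear map. -/
def actL (u : ℂ) : M2 →L[ℝ] ℂ :=
  LinearMap.mkContinuous
    { toFun := fun M => act M u
      map_add' := fun M N => by simp only [act, chiralCenter_add, antilin_add]; ring
      map_smul' := fun c M => by
        simp only [act, chiralCenter_smul, antilin_smul, RingHom.id_apply, Complex.real_smul]
        ring } ‖u‖ fun M =>
    (norm_act_le M u).trans_eq (mul_comm _ _)

/-- The linear part, as a continuous linear map. -/
def centerL : M2 →L[ℝ] ℂ :=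
  LinearMap.mkContinuous
    { toFun := fun M => chiralCenter M
      map_add' := chiralCenter_add
      map_smul' := fun c M => by
        simp only [chiralCenter_smul, RingHom.id_apply, Complex.real_smul] } 1 fun M => by
      rw [one_mul]
      exact (le_add_of_nonneg_right (norm_nonneg _)).trans (norm_add_norm_le M)

/-- The antilinear part, as a continuous linear map. -/
def antilinL : M2 →L[ℝ] ℂ :=
  LinearMap.mkContinuous
    { toFun := fun M => antilin M
      map_add' := antilin_add
      map_smul' := fun c M => by
        simp only [antilin_smul, RingHom.id_apply, Complex.real_smul] } 1 fun M => by
      rw [one_mul]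
      exact (le_add_of_nonneg_left (norm_nonneg _)).trans (norm_add_norm_le M)

namespace IsDensity

variable {f : ℝ → M2} {p : ℝ}

lemma locallyLipschitz_act (hf : IsDensity f p) (u : ℂ) :
    LocallyLipschitz fun s => act (flow f s) u :=
  (actL u).lipschitz.locallyLipschitz.comp hf.locallyLipschitz_flow

lemma ae_hasDerivAt_act (hf : IsDensity f p) (u : ℂ) :
    ∀ᵐ s, HasDerivAt (fun s => act (flow f s) u) (act (f s) (act (flow f s) u)) s := by
  filter_upwards [hf.ae_hasDerivAt_flow] with s hs
  rw [← act_mul]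
  exact (actL u).hasFDerivAt.comp_hasDerivAt s hs

lemma norm_act_le (hf : IsDensity f p) (s : ℝ) (u : ℂ) : ‖act (f s) u‖ ≤ ‖u‖ :=
  (Magnus.norm_act_le _ _).trans (mul_le_of_le_one_left (norm_nonneg _) (hf.norm_le s))

/-- Grönwall applied to the time-reversed trajectory: if it vanished at time s, it would have
vanished at time 0, where it equals u. -/
lemma act_flow_ne_zero (hf : IsDensity f p) {u : ℂ} (hu : u ≠ 0) {s : ℝ} (hs : 0 ≤ s) :
    act (flow f s) u ≠ 0 := by
  intro h0
  have hL : LocallyLipschitz fun σ => act (flow f (s - σ)) u :=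
    (hf.locallyLipschitz_act u).comp (LocallyLipschitz.const s |>.sub .id)
  have hae := (Measure.measurePreserving_sub_left (volume : Measure ℝ) s).quasiMeasurePreserving.ae
    (hf.ae_hasDerivAt_act u)
  have := eq_zero_of_norm_deriv_le (D := fun σ => act (flow f (s - σ)) u)
    (D' := fun σ => (-1 : ℝ) • act (f (s - σ)) (act (flow f (s - σ)) u)) hL hs (K := 1) (by
      filter_upwards [hae] with σ hσ _
      refine ⟨?_, ?_⟩
      · have h1 : HasDerivAt (fun σ => s - σ) (-1) σ := by
          simpa using (hasDerivAt_id σ).const_sub s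
        exact HasDerivAt.scomp σ hσ h1
      · rw [neg_one_smul, norm_neg, one_mul]
        exact hf.norm_act_le _ _) (by simpa using h0) (right_mem_Icc.2 hs)
  rw [sub_self, hf.flow_zero, act_one] at this
  exact hu this

/-- Here g is the logarithmic derivative of the trajectory x(s). It is bounded by the norm of the
density, and x·exp(−∫g) has derivative zero almost everywhere. -/
lemma exists_log (hf : IsDensity f p) {u : ℂ} (hu : u ≠ 0) :
    ∃ g : ℝ → ℂ, StronglyMeasurable g ∧ (∀ s, ‖g s‖ ≤ 1) ∧ ∀ s, 0 ≤ s →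
      act (flow f s) u = u * Complex.exp (∫ σ in (0 : ℝ)..s, g σ) ∧
      act (f s) (act (flow f s) u) = g s * act (flow f s) u := by
  set x : ℝ → ℂ := fun s => act (flow f s) u with hx
  have hxc : Continuous x := (hf.locallyLipschitz_act u).continuous
  have hgm : StronglyMeasurable fun s => act (f s) (x s) / x s := by
    have h1 : StronglyMeasurable fun s => chiralCenter (f s) :=
      centerL.continuous.comp_stronglyMeasurable hf.meas
    have h2 : StronglyMeasurable fun s => antilin (f s) :=
      antilinL.continuous.comp_stronglyMeasurable hf.meas
    exact ((h1.mul hxc.stronglyMeasurable).add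
      (h2.mul (Complex.continuous_conj.comp hxc).stronglyMeasurable)).div hxc.stronglyMeasurable
  have hgb : ∀ s, ‖act (f s) (x s) / x s‖ ≤ 1 := fun s => by
    rw [norm_div]
    exact div_le_one_of_le₀ (hf.norm_act_le _ _) (norm_nonneg _)
  refine ⟨_, hgm, hgb, fun s hs => ⟨?_, ?_⟩⟩
  · set ℓ : ℝ → ℂ := fun s => ∫ σ in (0 : ℝ)..s, act (f σ) (x σ) / x σ with hℓ
    have hℓL : LocallyLipschitz ℓ :=
      locallyLipschitz_integral hgm.aestronglyMeasurable continuous_const hgb 0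
    have hli : LocallyIntegrable (fun s => act (f s) (x s) / x s) volume :=
      (locallyIntegrable_const (1 : ℝ)).mono hgm.aestronglyMeasurable
        (.of_forall fun s => by simpa using hgb s)
    have hxL : LocallyLipschitz x := hf.locallyLipschitz_act u
    have hLL : LocallyLipschitz fun s => x s * Complex.exp (-ℓ s) := hxL.mul_exp_neg hℓL
    have := eq_of_ae_hasDerivAt_zero hLL hs (by
      filter_upwards [hf.ae_hasDerivAt_act u, _root_.LocallyIntegrable.ae_hasDerivAt_integral hli]
        with σ h1 h2 hσ
      have hx0 : x σ ≠ 0 := hf.act_flow_ne_zero hu hσ.1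
      have h3 : HasDerivAt (fun s => x s * Complex.exp (-ℓ s))
          (act (f σ) (x σ) * Complex.exp (-ℓ σ) +
            x σ * (Complex.exp (-ℓ σ) * -(act (f σ) (x σ) / x σ))) σ :=
        h1.mul ((h2 0).neg.cexp)
      have h4 : act (f σ) (x σ) * Complex.exp (-ℓ σ) +
          x σ * (Complex.exp (-ℓ σ) * -(act (f σ) (x σ) / x σ)) = 0 := by
        generalize act (f σ) (x σ) = A
        field_simp
        ring
      rwa [h4] at h3) (right_mem_Icc.2 hs)
    simp only [hℓ, intervalIntegral.integral_same, neg_zero, Complex.exp_zero, mul_one] at this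
    have hx0 : x 0 = u := by simp only [hx, hf.flow_zero, act_one]
    rw [hx0, Complex.exp_neg] at this
    change x s = _
    rw [← this, mul_assoc, inv_mul_cancel₀ (Complex.exp_ne_zero _), mul_one]
  · exact (div_mul_cancel₀ _ (hf.act_flow_ne_zero hu hs)).symm

lemma exists_act_eq_exp (hf : IsDensity f p) (hp : 0 ≤ p) {u : ℂ} (hu : u ≠ 0) :
    ∃ ℓ : ℂ, ‖ℓ‖ ≤ p ∧ act (flow f p) u = u * Complex.exp ℓ := by
  obtain ⟨g, -, hg, h⟩ := hf.exists_log hu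
  refine ⟨_, ?_, (h p hp).1⟩
  simpa [abs_of_nonneg hp] using intervalIntegral.norm_integral_le_of_norm_le_const (a := 0)
    (b := p) (C := 1) fun s _ => hg s

/-- Positivity of the determinant. Equality of the two moduli would produce a nonzero vector in the
kernel of the flow, so the strict inequality at time 0 persists by the intermediate value theorem.
-/
lemma norm_antilin_flow_lt (hf : IsDensity f p) {s : ℝ} (hs : 0 ≤ s) :
    ‖antilin (flow f s)‖ < ‖chiralCenter (flow f s)‖ := by
  have hne : ∀ s, 0 ≤ s → ‖antilin (flow f s)‖ ≠ ‖chiralCenter (flow f s)‖ := by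
    intro s hs heq
    by_cases hw : antilin (flow f s) = 0
    · rw [hw, norm_zero, eq_comm, norm_eq_zero] at heq
      exact hf.act_flow_ne_zero one_ne_zero hs (by rw [act, hw, heq]; simp)
    · obtain ⟨u, hu, hω⟩ := exists_unit_conj_div (-(chiralCenter (flow f s) / antilin (flow f s)))
        (by rw [norm_neg, norm_div, heq, div_self]; rw [← heq]; exact norm_ne_zero_iff.2 hw)
      have hu0 : u ≠ 0 := by rintro rfl; simp at hu
      have := act_div_self (flow f s) hu0
      rw [hω, mul_neg, mul_div_cancel₀ _ hw, add_neg_cancel, div_eq_zero_iff] at this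
      exact this.elim (hf.act_flow_ne_zero hu0 hs) hu0
  by_contra hcon
  rw [not_lt] at hcon
  have hc : ContinuousOn (fun s => ‖antilin (flow f s)‖ - ‖chiralCenter (flow f s)‖) (Icc 0 s) :=
    ((antilinL.continuous.comp hf.continuous_flow).norm.sub
      (centerL.continuous.comp hf.continuous_flow).norm).continuousOn
  obtain ⟨σ, hσ, h0⟩ := intermediate_value_Icc hs hc (show (0 : ℝ) ∈ _ by
    rw [hf.flow_zero]; simpa using hcon)
  exact hne σ hσ.1 (sub_eq_zero.1 h0)

end IsDensity

/-! ### Rigidity of extremal trajectories -/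

lemma eq_one_of_norm_le_one {z : ℂ} (h : ‖z‖ ≤ 1) (hre : z.re = 1) : z = 1 := by
  have h1 : ‖z‖ ^ 2 ≤ 1 := pow_le_one₀ (norm_nonneg _) h
  rw [← Complex.normSq_eq_norm_sq, Complex.normSq_apply, hre] at h1
  exact Complex.ext hre (by simpa using (by nlinarith : z.im = 0))

/-- The equality case of the triangle inequality; it separates the linear from the antilinear
contribution along an extremal trajectory. -/
lemma eq_norm_of_add_eq_one {z w : ℂ} (h : z + w = 1) (hn : ‖z‖ + ‖w‖ ≤ 1) : z = ‖z‖ := by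
  have h1 := Complex.re_le_norm z
  have h2 := Complex.re_le_norm w
  have h3 : z.re + w.re = 1 := by simpa using congrArg Complex.re h
  have h4 : z.re = ‖z‖ := by linarith
  have h5 : ‖z‖ ^ 2 = z.re * z.re + z.im * z.im := by
    rw [← Complex.normSq_eq_norm_sq, Complex.normSq_apply]
  rw [← h4] at h5
  have h6 : z.im = 0 := by nlinarith
  exact Complex.ext (by simpa using h4) (by simpa using h6)

lemma norm_exp_mul_I (t : ℝ) : ‖Complex.exp (t * Complex.I)‖ = 1 :=
  Complex.norm_exp_ofReal_mul_I t

lemma exp_injective_of_norm_lt_pi {z w : ℂ} (hz : ‖z‖ < Real.pi) (hw : ‖w‖ < Real.pi)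
    (h : Complex.exp z = Complex.exp w) : z = w := by
  have hz' := abs_lt.1 ((Complex.abs_im_le_norm z).trans_lt hz)
  have hw' := abs_lt.1 ((Complex.abs_im_le_norm w).trans_lt hw)
  exact Complex.exp_inj_of_neg_pi_lt_of_le_pi hz'.1 hz'.2.le hw'.1 hw'.2.le h

/-- The initial phase of the extremal development with direction `t` through the vector `u`. -/
def phase (t : ℝ) (u : ℂ) : ℂ := Complex.exp (t * Complex.I) * (u / conj u)

lemma norm_phase (t : ℝ) {u : ℂ} (hu : u ≠ 0) : ‖phase t u‖ = 1 := by
  rw [phase, norm_mul, norm_exp_mul_I, norm_div, Complex.norm_conj,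
    div_self (norm_ne_zero_iff.2 hu), mul_one]

lemma norm_ofReal_mul_exp {p : ℝ} (hp : 0 ≤ p) (t : ℝ) :
    ‖(p : ℂ) * Complex.exp (t * Complex.I)‖ = p := by
  rw [norm_mul, norm_exp_mul_I, mul_one, Complex.norm_real, Real.norm_of_nonneg hp]

variable {f : ℝ → M2} {p : ℝ}

/-- The density is determined, up to its elliptic proportion, along an extremal trajectory. -/
lemma IsDensity.ae_parts_of_extremal (hf : IsDensity f p) (hp : 0 ≤ p) (hpi : p < Real.pi)
    {u : ℂ} (hu : u ≠ 0) {t : ℝ}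
    (h : act (flow f p) u = u * Complex.exp (p * Complex.exp (t * Complex.I))) :
    ∀ᵐ s, s ∈ Icc 0 p →
      chiralCenter (f s) = ‖chiralCenter (f s)‖ * Complex.exp (t * Complex.I) ∧
      antilin (f s) = (1 - ‖chiralCenter (f s)‖) * phase t u *
        Complex.exp (((2 * s * Real.sin t : ℝ) : ℂ) * Complex.I) := by
  obtain ⟨g, hgm, hgb, hg⟩ := hf.exists_log hu
  set e := Complex.exp (t * Complex.I) with he
  have hen : ‖e‖ = 1 := norm_exp_mul_I t
  have he0 : e ≠ 0 := Complex.exp_ne_zero _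
  have hgi : IntervalIntegrable g volume 0 p :=
    (intervalIntegrable_const (c := (1 : ℝ))).mono_fun' hgm.aestronglyMeasurable (.of_forall hgb)
  -- Both logarithms have modulus at most p < π, where exp is injective.
  have hint : ∫ σ in (0 : ℝ)..p, g σ = p * e := by
    have h1 := (hg p hp).1
    rw [h] at h1
    refine (exp_injective_of_norm_lt_pi ?_ ?_ (mul_left_cancel₀ hu h1)).symm
    · rwa [norm_ofReal_mul_exp hp]
    · refine lt_of_le_of_lt ?_ hpi
      simpa [abs_of_nonneg hp] using intervalIntegral.norm_integral_le_of_norm_le_const (a := 0)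
        (b := p) (C := 1) fun s _ => hgb s
  -- The real part of g/e is at most 1 and has mean 1, so it equals 1 almost everywhere; with |g| ≤
  -- 1 this forces g = e.
  have hge : ∀ᵐ s, s ∈ Icc 0 p → g s = e := by
    have hre : ∀ s, (e⁻¹ * g s).re ≤ 1 := fun s =>
      (Complex.re_le_norm _).trans (by rw [norm_mul, norm_inv, hen, inv_one, one_mul]; exact hgb s)
    have hi1 : IntegrableOn (fun s => (e⁻¹ * g s).re) (Icc 0 p) volume := by
      have := (intervalIntegrable_iff_integrableOn_Icc_of_le hp).1 (hgi.const_mul e⁻¹)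
      exact this.re
    have hi2 : IntegrableOn (fun s => 1 - (e⁻¹ * g s).re) (Icc 0 p) volume :=
      (integrable_const _).sub hi1
    have hz : ∫ s in Icc 0 p, (1 - (e⁻¹ * g s).re) = 0 := by
      rw [integral_sub (integrable_const _) hi1]
      have h2 : ∫ s in Icc 0 p, (e⁻¹ * g s).re = (∫ s in Icc 0 p, e⁻¹ * g s).re :=
        integral_re ((intervalIntegrable_iff_integrableOn_Icc_of_le hp).1 (hgi.const_mul e⁻¹))
      have h3 : ∫ s in Icc 0 p, e⁻¹ * g s = p := by
        rw [integral_Icc_eq_integral_Ioc, ← intervalIntegral.integral_of_le hp,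
          intervalIntegral.integral_const_mul, hint, mul_comm (p : ℂ), inv_mul_cancel_left₀ he0]
      rw [h2, h3]
      simp [hp]
    have hae := (integral_eq_zero_iff_of_nonneg (fun s => sub_nonneg.2 (hre s)) hi2).1 hz
    rw [Filter.EventuallyEq, ae_restrict_iff' measurableSet_Icc] at hae
    filter_upwards [hae] with s hs hsp
    have h1 : e⁻¹ * g s = 1 := eq_one_of_norm_le_one
      (by rw [norm_mul, norm_inv, hen, inv_one, one_mul]; exact hgb s)
      (by have := hs hsp; simp only [Pi.zero_apply] at this; linarith)
    rwa [inv_mul_eq_one₀ he0, eq_comm] at h1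
  have hx : ∀ s ∈ Icc 0 p, act (flow f s) u = u * Complex.exp (s * e) := by
    intro s hs
    rw [(hg s hs.1).1]
    congr 2
    rw [intervalIntegral.integral_congr_ae (g := fun _ => e)]
    · simp
    · filter_upwards [hge] with σ hσ hσs
      rw [uIoc_of_le hs.1] at hσs
      exact hσ ⟨hσs.1.le, hσs.2.trans hs.2⟩
  filter_upwards [hge] with s hs hsp
  have h1 := (hg s hsp.1).2
  rw [hs hsp, hx s hsp, act] at h1
  have hcu : conj u ≠ 0 := (map_ne_zero _).2 hu
  -- The quotient conj x / x rotates by −2s sin t along the trajectory, which produces the rotating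
  -- factor in the antilinear part.
  have hconj : conj (Complex.exp (s * e)) = Complex.exp (s * e) *
      (Complex.exp (((2 * s * Real.sin t : ℝ) : ℂ) * Complex.I))⁻¹ := by
    rw [← Complex.exp_conj, ← Complex.exp_neg, ← Complex.exp_add]
    congr 1
    rw [he, Complex.exp_mul_I, ← Complex.ofReal_cos, ← Complex.ofReal_sin]
    simp only [map_mul, map_add, Complex.conj_ofReal, Complex.conj_I]
    push_cast
    ring
  set r := Complex.exp (((2 * s * Real.sin t : ℝ) : ℂ) * Complex.I) with hr
  have hr0 : r ≠ 0 := Complex.exp_ne_zero _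
  have hrn : ‖r‖ = 1 := norm_exp_mul_I _
  have hE : Complex.exp (s * e) ≠ 0 := Complex.exp_ne_zero _
  rw [map_mul, hconj] at h1
  have h2 : e⁻¹ * chiralCenter (f s) + e⁻¹ * antilin (f s) * (conj u / u) * r⁻¹ = 1 := by
    field_simp
    have h3 : (chiralCenter (f s) * u * r + antilin (f s) * conj u) * Complex.exp (s * e) =
        (u * r * e) * Complex.exp (s * e) := by
      field_simp at h1
      linear_combination Complex.exp (s * e) * h1
    have := mul_right_cancel₀ hE h3
    linear_combination this
  have hn1 : ‖e⁻¹ * chiralCenter (f s)‖ = ‖chiralCenter (f s)‖ := by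
    rw [norm_mul, norm_inv, hen, inv_one, one_mul]
  have hn2 : ‖e⁻¹ * antilin (f s) * (conj u / u) * r⁻¹‖ = ‖antilin (f s)‖ := by
    rw [norm_mul, norm_mul, norm_mul, norm_inv, norm_inv, hen, hrn, norm_conj_div_self hu]
    simp
  have h4 := eq_norm_of_add_eq_one h2
    (by rw [hn1, hn2]; exact (norm_add_norm_le _).trans (hf.norm_le s))
  rw [hn1] at h4
  refine ⟨?_, ?_⟩
  · rw [← h4]; field_simp
  · rw [h4] at h2
    rw [phase, ← he, ← eq_sub_iff_add_eq'.2 h2]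
    field_simp

end

end Magnus

namespace Magnus

noncomputable section

local notation "conj" => starRingEnd ℂ

/-! ### The function `sinhDiv` -/

lemma sinhDiv_mul (q c : ℝ) : sinhDiv q c * c = Real.sinh (q * c) := by
  rw [sinhDiv]
  split_ifs with h
  · simp [h]
  · rw [div_mul_cancel₀ _ h]

@[simp] lemma sinhDiv_zero_left (c : ℝ) : sinhDiv 0 c = 0 := by
  simp [sinhDiv]

lemma hasDerivAt_sinhDiv (q c : ℝ) : HasDerivAt (fun q => sinhDiv q c) (Real.cosh (q * c)) q := by
  by_cases h : c = 0
  · simp only [sinhDiv, h, if_true, mul_zero, Real.cosh_zero]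
    exact hasDerivAt_id q
  · simp only [sinhDiv, h, if_false]
    have := ((hasDerivAt_id q).mul_const c).sinh.div_const c
    simpa [h] using this

lemma contDiff_sinhDiv (c : ℝ) : ContDiff ℝ 1 (fun q => sinhDiv q c) := by
  by_cases h : c = 0
  · simp only [sinhDiv, h, if_true]
    exact contDiff_id
  · simp only [sinhDiv, h, if_false]
    fun_prop

lemma sinhDiv_neg_right (q c : ℝ) : sinhDiv q (-c) = sinhDiv q c := by
  simp only [sinhDiv, neg_eq_zero, mul_neg, Real.sinh_neg, neg_div_neg_eq]

lemma strictMono_sinhDiv (c : ℝ) : StrictMono (fun q => sinhDiv q c) :=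
  strictMono_of_deriv_pos fun q => by
    rw [(hasDerivAt_sinhDiv q c).deriv]; exact Real.cosh_pos _

lemma sinhDiv_pos {q : ℝ} (hq : 0 < q) (c : ℝ) : 0 < sinhDiv q c := by
  simpa using strictMono_sinhDiv c hq

lemma sinhDiv_nonneg {q : ℝ} (hq : 0 ≤ q) (c : ℝ) : 0 ≤ sinhDiv q c := by
  simpa using (strictMono_sinhDiv c).monotone hq

/-- The size of the antilinear part of the normal form, relative to the norm. -/
def relRadius (q c : ℝ) : ℝ := Real.exp (-(q * c)) * sinhDiv q c

lemma hasDerivAt_relRadius (q c : ℝ) :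
    HasDerivAt (fun q => relRadius q c) (Real.exp (-(2 * (q * c)))) q := by
  have h1 : HasDerivAt (fun q => Real.exp (-(q * c))) (Real.exp (-(q * c)) * -(1 * c)) q :=
    (((hasDerivAt_id q).mul_const c).neg).exp
  have h := h1.mul (hasDerivAt_sinhDiv q c)
  have h2 : Real.exp (-(q * c)) * -(1 * c) * sinhDiv q c + Real.exp (-(q * c)) *
      Real.cosh (q * c) = Real.exp (-(2 * (q * c))) := by
    have h3 : Real.exp (-(2 * (q * c))) = Real.exp (-(q * c)) * Real.exp (-(q * c)) := by
      rw [← Real.exp_add]; ring_nf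
    rw [h3]
    nth_rw 4 [← Real.cosh_sub_sinh]
    rw [← sinhDiv_mul]
    ring
  rw [h2] at h
  exact h

/-- The derivative is an exponential, hence positive whatever the sign of c. This is what allows the
hyperbolic length to be read off from the chiral radius. -/
lemma strictMono_relRadius (c : ℝ) : StrictMono (fun q => relRadius q c) :=
  strictMono_of_deriv_pos fun q => by
    rw [(hasDerivAt_relRadius q c).deriv]; exact Real.exp_pos _

@[simp] lemma relRadius_zero_left (c : ℝ) : relRadius 0 c = 0 := by simp [relRadius]

lemma relRadius_zero_right (q : ℝ) : relRadius q 0 = q := by simp [relRadius, sinhDiv]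

lemma two_mul_relRadius_mul (q c : ℝ) :
    2 * relRadius q c * c = 1 - Real.exp (-(2 * (q * c))) := by
  rw [relRadius, mul_assoc, mul_assoc, sinhDiv_mul, Real.sinh_eq]
  have h3 : Real.exp (-(2 * (q * c))) = Real.exp (-(q * c)) * Real.exp (-(q * c)) := by
    rw [← Real.exp_add]; ring_nf
  have h4 : Real.exp (-(q * c)) * Real.exp (q * c) = 1 := by
    rw [← Real.exp_add]; simp
  rw [h3]
  linear_combination h4

/-- The parts of the normal form of total length `s`, in terms of its relative radius. -/
lemma chiralCenter_NW_sub {F : M2} (hF : chiralCenter F = 0) (s v t r : ℝ) :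
    chiralCenter (NW (s - v) v t (rot r * F)) =
      Complex.exp (s * Complex.exp (t * Complex.I)) *
        (1 - relRadius v (Real.cos t) * Complex.exp (t * Complex.I)) := by
  rw [chiralCenter_NW hF]
  set c := Real.cos t with hc
  have h1 : Complex.exp (t * Complex.I) = c + Real.sin t * Complex.I := by
    rw [Complex.exp_mul_I, ← Complex.ofReal_cos, ← Complex.ofReal_sin]
  have h2 : Complex.exp (s * Complex.exp (t * Complex.I)) =
      (Real.exp (s * c) : ℝ) * Complex.exp ((s * Real.sin t : ℝ) * Complex.I) := by
    rw [h1, Complex.ofReal_exp, ← Complex.exp_add]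
    congr 1
    push_cast
    ring
  have h3 : Real.exp ((s - v) * c) = Real.exp (s * c) * Real.exp (-(v * c)) := by
    rw [← Real.exp_add]; ring_nf
  have h4 : Real.exp (-(v * c)) * (Real.cosh (v * c) + sinhDiv v c * c) = 1 := by
    rw [sinhDiv_mul, Real.cosh_add_sinh, ← Real.exp_add]; simp
  have h4' : ((Real.exp (-(v * c)) : ℝ) : ℂ) * (Real.cosh (v * c) + sinhDiv v c * c) = 1 := by
    exact_mod_cast h4
  rw [h2, h1, h3, relRadius, sub_add_cancel]
  push_cast [-Complex.ofReal_exp, -Complex.ofReal_cosh, -Complex.ofReal_sin] at h4' ⊢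
  linear_combination ((Real.exp (s * c) : ℝ) : ℂ) *
    Complex.exp (↑s * (Real.sin t : ℝ) * Complex.I) * h4'

lemma antilin_NW_sub (F : M2) (s v t r : ℝ) :
    antilin (NW (s - v) v t (rot r * F)) = Real.exp (s * Real.cos t) *
      relRadius v (Real.cos t) * Complex.exp (r * Complex.I) * antilin F := by
  rw [antilin_NW, relRadius, sub_mul, sub_eq_add_neg, Real.exp_add]
  push_cast
  ring

/-! ### Verification of the normal form -/

/-- The elliptic length accumulated by a density up to time `s`. -/
def ellipticLength (f : ℝ → M2) (s : ℝ) : ℝ := ∫ σ in (0 : ℝ)..s, ‖chiralCenter (f σ)‖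

namespace IsDensity

variable {f : ℝ → M2} {p : ℝ}

lemma norm_center_le (hf : IsDensity f p) (s : ℝ) : ‖chiralCenter (f s)‖ ≤ 1 :=
  (le_add_of_nonneg_right (norm_nonneg _)).trans ((norm_add_norm_le _).trans (hf.norm_le s))

lemma stronglyMeasurable_center (hf : IsDensity f p) :
    StronglyMeasurable fun s => ‖chiralCenter (f s)‖ :=
  (centerL.continuous.comp_stronglyMeasurable hf.meas).norm

lemma locallyIntegrable_center (hf : IsDensity f p) :
    LocallyIntegrable (fun s => ‖chiralCenter (f s)‖) volume :=
  (locallyIntegrable_const (1 : ℝ)).mono hf.stronglyMeasurable_center.aestronglyMeasurable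
    (.of_forall fun s => by simpa using hf.norm_center_le s)

lemma intervalIntegrable_center (hf : IsDensity f p) (x y : ℝ) :
    IntervalIntegrable (fun s => ‖chiralCenter (f s)‖) volume x y :=
  (intervalIntegrable_const (c := (1 : ℝ))).mono_fun'
    hf.stronglyMeasurable_center.aestronglyMeasurable
    (.of_forall fun s => by simpa using hf.norm_center_le s)

lemma locallyLipschitz_ellipticLength (hf : IsDensity f p) :
    LocallyLipschitz (ellipticLength f) :=
  locallyLipschitz_integral hf.stronglyMeasurable_center.aestronglyMeasurable continuous_const
    (B := fun _ => 1) (fun s => by simpa using hf.norm_center_le s) 0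

lemma ellipticLength_sub (hf : IsDensity f p) (x y : ℝ) :
    ellipticLength f y - ellipticLength f x = ∫ σ in x..y, ‖chiralCenter (f σ)‖ :=
  intervalIntegral.integral_interval_sub_left (hf.intervalIntegrable_center _ _)
    (hf.intervalIntegrable_center _ _)

lemma monotone_ellipticLength (hf : IsDensity f p) : Monotone (ellipticLength f) := by
  intro x y hxy
  rw [← sub_nonneg, hf.ellipticLength_sub]
  exact intervalIntegral.integral_nonneg hxy fun _ _ => norm_nonneg _

lemma monotone_sub_ellipticLength (hf : IsDensity f p) :
    Monotone fun s => s - ellipticLength f s := by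
  intro x y hxy
  have : ellipticLength f y - ellipticLength f x ≤ y - x := by
    rw [hf.ellipticLength_sub]
    have := intervalIntegral.integral_mono_on hxy (hf.intervalIntegrable_center x y)
      (intervalIntegrable_const (c := (1 : ℝ))) fun s _ => hf.norm_center_le s
    simpa using this
  change x - ellipticLength f x ≤ y - ellipticLength f y
  linarith

@[simp] lemma _root_.Magnus.ellipticLength_zero (f : ℝ → M2) : ellipticLength f 0 = 0 := by
  simp [ellipticLength]

/-- The two scalar profiles of the normal form satisfy a closed linear system whose coefficients
depend only on the current elliptic speed a. -/
lemma _root_.Magnus.hasDerivAt_parts_NW {a : ℝ} {w : ℝ → ℝ} {s : ℝ} (hw : HasDerivAt w a s)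
    (c : ℝ) :
    HasDerivAt (fun s => Real.exp (w s * c) * Real.cosh ((s - w s) * c))
      (a * c * (Real.exp (w s * c) * Real.cosh ((s - w s) * c)) +
        c ^ 2 * (1 - a) * (Real.exp (w s * c) * sinhDiv (s - w s) c)) s ∧
    HasDerivAt (fun s => Real.exp (w s * c) * sinhDiv (s - w s) c)
      (a * c * (Real.exp (w s * c) * sinhDiv (s - w s) c) +
        (1 - a) * (Real.exp (w s * c) * Real.cosh ((s - w s) * c))) s := by
  have h1 : HasDerivAt (fun s => s - w s) (1 - a) s := (hasDerivAt_id s).sub hw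
  have hE : HasDerivAt (fun s => Real.exp (w s * c)) (Real.exp (w s * c) * (a * c)) s :=
    (hw.mul_const c).exp
  have hC : HasDerivAt (fun s => Real.cosh ((s - w s) * c))
      (Real.sinh ((s - w s) * c) * ((1 - a) * c)) s := (h1.mul_const c).cosh
  have hS : HasDerivAt (fun s => sinhDiv (s - w s) c)
      (Real.cosh ((s - w s) * c) * (1 - a)) s :=
    HasDerivAt.comp (h₂ := fun q => sinhDiv q c) s (hasDerivAt_sinhDiv (s - w s) c) h1
  constructor
  · refine (hE.mul hC).congr_deriv ?_
    rw [← sinhDiv_mul]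
    ring
  · refine (hE.mul hS).congr_deriv ?_
    ring

/-- The linear part of the normal form of elliptic length `v` and total length `s`. -/
def _root_.Magnus.nfCenter (t s v : ℝ) : ℂ :=
  Complex.exp (((s * Real.sin t : ℝ) : ℂ) * Complex.I) *
    (((Real.exp (v * Real.cos t) * Real.cosh ((s - v) * Real.cos t) : ℝ) : ℂ) -
      Real.sin t * ((Real.exp (v * Real.cos t) * sinhDiv (s - v) (Real.cos t) : ℝ) : ℂ) *
        Complex.I)

/-- The antilinear part of the normal form of elliptic length `v` and total length `s`. -/
def _root_.Magnus.nfAntilin (t : ℝ) (η : ℂ) (s v : ℝ) : ℂ :=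
  Complex.exp (((s * Real.sin t : ℝ) : ℂ) * Complex.I) *
    (η * ((Real.exp (v * Real.cos t) * sinhDiv (s - v) (Real.cos t) : ℝ) : ℂ))

lemma _root_.Magnus.chiralCenter_NW_eq_nfCenter (t s v r : ℝ) (η : ℂ) :
    chiralCenter (NW v (s - v) t (rot r * ofParts 0 η)) = nfCenter t s v := by
  rw [chiralCenter_NW (chiralCenter_ofParts _ _), add_sub_cancel, nfCenter]
  push_cast
  ring

lemma _root_.Magnus.antilin_NW_eq_nfAntilin (t s v : ℝ) (η : ℂ) :
    antilin (NW v (s - v) t (rot (s * Real.sin t) * ofParts 0 η)) = nfAntilin t η s v := by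
  rw [antilin_NW, antilin_ofParts, nfAntilin]
  push_cast
  ring

/-- Total and elliptic length are kept as independent variables: the elliptic length is only
Lipschitz in time, so regularity along it comes from composition with a C¹ map. -/
lemma _root_.Magnus.contDiff_nf (t : ℝ) (η : ℂ) :
    ContDiff ℝ 1 fun q : ℝ × ℝ => (nfCenter t q.1 q.2, nfAntilin t η q.1 q.2) := by
  have h0 : ContDiff ℝ 1 fun q : ℝ × ℝ => q.1 * Real.sin t := by fun_prop
  have h1 : ContDiff ℝ 1 fun q : ℝ × ℝ =>
      Complex.exp (((q.1 * Real.sin t : ℝ) : ℂ) * Complex.I) :=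
    ((Complex.ofRealCLM.contDiff.comp h0).mul contDiff_const).cexp
  have h2 : ContDiff ℝ 1 fun q : ℝ × ℝ => Real.exp (q.2 * Real.cos t) *
      Real.cosh ((q.1 - q.2) * Real.cos t) := by fun_prop
  have h3 : ContDiff ℝ 1 fun q : ℝ × ℝ => sinhDiv (q.1 - q.2) (Real.cos t) :=
    (contDiff_sinhDiv (Real.cos t)).comp (contDiff_fst.sub contDiff_snd)
  have h4 : ContDiff ℝ 1 fun q : ℝ × ℝ => Real.exp (q.2 * Real.cos t) *
      sinhDiv (q.1 - q.2) (Real.cos t) := ContDiff.mul (by fun_prop) h3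
  have h5 := Complex.ofRealCLM.contDiff.comp h4
  exact (h1.mul ((Complex.ofRealCLM.contDiff.comp h2).sub
    ((contDiff_const.mul h5).mul contDiff_const))).prodMk (h1.mul (contDiff_const.mul h5))

/-- The parts of the normal form solve the same equation as the flow of a density with linear part α
and antilinear part β. The identity rests on cos² + sin² = 1 and on η and the rotation having
modulus one. -/
lemma _root_.Magnus.hasDerivAt_nf {a : ℝ} {w : ℝ → ℝ} {s : ℝ} (hw : HasDerivAt w a s) (t : ℝ)
    {η : ℂ} (hη : ‖η‖ = 1) {α β : ℂ} (hα : α = a * Complex.exp (t * Complex.I))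
    (hβ : β = (1 - a) * η * Complex.exp (((2 * s * Real.sin t : ℝ) : ℂ) * Complex.I)) :
    HasDerivAt (fun s => nfCenter t s (w s))
      (α * nfCenter t s (w s) + β * conj (nfAntilin t η s (w s))) s ∧
    HasDerivAt (fun s => nfAntilin t η s (w s))
      (α * nfAntilin t η s (w s) + β * conj (nfCenter t s (w s))) s := by
  obtain ⟨hXd, hYd⟩ := hasDerivAt_parts_NW hw (Real.cos t)
  have hXc := hXd.ofReal_comp
  have hYc := hYd.ofReal_comp
  have hRd : HasDerivAt (fun s : ℝ => Complex.exp (((s * Real.sin t : ℝ) : ℂ) * Complex.I))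
      (Complex.exp (((s * Real.sin t : ℝ) : ℂ) * Complex.I) * (Real.sin t * Complex.I)) s := by
    have h1 : HasDerivAt (fun s : ℝ => ((s * Real.sin t : ℝ) : ℂ) * Complex.I)
        (((1 * Real.sin t : ℝ) : ℂ) * Complex.I) s :=
      (((hasDerivAt_id s).mul_const (Real.sin t)).ofReal_comp).mul_const Complex.I
    have := h1.cexp
    rwa [one_mul] at this
  have hR2 : Complex.exp (((2 * s * Real.sin t : ℝ) : ℂ) * Complex.I) =
      Complex.exp (((s * Real.sin t : ℝ) : ℂ) * Complex.I) *
        Complex.exp (((s * Real.sin t : ℝ) : ℂ) * Complex.I) := by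
    rw [← Complex.exp_add]
    congr 1
    push_cast
    ring
  have hcs : ((Real.cos t : ℝ) : ℂ) ^ 2 + ((Real.sin t : ℝ) : ℂ) ^ 2 = 1 := by
    exact_mod_cast Real.cos_sq_add_sin_sq t
  have hηη : η * conj η = 1 := by
    rw [Complex.mul_conj, Complex.normSq_eq_norm_sq, hη]; simp
  have hRR : Complex.exp (((s * Real.sin t : ℝ) : ℂ) * Complex.I) *
      conj (Complex.exp (((s * Real.sin t : ℝ) : ℂ) * Complex.I)) = 1 := by
    rw [Complex.mul_conj, Complex.normSq_eq_norm_sq, norm_exp_mul_I]; simp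
  have hI := Complex.I_sq
  rw [Complex.exp_mul_I, ← Complex.ofReal_cos, ← Complex.ofReal_sin] at hα
  constructor
  · refine (hRd.mul (hXc.sub ((hYc.const_mul (Real.sin t : ℂ)).mul_const
      Complex.I))).congr_deriv ?_
    rw [hα, hβ, hR2]
    simp only [nfCenter, nfAntilin, map_mul, Complex.conj_ofReal, Pi.sub_apply]
    generalize Real.exp (w s * Real.cos t) * Real.cosh ((s - w s) * Real.cos t) = X
    generalize Real.exp (w s * Real.cos t) * sinhDiv (s - w s) (Real.cos t) = Y
    generalize Complex.exp (((s * Real.sin t : ℝ) : ℂ) * Complex.I) = R at *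
    generalize Real.cos t = c at *
    generalize Real.sin t = σ at *
    push_cast
    linear_combination R * Y * (1 - a) * (hcs - η * conj η * hRR - hηη) - R * Y * σ ^ 2 * hI * (1 - a)
  · refine (hRd.mul (hYc.const_mul η)).congr_deriv ?_
    rw [hα, hβ, hR2]
    simp only [nfCenter, nfAntilin, map_mul, map_sub, Complex.conj_ofReal, Complex.conj_I]
    generalize Real.exp (w s * Real.cos t) * Real.cosh ((s - w s) * Real.cos t) = X
    generalize Real.exp (w s * Real.cos t) * sinhDiv (s - w s) (Real.cos t) = Y
    generalize Complex.exp (((s * Real.sin t : ℝ) : ℂ) * Complex.I) = R at *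
    generalize Real.cos t = c at *
    generalize Real.sin t = σ at *
    push_cast
    linear_combination -(1 - a) * η * R * (X + σ * Y * Complex.I) * hRR

lemma locallyLipschitz_comp_ellipticLength (hf : IsDensity f p) {g : ℝ × ℝ → ℂ × ℂ}
    (hg : ContDiff ℝ 1 g) : LocallyLipschitz fun s => g (s, ellipticLength f s) :=
  hg.locallyLipschitz.comp (LocallyLipschitz.id.prodMk hf.locallyLipschitz_ellipticLength)

lemma locallyLipschitz_parts_flow (hf : IsDensity f p) :
    LocallyLipschitz fun s => (chiralCenter (flow f s), antilin (flow f s)) := by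
  have h := (centerL.prod antilinL).lipschitz.locallyLipschitz
  exact h.comp hf.locallyLipschitz_flow

lemma hasDerivAt_parts_flow {σ : ℝ} (hfl : HasDerivAt (flow f) (f σ * flow f σ) σ) :
    HasDerivAt (fun s => (chiralCenter (flow f s), antilin (flow f s)))
      (chiralCenter (f σ * flow f σ), antilin (f σ * flow f σ)) σ :=
  (centerL.prod antilinL).hasFDerivAt.comp_hasDerivAt σ hfl

/-- In the maximum norm of the pair of parts, left multiplication by M is a contraction, which
provides the Grönwall constant 1. -/
lemma norm_parts_mul_le {M : M2} (hM : ‖M‖ ≤ 1) (d : ℂ × ℂ) :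
    ‖(chiralCenter M * d.1 + antilin M * conj d.2,
      chiralCenter M * d.2 + antilin M * conj d.1)‖ ≤ ‖d‖ := by
  have hone := (norm_add_norm_le M).trans hM
  have hbd : ∀ x y : ℂ, ‖x‖ ≤ ‖d‖ → ‖y‖ ≤ ‖d‖ →
      ‖chiralCenter M * x + antilin M * conj y‖ ≤ ‖d‖ := by
    intro x y hx hy
    refine (norm_add_le _ _).trans ?_
    rw [norm_mul, norm_mul, Complex.norm_conj]
    nlinarith [norm_nonneg (chiralCenter M), norm_nonneg (antilin M), norm_nonneg d]
  exact norm_prod_le_iff.2 ⟨hbd _ _ (norm_fst_le d) (norm_snd_le d),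
    hbd _ _ (norm_snd_le d) (norm_fst_le d)⟩

/-- A flow with extremal density develops along the normal form. -/
theorem flow_eq_NW (hf : IsDensity f p) {η : ℂ} (hη : ‖η‖ = 1) {t : ℝ}
    (h : ∀ᵐ s, s ∈ Icc 0 p →
      chiralCenter (f s) = ‖chiralCenter (f s)‖ * Complex.exp (t * Complex.I) ∧
      antilin (f s) = (1 - ‖chiralCenter (f s)‖) * η *
        Complex.exp (((2 * s * Real.sin t : ℝ) : ℂ) * Complex.I)) {s : ℝ} (hs : s ∈ Icc 0 p) :
    flow f s = NW (ellipticLength f s) (s - ellipticLength f s) t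
      (rot (s * Real.sin t) * ofParts 0 η) := by
  set w := ellipticLength f with hw
  have hdiffL := hf.locallyLipschitz_parts_flow.sub (hf.locallyLipschitz_comp_ellipticLength (contDiff_nf t η))
  have hder : ∀ᵐ σ, σ ∈ Icc 0 p → HasDerivAt
      ((fun s => (chiralCenter (flow f s), antilin (flow f s))) -
        fun s => (nfCenter t s (w s), nfAntilin t η s (w s)))
      (chiralCenter (f σ) * (chiralCenter (flow f σ) - nfCenter t σ (w σ)) +
        antilin (f σ) * conj (antilin (flow f σ) - nfAntilin t η σ (w σ)),
       chiralCenter (f σ) * (antilin (flow f σ) - nfAntilin t η σ (w σ)) +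
        antilin (f σ) * conj (chiralCenter (flow f σ) - nfCenter t σ (w σ))) σ := by
    filter_upwards [h, hf.ae_hasDerivAt_flow,
      _root_.LocallyIntegrable.ae_hasDerivAt_integral hf.locallyIntegrable_center]
      with σ hσ hfl hwd hσp
    obtain ⟨hα, hβ⟩ := hσ hσp
    obtain ⟨hZd, hWd⟩ := hasDerivAt_nf (w := w) (hwd 0) t hη hα hβ
    refine ((hasDerivAt_parts_flow hfl).sub (hZd.prodMk hWd)).congr_deriv ?_
    simp only [chiralCenter_mul, antilin_mul, map_sub, Prod.mk_sub_mk]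
    refine Prod.ext ?_ ?_ <;> ring
  -- The flow and the normal form solve the same linear equation almost everywhere and agree at 0,
  -- so Grönwall identifies them.
  have key := eq_zero_of_norm_deriv_le hdiffL (hs.1.trans hs.2) (K := 1) (by
      filter_upwards [hder] with σ hσ hσp
      refine ⟨hσ hσp, ?_⟩
      rw [one_mul]
      exact norm_parts_mul_le (hf.norm_le σ)
        ((chiralCenter (flow f σ), antilin (flow f σ)) - (nfCenter t σ (w σ), nfAntilin t η σ (w σ)))) (by
      simp [hf.flow_zero, nfCenter, nfAntilin]) hs
  have hkey := sub_eq_zero.1 key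
  refine ext_parts ?_ ?_
  · rw [chiralCenter_NW_eq_nfCenter]; exact congrArg Prod.fst hkey
  · rw [antilin_NW_eq_nfAntilin]; exact congrArg Prod.snd hkey

end IsDensity

end

end Magnus

namespace Magnus

noncomputable section

local notation "conj" => starRingEnd ℂ

/-! ### Disks on which the logarithm is bounded -/

/-- The disk of center `Z` and radius `r` lies in the image under `exp` of the closed disk of
radius `q` around `0`. -/
def LogBounded (Z : ℂ) (r q : ℝ) : Prop :=
  ∀ z ∈ Metric.closedBall Z r, z ∈ Complex.slitPlane ∧ ‖Complex.log z‖ ≤ q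

lemma log_exp_of_norm_lt_pi {z : ℂ} (hz : ‖z‖ < Real.pi) : Complex.log (Complex.exp z) = z := by
  have h := abs_lt.1 ((Complex.abs_im_le_norm z).trans_lt hz)
  exact Complex.log_exp h.1 h.2.le

lemma exp_mem_slitPlane_of_norm_lt_pi {z : ℂ} (hz : ‖z‖ < Real.pi) :
    Complex.exp z ∈ Complex.slitPlane := by
  refine Complex.mem_slitPlane_iff_arg.2 ⟨?_, Complex.exp_ne_zero z⟩
  rw [← Complex.log_im, log_exp_of_norm_lt_pi hz]
  exact ((le_abs_self _).trans_lt ((Complex.abs_im_le_norm z).trans_lt hz)).ne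

/-- If the disk met the closed negative half-axis, then moving left along it one would leave the
disk through a point of the circle outside the slit plane. Hence log is holomorphic around the disk,
and the maximum principle carries the bound inside. -/
lemma logBounded_of_sphere {Z : ℂ} {r q : ℝ} (hr : 0 ≤ r)
    (h : ∀ z ∈ Metric.sphere Z r, z ∈ Complex.slitPlane ∧ ‖Complex.log z‖ ≤ q) :
    LogBounded Z r q := by
  have hslit : ∀ z ∈ Metric.closedBall Z r, z ∈ Complex.slitPlane := by
    intro z hz
    by_contra hns
    rw [Complex.mem_slitPlane_iff, not_or, not_lt, not_not] at hns
    obtain ⟨hre, him⟩ := hns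
    set g : ℝ → ℝ := fun τ => ‖((-τ : ℝ) : ℂ) - Z‖ with hg
    have hgc : Continuous g := by
      simp only [hg]
      fun_prop
    have hz0 : z = ((-(-z.re) : ℝ) : ℂ) := by
      apply Complex.ext <;> simp [him]
    have h1 : g (-z.re) ≤ r := by
      simp only [hg]
      rw [← hz0]
      simpa [dist_eq_norm] using hz
    have h2 : r ≤ g (-z.re + ‖Z‖ + r) := by
      have h3 := norm_sub_norm_le ((-(-z.re + ‖Z‖ + r) : ℝ) : ℂ) Z
      rw [Complex.norm_real, norm_neg, Real.norm_of_nonneg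
        (by have := norm_nonneg Z; linarith)] at h3
      simp only [hg]
      linarith
    obtain ⟨τ, hτ, hτr⟩ := intermediate_value_Icc
      (by have := norm_nonneg Z; linarith : -z.re ≤ -z.re + ‖Z‖ + r) hgc.continuousOn ⟨h1, h2⟩
    have h4 := (h ((-τ : ℝ) : ℂ) (by simpa [dist_eq_norm, hg] using hτr)).1
    rw [Complex.ofReal_mem_slitPlane] at h4
    linarith [hτ.1]
  refine fun z hz => ⟨hslit z hz, ?_⟩
  rcases hr.eq_or_lt with h0 | h0
  · refine (h z ?_).2
    rw [← h0, Metric.closedBall_zero] at hz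
    rw [← h0, Metric.sphere_zero]
    exact hz
  · refine Complex.norm_le_of_forall_mem_frontier_norm_le (U := Metric.ball Z r)
      Metric.isBounded_ball ?_ (fun z hz => (h z ?_).2) ?_
    · refine DifferentiableOn.diffContOnCl fun z hz => ?_
      rw [closure_ball _ h0.ne'] at hz
      exact (Complex.differentiableAt_log (hslit z hz)).differentiableWithinAt
    · rwa [frontier_ball _ h0.ne'] at hz
    · rwa [closure_ball _ h0.ne']

namespace LogBounded

variable {Z : ℂ} {r q : ℝ}

/-- Points of larger logarithm lie outside of the disk. -/
lemma exp_notMem_closedBall (h : LogBounded Z r q) {ζ : ℂ} (hζ : q < ‖ζ‖) (hpi : ‖ζ‖ < Real.pi) :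
    Complex.exp ζ ∉ Metric.closedBall Z r := fun hm => by
  have := (h _ hm).2
  rw [log_exp_of_norm_lt_pi hpi] at this
  exact absurd hζ this.not_gt

/-- If exp ζ were interior, then exp(τζ) would also lie in the ball for some τ slightly larger than
1, although its logarithm has modulus greater than q. -/
lemma exp_notMem_ball (h : LogBounded Z r q) (hq : 0 < q) (hpi : q < Real.pi) {ζ : ℂ}
    (hζ : ‖ζ‖ = q) : Complex.exp ζ ∉ Metric.ball Z r := fun hm => by
  have hc : ContinuousAt (fun τ : ℝ => Complex.exp (τ * ζ)) 1 := by fun_prop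
  have h1 : ∀ᶠ τ : ℝ in nhds 1, Complex.exp (τ * ζ) ∈ Metric.ball Z r :=
    hc.eventually_mem (by simpa using Metric.isOpen_ball.mem_nhds hm)
  have h2 : ∀ᶠ τ : ℝ in nhds 1, τ * q < Real.pi := by
    have hc : ContinuousAt (fun τ : ℝ => τ * q) 1 := by fun_prop
    exact hc.eventually_lt_const (by simpa using hpi)
  obtain ⟨τ, ⟨hτ1, hτ2⟩, hτ⟩ := (((h1.and h2).filter_mono
    (nhdsWithin_le_nhds (s := Ioi (1 : ℝ)))).and self_mem_nhdsWithin).exists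
  have hn : ‖(τ : ℂ) * ζ‖ = τ * q := by
    rw [norm_mul, Complex.norm_real, Real.norm_of_nonneg (zero_le_one.trans (le_of_lt hτ)), hζ]
  refine h.exp_notMem_closedBall (ζ := τ * ζ) ?_ (by rwa [hn]) (Metric.ball_subset_closedBall hτ1)
  rw [hn]
  have : 1 < τ := hτ
  nlinarith

end LogBounded

/-! ### Derivatives of the distance to a fixed point along `gammaCurve` -/

lemma hasDerivAt_gammaCurve (q τ : ℝ) : HasDerivAt (gammaCurve q)
    (gammaCurve q τ * (q * (Complex.exp (τ * Complex.I) * Complex.I))) τ := by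
  have h1 : HasDerivAt (fun τ : ℝ => (τ : ℂ) * Complex.I) (1 * Complex.I) τ :=
    Complex.ofRealCLM.hasDerivAt.mul_const Complex.I
  have h2 := (h1.cexp.const_mul (q : ℂ)).cexp
  rw [one_mul] at h2
  exact h2

lemma hasDerivAt_normSq_gammaCurve_sub (q τ : ℝ) (Z : ℂ) :
    HasDerivAt (fun τ => ‖gammaCurve q τ - Z‖ ^ 2)
      (2 * inner ℝ (gammaCurve q τ - Z)
        (gammaCurve q τ * (q * (Complex.exp (τ * Complex.I) * Complex.I)))) τ :=
  ((hasDerivAt_gammaCurve q τ).sub_const Z).norm_sq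

lemma hasDerivAt_deriv_normSq_gammaCurve_sub (q τ : ℝ) (Z : ℂ) :
    HasDerivAt (deriv fun τ => ‖gammaCurve q τ - Z‖ ^ 2)
      (2 * (inner ℝ (gammaCurve q τ - Z)
          (-(gammaCurve q τ * (q * Complex.exp (τ * Complex.I) +
            (q * Complex.exp (τ * Complex.I)) ^ 2))) +
        ‖gammaCurve q τ * (q * Complex.exp (τ * Complex.I))‖ ^ 2)) τ := by
  have h0 : (deriv fun τ => ‖gammaCurve q τ - Z‖ ^ 2) = fun τ =>
      2 * inner ℝ (gammaCurve q τ - Z)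
        (gammaCurve q τ * (q * (Complex.exp (τ * Complex.I) * Complex.I))) :=
    funext fun τ => (hasDerivAt_normSq_gammaCurve_sub q τ Z).deriv
  rw [h0]
  have hE : HasDerivAt (fun τ : ℝ => Complex.exp (τ * Complex.I))
      (Complex.exp (τ * Complex.I) * Complex.I) τ := by
    have h1 : HasDerivAt (fun τ : ℝ => (τ : ℂ) * Complex.I) (1 * Complex.I) τ :=
      Complex.ofRealCLM.hasDerivAt.mul_const Complex.I
    have h2 := h1.cexp
    rwa [one_mul] at h2
  have hG := (hasDerivAt_gammaCurve q τ).mul ((hE.mul_const Complex.I).const_mul (q : ℂ))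
  have hI := Complex.I_sq
  refine ((((hasDerivAt_gammaCurve q τ).sub_const Z).inner ℝ hG).const_mul 2).congr_deriv ?_
  have hn : ‖gammaCurve q τ * (q * Complex.exp (τ * Complex.I))‖ =
      ‖gammaCurve q τ * (q * (Complex.exp (τ * Complex.I) * Complex.I))‖ := by
    simp only [norm_mul, Complex.norm_I, mul_one]
  rw [hn, ← real_inner_self_eq_norm_sq]
  congr 3
  linear_combination gammaCurve q τ * (q * Complex.exp (τ * Complex.I) +
            (q * Complex.exp (τ * Complex.I)) ^ 2) * hI

/-- At the points with cos t = 0 the value k = q corresponds to the osculating circle; the sign of q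
− k decides between a local minimum and a local maximum of the distance. -/
lemma deriv_deriv_normSq_gammaCurve_sub {q t : ℝ} {k : ℝ} {Z : ℂ}
    (hZ : Z = gammaCurve q t * (1 - k * Complex.exp (t * Complex.I))) (hc : Real.cos t = 0) :
    deriv (deriv fun τ => ‖gammaCurve q τ - Z‖ ^ 2) t =
      2 * ‖gammaCurve q t‖ ^ 2 * (q * (q - k)) := by
  rw [(hasDerivAt_deriv_normSq_gammaCurve_sub q t Z).deriv, hZ, Complex.inner]
  have h1 : gammaCurve q t - gammaCurve q t * (1 - k * Complex.exp (t * Complex.I)) =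
      gammaCurve q t * (k * Complex.exp (t * Complex.I)) := by ring
  have hg : gammaCurve q t * conj (gammaCurve q t) = ((‖gammaCurve q t‖ ^ 2 : ℝ) : ℂ) := by
    rw [Complex.mul_conj, Complex.normSq_eq_norm_sq]
  have he : Complex.exp (t * Complex.I) * conj (Complex.exp (t * Complex.I)) = 1 := by
    rw [Complex.mul_conj, Complex.normSq_eq_norm_sq, norm_exp_mul_I]; simp
  have h2 : -(gammaCurve q t * (q * Complex.exp (t * Complex.I) +
      (q * Complex.exp (t * Complex.I)) ^ 2)) * conj (gammaCurve q t *
        (k * Complex.exp (t * Complex.I))) =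
      -((‖gammaCurve q t‖ ^ 2 * (q * k) : ℝ) : ℂ) -
        ((‖gammaCurve q t‖ ^ 2 * (q ^ 2 * k) : ℝ) : ℂ) * Complex.exp (t * Complex.I) := by
    simp only [map_mul, Complex.conj_ofReal]
    push_cast at hg ⊢
    linear_combination (-(k * q * (1 + q * Complex.exp (t * Complex.I))) *
      Complex.exp (t * Complex.I) * conj (Complex.exp (t * Complex.I))) * hg -
      (‖gammaCurve q t‖ : ℂ) ^ 2 * k * q * (1 + q * Complex.exp (t * Complex.I)) * he
  have h3 : (Complex.exp (t * Complex.I)).re = 0 := by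
    rw [Complex.exp_ofReal_mul_I_re, hc]
  rw [h1, h2, norm_mul, norm_mul, norm_exp_mul_I, mul_one, Complex.sub_re, Complex.neg_re,
    Complex.ofReal_re, Complex.re_ofReal_mul, h3, Complex.norm_real, Real.norm_eq_abs, mul_pow,
    sq_abs]
  ring

end

end Magnus

namespace Magnus

noncomputable section

local notation "conj" => starRingEnd ℂ

/-! ### Touching points of disks with bounded logarithm -/

lemma norm_gammaCurve (q t : ℝ) : ‖gammaCurve q t‖ = Real.exp (q * Real.cos t) := by
  rw [gammaCurve, Complex.norm_exp, Complex.re_ofReal_mul, Complex.exp_ofReal_mul_I_re]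

lemma gammaCurve_eq (q t : ℝ) : gammaCurve q t = Real.exp (q * Real.cos t) *
    Complex.exp (((q * Real.sin t : ℝ) : ℂ) * Complex.I) := by
  rw [gammaCurve, Complex.exp_mul_I, ← Complex.ofReal_cos, ← Complex.ofReal_sin,
    Complex.ofReal_exp, ← Complex.exp_add]
  congr 1
  push_cast
  ring

lemma gammaCurve_ne_zero (q t : ℝ) : gammaCurve q t ≠ 0 := Complex.exp_ne_zero _

/-- The point of `exp ∂D(0,q)` mirrored to `gammaCurve q t` with respect to the unit circle. -/
lemma exp_neg_conj_eq (q t : ℝ) :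
    Complex.exp (-conj (q * Complex.exp (t * Complex.I))) =
      gammaCurve q t * (1 - (2 * relRadius q (Real.cos t) * Real.cos t : ℝ)) := by
  rw [two_mul_relRadius_mul, gammaCurve]
  push_cast
  rw [sub_sub_cancel, ← Complex.exp_add, Complex.cos, map_mul, Complex.conj_ofReal,
    ← Complex.exp_conj, map_mul, Complex.conj_I, Complex.conj_ofReal]
  congr 1
  ring_nf

namespace LogBounded

variable {Z : ℂ} {r q t : ℝ}

lemma le_norm_gammaCurve_sub (h : LogBounded Z r q) (hq : 0 < q) (hpi : q < Real.pi) (τ : ℝ) :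
    r ≤ ‖gammaCurve q τ - Z‖ := by
  have := h.exp_notMem_ball hq hpi (norm_ofReal_mul_exp hq.le τ)
  rwa [Metric.mem_ball, not_lt, dist_eq_norm] at this

lemma isLocalMin (h : LogBounded Z r q) (hr : 0 ≤ r) (hq : 0 < q) (hpi : q < Real.pi)
    (ht : ‖gammaCurve q t - Z‖ = r) : IsLocalMin (fun τ => ‖gammaCurve q τ - Z‖ ^ 2) t :=
  Filter.Eventually.of_forall fun τ => by
    simp only [ht]
    exact pow_le_pow_left₀ hr (h.le_norm_gammaCurve_sub hq hpi τ) 2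

/-- The center of a touching disk is on the inner normal. -/
lemma exists_center_eq (h : LogBounded Z r q) (hr : 0 ≤ r) (hq : 0 < q) (hpi : q < Real.pi)
    (ht : ‖gammaCurve q t - Z‖ = r) :
    ∃ k : ℝ, 0 ≤ k ∧ Z = gammaCurve q t * (1 - k * Complex.exp (t * Complex.I)) := by
  set e := Complex.exp (t * Complex.I) with he
  have he0 : e ≠ 0 := Complex.exp_ne_zero _
  have hγ0 := gammaCurve_ne_zero q t
  obtain ⟨κ, hκ⟩ : ∃ κ : ℂ, gammaCurve q t - Z = gammaCurve q t * (κ * e) :=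
    ⟨(gammaCurve q t - Z) / gammaCurve q t / e, by field_simp⟩
  have hgg : gammaCurve q t * conj (gammaCurve q t) = ((‖gammaCurve q t‖ ^ 2 : ℝ) : ℂ) := by
    rw [Complex.mul_conj, Complex.normSq_eq_norm_sq]
  have hee : e * conj e = 1 := by
    rw [Complex.mul_conj, Complex.normSq_eq_norm_sq, he, norm_exp_mul_I]; simp
  have hpos : 0 < ‖gammaCurve q t‖ ^ 2 := by positivity
  -- Stationarity of the distance along the curve kills the tangential component of κ.
  have him : κ.im = 0 := by
    have h1 := (h.isLocalMin hr hq hpi ht).hasDerivAt_eq_zero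
      (hasDerivAt_normSq_gammaCurve_sub q t Z)
    rw [hκ, Complex.inner] at h1
    have h2 : gammaCurve q t * (q * (Complex.exp (t * Complex.I) * Complex.I)) *
        conj (gammaCurve q t * (κ * e)) =
        ((‖gammaCurve q t‖ ^ 2 * q : ℝ) : ℂ) * (Complex.I * conj κ) := by
      rw [← he]
      push_cast at hgg ⊢
      simp only [map_mul]
      linear_combination q * e * Complex.I * conj κ * conj e * hgg +
        (‖gammaCurve q t‖ : ℂ) ^ 2 * q * Complex.I * conj κ * hee
    rw [h2, Complex.re_ofReal_mul] at h1
    have h3 : (Complex.I * conj κ).re = κ.im := by simp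
    rw [h3] at h1
    have : ‖gammaCurve q t‖ ^ 2 * q ≠ 0 := by positivity
    simpa [this, hq.ne', hγ0] using h1
  -- The points exp(ρe) with ρ slightly larger than q lie outside the disk, so the radial derivative
  -- of the squared distance to the center is nonnegative.
  have hre : 0 ≤ κ.re := by
    set g : ℝ → ℂ := fun ρ => Complex.exp (ρ * e) with hg
    have hgq : g q = gammaCurve q t := rfl
    have hgd : HasDerivAt g (g q * e) q := by
      have h1 : HasDerivAt (fun ρ : ℝ => (ρ : ℂ) * e) (1 * e) q :=
        Complex.ofRealCLM.hasDerivAt.mul_const e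
      have h2 := h1.cexp
      rwa [one_mul] at h2
    have hd := (hgd.sub_const Z).norm_sq
    have hge : 0 ≤ 2 * inner ℝ (g q - Z) (g q * e) := by
      refine ge_of_tendsto hd.tendsto_slope_zero_right ?_
      have h2 : ∀ᶠ τ : ℝ in nhds 0, q + τ < Real.pi := by
        have hc : ContinuousAt (fun τ : ℝ => q + τ) 0 := by fun_prop
        exact hc.eventually_lt_const (by simpa using hpi)
      filter_upwards [h2.filter_mono nhdsWithin_le_nhds, self_mem_nhdsWithin] with τ hτ hτ0
      have hτ0 : 0 < τ := hτ0
      have hn : ‖((q + τ : ℝ) : ℂ) * e‖ = q + τ := norm_ofReal_mul_exp (by linarith) t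
      have h3 := h.exp_notMem_closedBall (ζ := ((q + τ : ℝ) : ℂ) * e)
        (by rw [hn]; linarith) (by rwa [hn])
      rw [Metric.mem_closedBall, not_le, dist_eq_norm] at h3
      rw [smul_eq_mul]
      refine mul_nonneg (inv_nonneg.2 hτ0.le) (sub_nonneg.2 ?_)
      rw [hgq, ht]
      exact pow_le_pow_left₀ hr h3.le 2
    rw [hgq, hκ, Complex.inner] at hge
    have h2 : gammaCurve q t * e * conj (gammaCurve q t * (κ * e)) =
        ((‖gammaCurve q t‖ ^ 2 : ℝ) : ℂ) * conj κ := by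
      push_cast at hgg ⊢
      simp only [map_mul]
      linear_combination e * conj κ * conj e * hgg + (‖gammaCurve q t‖ : ℂ) ^ 2 * conj κ * hee
    rw [h2, Complex.re_ofReal_mul, Complex.conj_re] at hge
    exact nonneg_of_mul_nonneg_right (by linarith) hpos
  refine ⟨κ.re, hre, ?_⟩
  have hκr : ((κ.re : ℝ) : ℂ) = κ := Complex.ext (by simp) (by simp [him])
  rw [hκr]
  linear_combination -hκ

lemma radius_eq {k : ℝ} (hk : 0 ≤ k) (ht : ‖gammaCurve q t - Z‖ = r)
    (hZ : Z = gammaCurve q t * (1 - k * Complex.exp (t * Complex.I))) :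
    r = Real.exp (q * Real.cos t) * k := by
  have h1 : gammaCurve q t - gammaCurve q t * (1 - k * Complex.exp (t * Complex.I)) =
      gammaCurve q t * (k * Complex.exp (t * Complex.I)) := by ring
  rw [← ht, hZ, h1, norm_mul, norm_gammaCurve, norm_ofReal_mul_exp hk]

/-- The distance from the center to the mirrored point. -/
lemma normSq_mirror_sub {k : ℝ} (hZ : Z = gammaCurve q t * (1 - k * Complex.exp (t * Complex.I))) :
    ‖Complex.exp (-conj (q * Complex.exp (t * Complex.I))) - Z‖ ^ 2 =
      Real.exp (q * Real.cos t) ^ 2 * (k ^ 2 - 4 * Real.cos t ^ 2 * relRadius q (Real.cos t) *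
        (k - relRadius q (Real.cos t))) := by
  set m := relRadius q (Real.cos t) with hm
  have h1 : Complex.exp (-conj (q * Complex.exp (t * Complex.I))) - Z =
      gammaCurve q t * (k * Complex.exp (t * Complex.I) - (2 * m * Real.cos t : ℝ)) := by
    rw [exp_neg_conj_eq, hZ, ← hm]; ring
  have hcs := Real.cos_sq_add_sin_sq t
  rw [h1, norm_mul, mul_pow, norm_gammaCurve, ← Complex.normSq_eq_norm_sq, Complex.normSq_apply]
  simp only [Complex.sub_re, Complex.sub_im, Complex.re_ofReal_mul, Complex.im_ofReal_mul,
    Complex.exp_ofReal_mul_I_re, Complex.exp_ofReal_mul_I_im, Complex.ofReal_re,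
    Complex.ofReal_im]
  congr 1
  linear_combination k ^ 2 * hcs

/-- The radius of a touching disk is bounded by the second touching point, or by the osculating
radius. -/
lemma le_relRadius (h : LogBounded Z r q) (hr : 0 ≤ r) (hq : 0 < q) (hpi : q < Real.pi)
    (ht : ‖gammaCurve q t - Z‖ = r) {k : ℝ} (hk : 0 ≤ k)
    (hZ : Z = gammaCurve q t * (1 - k * Complex.exp (t * Complex.I))) :
    k ≤ relRadius q (Real.cos t) := by
  by_contra! hlt
  by_cases hc : Real.cos t = 0
  · rw [hc, relRadius_zero_right] at hlt
    have hmin := h.isLocalMin hr hq hpi ht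
    have hdd := deriv_deriv_normSq_gammaCurve_sub hZ hc
    have hneg : 2 * ‖gammaCurve q t‖ ^ 2 * (q * (q - k)) < 0 := by
      have : 0 < ‖gammaCurve q t‖ ^ 2 := by have := gammaCurve_ne_zero q t; positivity
      exact mul_neg_of_pos_of_neg (by positivity) (mul_neg_of_pos_of_neg hq (by linarith))
    -- A point that is both a local minimum and a local maximum makes the distance locally constant,
    -- contradicting the negative second derivative.
    have hmax := isLocalMax_of_deriv_deriv_neg (hdd.trans_lt hneg) hmin.deriv_eq_zero
      (hasDerivAt_normSq_gammaCurve_sub q t Z).continuousAt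
    have hconst : (fun τ => ‖gammaCurve q τ - Z‖ ^ 2) =ᶠ[nhds t]
        fun _ => ‖gammaCurve q t - Z‖ ^ 2 := by
      filter_upwards [hmin, hmax] with τ h1 h2 using le_antisymm h2 h1
    have := hconst.deriv.deriv_eq
    rw [hdd] at this
    simp only [deriv_const'] at this
    linarith
  · have hm : 0 < relRadius q (Real.cos t) := by
      have := strictMono_relRadius (Real.cos t) hq
      simpa using this
    -- The mirrored point lies on exp ∂D(0, q) too, but by `normSq_mirror_sub` it would be interior
    -- to the disk if k exceeded the relative radius.
    have h1 := h.exp_notMem_ball hq hpi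
      (ζ := -conj (q * Complex.exp (t * Complex.I)))
      (by rw [norm_neg, Complex.norm_conj, norm_ofReal_mul_exp hq.le])
    rw [Metric.mem_ball, not_lt, dist_eq_norm] at h1
    have h2 := pow_le_pow_left₀ hr h1 2
    rw [normSq_mirror_sub hZ, radius_eq hk ht hZ, mul_pow] at h2
    have hE : 0 < Real.exp (q * Real.cos t) ^ 2 := by positivity
    have h3 := le_of_mul_le_mul_left h2 hE
    have h4 : 0 < 4 * Real.cos t ^ 2 * relRadius q (Real.cos t) *
        (k - relRadius q (Real.cos t)) :=
      mul_pos (by positivity) (by linarith)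
    linarith

end LogBounded

/-! ### Matrices whose chiral disk touches `exp ∂D(0,q)` -/

lemma norm_act_div_sub (A : M2) {u : ℂ} (hu : u ≠ 0) :
    ‖act A u / u - chiralCenter A‖ = ‖antilin A‖ := by
  rw [act_div_self A hu, add_sub_cancel_left, norm_mul, norm_conj_div_self hu, mul_one]

/-- The quotients Au/u cover the whole boundary of the chiral disk, since conj u / u takes every
value of modulus one; when the antilinear part is zero any nonzero u works. -/
lemma exists_act_eq_of_mem_sphere {A : M2} {z : ℂ}
    (hz : z ∈ Metric.sphere (chiralCenter A) ‖antilin A‖) : ∃ u : ℂ, u ≠ 0 ∧ act A u = u * z := by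
  rw [mem_sphere_iff_norm] at hz
  by_cases hW : antilin A = 0
  · rw [hW, norm_zero, norm_sub_eq_zero_iff] at hz
    exact ⟨1, one_ne_zero, by simp [act, hW, hz]⟩
  · obtain ⟨u, hu, hω⟩ := exists_unit_conj_div ((z - chiralCenter A) / antilin A)
      (by rw [norm_div, hz, div_self (norm_ne_zero_iff.2 hW)])
    have hu0 : u ≠ 0 := norm_ne_zero_iff.1 (by rw [hu]; exact one_ne_zero)
    refine ⟨u, hu0, ?_⟩
    have h := act_div_self A hu0
    rw [hω, mul_div_cancel₀ _ hW, add_sub_cancel, div_eq_iff hu0] at h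
    rw [h, mul_comm]

/-- The normal form of a matrix whose chiral disk touches `exp ∂D(0,q)` from inside. -/
theorem LogBounded.exists_eq_NW {A : M2} {q t : ℝ}
    (h : LogBounded (chiralCenter A) ‖antilin A‖ q) (hq : 0 < q) (hpi : q < Real.pi) {u : ℂ}
    (hu : u ≠ 0) (hA : act A u = u * gammaCurve q t) :
    ∃ v ∈ Icc 0 q, ‖antilin A‖ = Real.exp (q * Real.cos t) * relRadius v (Real.cos t) ∧
      chiralCenter A = gammaCurve q t *
        (1 - relRadius v (Real.cos t) * Complex.exp (t * Complex.I)) ∧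
      A = NW (q - v) v t (rot (q * Real.sin t) * ofParts 0 (phase t u)) := by
  have hγ : act A u / u = gammaCurve q t := by rw [hA, mul_div_cancel_left₀ _ hu]
  have ht : ‖gammaCurve q t - chiralCenter A‖ = ‖antilin A‖ := by
    rw [← hγ, norm_act_div_sub A hu]
  obtain ⟨k, hk, hZ⟩ := h.exists_center_eq (norm_nonneg _) hq hpi ht
  have hkm := h.le_relRadius (norm_nonneg _) hq hpi ht hk hZ
  have hcont : Continuous fun v => relRadius v (Real.cos t) :=
    continuous_iff_continuousAt.2 fun v => (hasDerivAt_relRadius v _).continuousAt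
  -- The hyperbolic length v is the one whose relative radius equals the given k; it exists in [0,
  -- q] precisely because of the bound of `le_relRadius`.
  obtain ⟨v, hv, rfl⟩ := intermediate_value_Icc hq.le hcont.continuousOn
    ⟨by simpa using hk, hkm⟩
  refine ⟨v, hv, radius_eq hk ht hZ, hZ, ext_parts ?_ ?_⟩
  · rw [chiralCenter_NW_sub (chiralCenter_ofParts _ _), hZ, gammaCurve]
  · rw [antilin_NW_sub, antilin_ofParts, phase]
    have h1 := act_div_self A hu
    rw [hγ] at h1
    have hcu : conj u ≠ 0 := by simpa using hu
    have h2 : antilin A = gammaCurve q t *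
        (relRadius v (Real.cos t) * Complex.exp (t * Complex.I)) * (u / conj u) := by
      have : antilin A * (conj u / u) = gammaCurve q t *
        (relRadius v (Real.cos t) * Complex.exp (t * Complex.I)) := by
        linear_combination -hZ - h1
      rw [← this]; field_simp
    rw [h2, gammaCurve_eq]
    ring

end

end Magnus

namespace Magnus

noncomputable section

local notation "conj" => starRingEnd ℂ

/-! ### Flows realizing the normal form -/

lemma continuous_ofParts : Continuous fun q : ℂ × ℂ => ofParts q.1 q.2 := by
  refine continuous_matrix fun i j => ?_
  fin_cases i <;> fin_cases j <;> simp only [ofParts] <;> simp <;> fun_prop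

/-- The density of constant elliptic speed `a` along the normal form. -/
def normalDensity (q a t : ℝ) (η : ℂ) : ℝ → M2 :=
  (Icc 0 q).indicator fun s => ofParts (a * Complex.exp (t * Complex.I))
    ((1 - a) * η * Complex.exp (((2 * s * Real.sin t : ℝ) : ℂ) * Complex.I))

lemma isDensity_normalDensity {q a t : ℝ} {η : ℂ} (ha : a ∈ Icc (0 : ℝ) 1) (hη : ‖η‖ = 1) :
    IsDensity (normalDensity q a t η) q := by
  refine ⟨?_, fun s => ?_, fun s hs => indicator_of_notMem hs _⟩
  · refine StronglyMeasurable.indicator (Continuous.stronglyMeasurable ?_) measurableSet_Icc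
    exact continuous_ofParts.comp (continuous_const.prodMk (by fun_prop))
  · refine (norm_indicator_le_norm_self _ s).trans ((norm_le_add_norm _).trans ?_)
    have h1 : ‖(1 - a : ℂ)‖ = 1 - a := by
      rw [← Complex.ofReal_one, ← Complex.ofReal_sub, Complex.norm_real,
        Real.norm_of_nonneg (by linarith [ha.2])]
    rw [chiralCenter_ofParts, antilin_ofParts, norm_ofReal_mul_exp ha.1, norm_mul, norm_mul,
      norm_exp_mul_I, hη, h1]
    linarith

/-- The constant elliptic speed 1 − v/q over time q accumulates elliptic length q − v, so the
corresponding flow ends at the given normal form. -/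
lemma magnusExponent_NW_le {q v t : ℝ} {η : ℂ} (hq : 0 < q) (hv : v ∈ Icc 0 q) (hη : ‖η‖ = 1) :
    magnusExponent (NW (q - v) v t (rot (q * Real.sin t) * ofParts 0 η)) ≤ ENNReal.ofReal q := by
  have ha : 1 - v / q ∈ Icc (0 : ℝ) 1 :=
    ⟨sub_nonneg.2 ((div_le_one hq).2 hv.2), sub_le_self _ (div_nonneg hv.1 hq.le)⟩
  set a := 1 - v / q with hadef
  have hf := isDensity_normalDensity (q := q) (t := t) ha hη
  have hZ : ∀ s ∈ Icc 0 q, chiralCenter (normalDensity q a t η s) =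
      a * Complex.exp (t * Complex.I) := fun s hs => by
    rw [normalDensity, indicator_of_mem hs, chiralCenter_ofParts]
  have hn : ∀ s ∈ Icc 0 q, ‖chiralCenter (normalDensity q a t η s)‖ = a := fun s hs => by
    rw [hZ s hs, norm_ofReal_mul_exp ha.1]
  have hw : ellipticLength (normalDensity q a t η) q = q - v := by
    rw [ellipticLength, intervalIntegral.integral_congr (g := fun _ => a) (fun s hs => by
      rw [uIcc_of_le hq.le] at hs
      exact hn s hs), intervalIntegral.integral_const, smul_eq_mul, hadef]
    field_simp
    ring
  have h := hf.flow_eq_NW hη (t := t) (.of_forall fun s hs => ?_) ⟨hq.le, le_rfl⟩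
  · rw [hw, sub_sub_cancel] at h
    rw [← h]
    exact hf.magnusExponent_flow_le hq.le
  · rw [hn s hs]
    refine ⟨hZ s hs, ?_⟩
    rw [normalDensity, indicator_of_mem hs, antilin_ofParts]

namespace IsDensity

variable {f g : ℝ → M2} {p : ℝ}

/-- Each boundary point of the chiral disk is an endpoint Uu/u of a trajectory, hence the
exponential of a number of modulus at most p < π; the interior follows from `logBounded_of_sphere`.
-/
theorem logBounded_flow (hf : IsDensity f p) (hp : 0 ≤ p) (hpi : p < Real.pi) :
    LogBounded (chiralCenter (flow f p)) ‖antilin (flow f p)‖ p := by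
  refine logBounded_of_sphere (norm_nonneg _) fun z hz => ?_
  obtain ⟨u, hu, h⟩ := exists_act_eq_of_mem_sphere hz
  obtain ⟨ℓ, hℓ, h'⟩ := hf.exists_act_eq_exp hp hu
  have hz : z = Complex.exp ℓ := mul_left_cancel₀ hu (h.symm.trans h')
  rw [hz, log_exp_of_norm_lt_pi (hℓ.trans_lt hpi)]
  exact ⟨exp_mem_slitPlane_of_norm_lt_pi (hℓ.trans_lt hpi), hℓ⟩

end IsDensity

lemma eq_one_of_act_eq {A : M2} (h : ∀ u : ℂ, u ≠ 0 → act A u = u) : A = 1 := by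
  have h1 := h 1 one_ne_zero
  have h2 := h Complex.I Complex.I_ne_zero
  simp only [act, map_one, mul_one, Complex.conj_I] at h1 h2
  have h3 : chiralCenter A - antilin A = 1 := by
    refine mul_right_cancel₀ Complex.I_ne_zero ?_
    linear_combination h2
  refine ext_parts ?_ ?_
  · rw [chiralCenter_one]; linear_combination (h1 + h3) / 2
  · rw [antilin_one]; linear_combination (h1 - h3) / 2

lemma exists_gammaCurve_eq (ζ : ℂ) :
    ∃ t ∈ Ico (0 : ℝ) (2 * Real.pi), gammaCurve ‖ζ‖ t = Complex.exp ζ := by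
  refine ⟨toIcoMod Real.two_pi_pos 0 ζ.arg, by simpa using toIcoMod_mem_Ico Real.two_pi_pos 0 ζ.arg,
    ?_⟩
  have h : Complex.exp (((toIcoMod Real.two_pi_pos 0 ζ.arg : ℝ) : ℂ) * Complex.I) =
      Complex.exp (ζ.arg * Complex.I) := by
    rw [Complex.exp_eq_exp_iff_exists_int]
    refine ⟨-toIcoDiv Real.two_pi_pos 0 ζ.arg, ?_⟩
    rw [toIcoMod]
    push_cast
    simp
    ring
  rw [gammaCurve, h, Complex.norm_mul_exp_arg_mul_I]

/-- The chiral disk of `A` touches `exp ∂D(0,p)` for the Magnus exponent `p` of `A`. -/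
theorem exists_act_eq_gammaCurve {A : M2} (hA : A ≠ 1) {p : ℝ} (hpi : p < Real.pi)
    (hM : ENNReal.ofReal p ≤ magnusExponent A)
    (hB : LogBounded (chiralCenter A) ‖antilin A‖ p) :
    ∃ u : ℂ, u ≠ 0 ∧ ∃ t ∈ Ico (0 : ℝ) (2 * Real.pi), act A u = u * gammaCurve p t := by
  have hne : (Metric.closedBall (chiralCenter A) ‖antilin A‖).Nonempty :=
    Metric.nonempty_closedBall.2 (norm_nonneg _)
  obtain ⟨z, hz, hmax⟩ := (isCompact_closedBall (chiralCenter A) ‖antilin A‖).exists_isMaxOn hne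
    (f := fun z => ‖Complex.log z‖)
    (fun z hz => (Complex.differentiableAt_log (hB z hz).1).continuousAt.norm.continuousWithinAt)
  set q := ‖Complex.log z‖ with hq
  have hBq : LogBounded (chiralCenter A) ‖antilin A‖ q := fun w hw => ⟨(hB w hw).1, hmax hw⟩
  have hqp : q ≤ p := (hB z hz).2
  have hz0 := Complex.slitPlane_ne_zero (hB z hz).1
  -- If log vanished on the whole disk, A would fix every vector.
  have hq0 : 0 < q := by
    refine (norm_nonneg _).lt_of_ne fun h0 => hA (eq_one_of_act_eq fun u hu => ?_)
    have hmem : act A u / u ∈ Metric.closedBall (chiralCenter A) ‖antilin A‖ := by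
      rw [mem_closedBall_iff_norm, norm_act_div_sub A hu]
    have h1 : Complex.log (act A u / u) = 0 := by
      rw [← norm_le_zero_iff, h0]; exact hmax hmem
    have h2 := Complex.exp_log (Complex.slitPlane_ne_zero (hB _ hmem).1)
    rw [h1, Complex.exp_zero] at h2
    exact ((div_eq_one_iff_eq hu).1 h2.symm)
  have hqpi := hqp.trans_lt hpi
  have hsphere : z ∈ Metric.sphere (chiralCenter A) ‖antilin A‖ := by
    have := hBq.exp_notMem_ball hq0 hqpi hq.symm
    rw [Complex.exp_log hz0] at this
    rw [Metric.mem_ball, not_lt] at this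
    exact le_antisymm hz this
  obtain ⟨u, hu, hAu⟩ := exists_act_eq_of_mem_sphere hsphere
  obtain ⟨t, ht, hγ⟩ := exists_gammaCurve_eq (Complex.log z)
  rw [Complex.exp_log hz0, ← hq] at hγ
  rw [← hγ] at hAu
  obtain ⟨v, hv, -, -, hNW⟩ := hBq.exists_eq_NW hq0 hqpi hu hAu
  -- A is now a normal form of total length q, so its Magnus exponent is at most q.
  have hle : p ≤ q := by
    have := hM.trans (hNW ▸ magnusExponent_NW_le hq0 hv (norm_phase t hu))
    exact (ENNReal.ofReal_le_ofReal_iff hq0.le).1 this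
  rw [le_antisymm hqp hle] at hAu
  exact ⟨u, hu, t, ht, hAu⟩

lemma LogBounded.exists_act_eq {A : M2} {q t : ℝ}
    (h : LogBounded (chiralCenter A) ‖antilin A‖ q) (hq : 0 < q) (hpi : q < Real.pi)
    (hd : gammaCurve q t ∈ chiralDisk A) : ∃ u : ℂ, u ≠ 0 ∧ act A u = u * gammaCurve q t := by
  refine exists_act_eq_of_mem_sphere (le_antisymm ?_ ?_)
  · rw [chiralDisk, chiralRadius_eq] at hd; exact hd
  · rw [dist_eq_norm]; exact h.le_norm_gammaCurve_sub hq hpi t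

/-- Touching at the extremal radius forces the Magnus hyperbolic or parabolic class. -/
theorem hyperbolic_or_parabolic {A : M2} {p t : ℝ} (hp : 0 < p) (hpi : p < Real.pi)
    (hM : (magnusExponent A).toReal = p) (hB : LogBounded (chiralCenter A) ‖antilin A‖ p)
    (hW : ‖antilin A‖ = Real.exp (p * Real.cos t) * relRadius p (Real.cos t))
    (hZ : chiralCenter A = gammaCurve p t *
      (1 - relRadius p (Real.cos t) * Complex.exp (t * Complex.I))) :
    IsMagnusHyperbolic A ∨ IsMagnusParabolic A := by
  set m := relRadius p (Real.cos t) with hm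
  have hm0 : 0 < m := by
    have := strictMono_relRadius (Real.cos t) hp
    simpa using this
  have hE : 0 < Real.exp (p * Real.cos t) := Real.exp_pos _
  have hcs := Real.cos_sq_add_sin_sq t
  -- At the extremal radius m the determinant is exp(2p cos t)(1 − 2m cos t), and the second factor
  -- is exp(−2p cos t).
  have hdet : A.det = 1 := by
    have h1 : ‖(1 - m * Complex.exp (t * Complex.I) : ℂ)‖ ^ 2 = 1 - 2 * m * Real.cos t + m ^ 2 := by
      rw [← Complex.normSq_eq_norm_sq, Complex.normSq_apply]
      simp only [Complex.sub_re, Complex.sub_im, Complex.re_ofReal_mul, Complex.im_ofReal_mul,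
        Complex.exp_ofReal_mul_I_re, Complex.exp_ofReal_mul_I_im, Complex.one_re, Complex.one_im]
      linear_combination m ^ 2 * hcs
    rw [det_eq, hZ, hW, norm_mul, mul_pow, h1, norm_gammaCurve, two_mul_relRadius_mul, mul_pow,
      ← mul_sub, add_sub_cancel_right, sub_sub_cancel, sq, ← Real.exp_add, ← Real.exp_add,
      Real.exp_eq_one_iff]
    ring
  have hdist : ‖gammaCurve p t - chiralCenter A‖ = ‖antilin A‖ := by
    have h1 : gammaCurve p t - gammaCurve p t * (1 - m * Complex.exp (t * Complex.I)) =
      gammaCurve p t * (m * Complex.exp (t * Complex.I)) := by ring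
    rw [hZ, h1, norm_mul, norm_gammaCurve, norm_ofReal_mul_exp hm0.le, hW]
  have hmem : gammaCurve p t ∈ chiralDisk A := by
    rw [chiralDisk, chiralRadius_eq, mem_closedBall_iff_norm, hdist]
  by_cases hc : Real.cos t = 0
  · right
    obtain ⟨t', ht', hexp⟩ : ∃ t' : ℝ, (t' = Real.pi / 2 ∨ t' = -(Real.pi / 2)) ∧
        Complex.exp (t' * Complex.I) = Complex.exp (t * Complex.I) := by
      have hs : Real.sin t = 1 ∨ Real.sin t = -1 := by
        rw [hc] at hcs
        exact mul_self_eq_one_iff.1 (by linarith [sq (Real.sin t)])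
      rcases hs with hs | hs
      · refine ⟨Real.pi / 2, .inl rfl, ?_⟩
        rw [Complex.exp_mul_I, Complex.exp_mul_I, ← Complex.ofReal_cos, ← Complex.ofReal_cos,
          ← Complex.ofReal_sin, ← Complex.ofReal_sin, hc, hs, Real.cos_pi_div_two,
          Real.sin_pi_div_two]
      · refine ⟨-(Real.pi / 2), .inr rfl, ?_⟩
        rw [Complex.exp_mul_I, Complex.exp_mul_I, ← Complex.ofReal_cos, ← Complex.ofReal_cos,
          ← Complex.ofReal_sin, ← Complex.ofReal_sin, hc, hs, Real.cos_neg, Real.sin_neg,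
          Real.cos_pi_div_two, Real.sin_pi_div_two]
    have hc' : Real.cos t' = 0 := by
      rcases ht' with rfl | rfl <;> simp
    have hγ : gammaCurve p t' = gammaCurve p t := by rw [gammaCurve, hexp, gammaCurve]
    have hmp : m = p := by rw [hm, hc, relRadius_zero_right]
    rw [← hγ, ← hexp] at hZ
    rw [← hγ] at hdist hmem
    refine ⟨hdet, t', ht', ?_⟩
    rw [hM, touchSet, hM, chiralRadius_eq]
    refine ⟨⟨hmem, mem_range_self _⟩, ?_, hdist, ?_, ?_⟩
    · rw [hW]; positivity
    · exact (hB.isLocalMin (norm_nonneg _) hp hpi hdist).deriv_eq_zero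
    · rw [deriv_deriv_normSq_gammaCurve_sub hZ hc', hmp, sub_self, mul_zero, mul_zero]
  · left
    -- At the extremal radius the mirrored point lies on the boundary circle of the chiral disk; it
    -- supplies the second touching point, with parameter π − t.
    have hmir : Complex.exp (-conj (p * Complex.exp (t * Complex.I))) =
        gammaCurve p (Real.pi - t) := by
      have h1 : Complex.exp (((Real.pi - t : ℝ) : ℂ) * Complex.I) =
          -Complex.exp (t * -Complex.I) := by
        rw [Complex.ofReal_sub, sub_mul, sub_eq_add_neg, Complex.exp_add, Complex.exp_pi_mul_I,
          neg_one_mul, mul_neg]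
      rw [gammaCurve, map_mul, Complex.conj_ofReal, ← Complex.exp_conj, map_mul, Complex.conj_I,
        Complex.conj_ofReal, h1, mul_neg, mul_neg]
    refine ⟨hdet, gammaCurve p t, ?_, gammaCurve p (Real.pi - t), ?_, fun heq => ?_⟩
    · rw [touchSet, hM]; exact ⟨hmem, mem_range_self _⟩
    · rw [touchSet, hM]
      refine ⟨?_, mem_range_self _⟩
      rw [chiralDisk, chiralRadius_eq, mem_closedBall_iff_norm, ← hmir]
      have h2 := LogBounded.normSq_mirror_sub hZ
      rw [← hm, sub_self, mul_zero, sub_zero, ← mul_pow, ← hW] at h2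
      exact ((pow_left_inj₀ (norm_nonneg _) (norm_nonneg _) two_ne_zero).1 h2).le
    · have h3 := congrArg norm heq
      rw [norm_gammaCurve, norm_gammaCurve, Real.cos_pi_sub] at h3
      have h4 := Real.exp_injective h3
      have : p * Real.cos t = 0 := by linarith
      exact (mul_ne_zero hp.ne' hc) this

end

end Magnus

namespace Magnus

noncomputable section

local notation "conj" => starRingEnd ℂ

/-! ### Developments of extremal flows -/

namespace IsDensity

variable {f g : ℝ → M2} {p : ℝ}

lemma ellipticLength_nonneg (hf : IsDensity f p) {s : ℝ} (hs : 0 ≤ s) : 0 ≤ ellipticLength f s := by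
  have := hf.monotone_ellipticLength hs
  rwa [ellipticLength_zero] at this

lemma ellipticLength_le (hf : IsDensity f p) {s : ℝ} (hs : 0 ≤ s) : ellipticLength f s ≤ s := by
  have := hf.monotone_sub_ellipticLength hs
  simp only [ellipticLength_zero, sub_zero] at this
  linarith

lemma ellipticLength_eq_zero (hf : IsDensity f p) (h : ellipticLength f p = 0) {s : ℝ}
    (hs : s ∈ Icc 0 p) : ellipticLength f s = 0 :=
  le_antisymm (h ▸ hf.monotone_ellipticLength hs.2) (hf.ellipticLength_nonneg hs.1)

lemma ellipticLength_eq_self (hf : IsDensity f p) (h : ellipticLength f p = p) {s : ℝ}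
    (hs : s ∈ Icc 0 p) : ellipticLength f s = s := by
  refine le_antisymm (hf.ellipticLength_le hs.1) ?_
  have := hf.monotone_sub_ellipticLength hs.2
  simp only [h, sub_self] at this
  linarith

/-- A flow that touches `exp ∂D(0,p)` develops along the normal form. -/
theorem flow_eq_NW_of_touch (hf : IsDensity f p) (hp : 0 ≤ p) (hpi : p < Real.pi) {u : ℂ}
    (hu : u ≠ 0) {t : ℝ} (h : act (flow f p) u = u * gammaCurve p t) {s : ℝ}
    (hs : s ∈ Icc 0 p) :
    flow f s = NW (ellipticLength f s) (s - ellipticLength f s) t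
      (rot (s * Real.sin t) * ofParts 0 (phase t u)) :=
  hf.flow_eq_NW (norm_phase t hu) (hf.ae_parts_of_extremal hp hpi hu h) hs

/-- Touching in two points is possible only without an elliptic part. -/
theorem ellipticLength_eq_zero_of_touch (hf : IsDensity f p) (hp : 0 ≤ p) (hpi : p < Real.pi)
    {u u' : ℂ} (hu : u ≠ 0) (hu' : u' ≠ 0) {t t' : ℝ}
    (h : act (flow f p) u = u * gammaCurve p t) (h' : act (flow f p) u' = u' * gammaCurve p t')
    (hne : Complex.exp (t * Complex.I) ≠ Complex.exp (t' * Complex.I)) :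
    ellipticLength f p = 0 := by
  rw [ellipticLength, intervalIntegral.integral_of_le hp]
  refine integral_eq_zero_of_ae ?_
  rw [Filter.EventuallyEq, ae_restrict_iff' measurableSet_Ioc]
  filter_upwards [hf.ae_parts_of_extremal hp hpi hu h, hf.ae_parts_of_extremal hp hpi hu' h']
    with s h1 h2 hs
  have hs' := Ioc_subset_Icc_self hs
  have h3 := (h1 hs').1.symm.trans (h2 hs').1
  rw [← sub_eq_zero, ← mul_sub, mul_eq_zero, or_iff_left (sub_ne_zero.2 hne)] at h3
  exact_mod_cast h3

lemma ne_one_pos (hf : IsDensity f p) (hp : 0 ≤ p) (h : flow f p ≠ 1) : 0 < p :=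
  hp.lt_of_ne fun h0 => h (by rw [← h0, hf.flow_zero])

/-- The flow determines its density. -/
lemma ae_eq_of_flow_eq (hf : IsDensity f p) (hg : IsDensity g p)
    (h : ∀ s ∈ Icc 0 p, flow f s = flow g s) :
    f =ᵐ[volume.restrict (Icc 0 p)] g := by
  rw [restrict_Ioo_eq_restrict_Icc.symm, Filter.EventuallyEq, ae_restrict_iff' measurableSet_Ioo]
  filter_upwards [hf.ae_hasDerivAt_flow, hg.ae_hasDerivAt_flow] with s h1 h2 hs
  have h3 : HasDerivAt (flow f) (g s * flow g s) s :=
    h2.congr_of_eventuallyEq (by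
      filter_upwards [Ioo_mem_nhds hs.1 hs.2] with σ hσ using h σ (Ioo_subset_Icc_self hσ))
  have h4 := h1.unique h3
  rw [← h s (Ioo_subset_Icc_self hs)] at h4
  -- Invertibility of the flow is what allows it to be cancelled from fU = gU.
  have hdet : IsUnit (flow f s).det := by
    rw [det_eq, isUnit_iff_ne_zero]
    have h5 := hf.norm_antilin_flow_lt hs.1.le
    have := norm_nonneg (antilin (flow f s))
    nlinarith
  exact (Matrix.isUnit_iff_isUnit_det _).2 hdet |>.mul_left_injective h4

end IsDensity

/-! ### Comparing normal forms -/

lemma ofParts_mem_kSet {η : ℂ} (hη : ‖η‖ = 1) : ofParts 0 η ∈ kSet :=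
  mem_kSet_iff.2 ⟨chiralCenter_ofParts _ _, by rw [antilin_ofParts, hη]⟩

lemma mK_mem_kSet : mK ∈ kSet := ⟨0, ⟨le_rfl, Real.two_pi_pos⟩, by simp⟩

lemma eq_of_antilin_eq {F F' : M2} (hF : F ∈ kSet) (hF' : F' ∈ kSet)
    (h : antilin F = antilin F') : F = F' :=
  ext_parts ((mem_kSet_iff.1 hF).1.trans (mem_kSet_iff.1 hF').1.symm) h

/-- Every admissible initial phase comes from a vector, so a prescribed development can be treated
as an extremal trajectory through it. -/
lemma exists_phase_eq {F : M2} (hF : F ∈ kSet) (t : ℝ) :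
    ∃ u : ℂ, u ≠ 0 ∧ F = ofParts 0 (phase t u) := by
  obtain ⟨hZ, hW⟩ := mem_kSet_iff.1 hF
  obtain ⟨u, hu, h⟩ := exists_unit_conj_div (Complex.exp (t * Complex.I) / antilin F)
    (by rw [norm_div, norm_exp_mul_I, hW, div_one])
  have hu0 : u ≠ 0 := norm_ne_zero_iff.1 (by rw [hu]; exact one_ne_zero)
  have hW0 : antilin F ≠ 0 := norm_ne_zero_iff.1 (by rw [hW]; exact one_ne_zero)
  refine ⟨u, hu0, ext_parts (by rw [hZ, chiralCenter_ofParts]) ?_⟩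
  have hcu : conj u ≠ 0 := by simpa using hu0
  rw [antilin_ofParts, phase]
  field_simp at h ⊢
  linear_combination h

lemma eq_of_exp_mul_I_eq {t t' : ℝ} (ht : t ∈ Ico 0 (2 * Real.pi)) (ht' : t' ∈ Ico 0 (2 * Real.pi))
    (h : Complex.exp (t * Complex.I) = Complex.exp (t' * Complex.I)) : t = t' := by
  obtain ⟨n, hn⟩ := Complex.exp_eq_exp_iff_exists_int.1 h
  have h1 : t = t' + n * (2 * Real.pi) := by
    have : ((t : ℝ) : ℂ) = ((t' + n * (2 * Real.pi) : ℝ) : ℂ) := by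
      refine mul_right_cancel₀ Complex.I_ne_zero ?_
      rw [hn]; push_cast; ring
    exact_mod_cast this
  have hpi := Real.two_pi_pos
  have h2 : (n : ℝ) < 1 := by
    by_contra! h3
    nlinarith [ht.2, ht'.1]
  have h3 : (-1 : ℝ) < n := by
    by_contra! h3
    nlinarith [ht.1, ht'.2]
  have h4 : n = 0 := by
    have h2 : n < 1 := by exact_mod_cast h2
    have h3 : -1 < n := by exact_mod_cast h3
    omega
  rw [h1, h4]; simp

/-- The direction and the initial phase of a hyperbolic development are determined by it. -/
lemma eq_of_NW_zero_eq {p t t' : ℝ} {F F' : M2} (hp : 0 < p) (hpi : p < Real.pi)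
    (ht : t ∈ Icc (-(Real.pi / 2)) (Real.pi / 2)) (ht' : t' ∈ Icc (-(Real.pi / 2)) (Real.pi / 2))
    (hF : F ∈ kSet) (hF' : F' ∈ kSet)
    (h : ∀ s ∈ Icc 0 p,
      NW 0 s t (rot (s * Real.sin t) * F) = NW 0 s t' (rot (s * Real.sin t') * F')) :
    t = t' ∧ F = F' := by
  have key : ∀ s, 0 < s → s ≤ p →
      Complex.exp (((s * Real.sin t : ℝ) : ℂ) * Complex.I) * antilin F =
        Complex.exp (((s * Real.sin t' : ℝ) : ℂ) * Complex.I) * antilin F' := by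
    intro s hs hsp
    have h1 := congrArg antilin (h s ⟨hs.le, hsp⟩)
    rw [antilin_NW, antilin_NW] at h1
    simp only [zero_mul, Real.exp_zero, Complex.ofReal_one, one_mul] at h1
    have h2 := congrArg norm h1
    simp only [norm_mul, norm_exp_mul_I, (mem_kSet_iff.1 hF).2, (mem_kSet_iff.1 hF').2, mul_one,
      Complex.norm_real, Real.norm_of_nonneg (sinhDiv_nonneg hs.le _)] at h2
    rw [h2, mul_assoc, mul_assoc] at h1
    exact mul_left_cancel₀ (Complex.ofReal_ne_zero.2 (sinhDiv_pos hs _).ne') h1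
  have hF0 : antilin F' ≠ 0 :=
    norm_ne_zero_iff.1 (by rw [(mem_kSet_iff.1 hF').2]; exact one_ne_zero)
  have hdouble : ∀ σ : ℝ, Complex.exp (((p * σ : ℝ) : ℂ) * Complex.I) =
      Complex.exp (((p / 2 * σ : ℝ) : ℂ) * Complex.I) *
        Complex.exp (((p / 2 * σ : ℝ) : ℂ) * Complex.I) := by
    intro σ
    rw [← Complex.exp_add]
    congr 1
    push_cast
    ring
  have h1 := key p hp le_rfl
  -- Dividing the identity at time p by the one at time p/2 eliminates the phases F and F'; the
  -- remaining exponents have modulus less than π, so the sines agree.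
  have h2 := key (p / 2) (by positivity) (by linarith)
  rw [hdouble, hdouble, mul_assoc, h2, mul_assoc, ← sub_eq_zero, ← sub_mul, mul_eq_zero,
    or_iff_left (mul_ne_zero (Complex.exp_ne_zero _) hF0), sub_eq_zero] at h1
  have hlt : ∀ τ : ℝ, ‖((p / 2 * Real.sin τ : ℝ) : ℂ) * Complex.I‖ < Real.pi := by
    intro τ
    rw [norm_mul, Complex.norm_I, mul_one, Complex.norm_real, Real.norm_eq_abs, abs_mul,
      abs_of_pos (by positivity)]
    nlinarith [Real.abs_sin_le_one τ, abs_nonneg (Real.sin τ)]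
  have h3 := mul_right_cancel₀ Complex.I_ne_zero (exp_injective_of_norm_lt_pi (hlt t) (hlt t') h1)
  have h4 : p / 2 * Real.sin t = p / 2 * Real.sin t' := by exact_mod_cast h3
  have h5 := mul_left_cancel₀ (by positivity) h4
  rw [h5] at h2
  exact ⟨Real.injOn_sin ht ht' h5, eq_of_antilin_eq hF hF'
    (mul_left_cancel₀ (Complex.exp_ne_zero _) h2)⟩

/-- Without an elliptic part the normal form is even in cos t, which is why directions may be taken
in [−π/2, π/2]. -/
lemma NW_zero_congr {s t t' : ℝ} (hs : Real.sin t = Real.sin t')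
    (hc : Real.cos t = Real.cos t' ∨ Real.cos t = -Real.cos t') (F : M2) :
    NW 0 s t F = NW 0 s t' F := by
  rcases hc with hc | hc <;>
    simp only [NW, hs, hc, zero_mul, mul_neg, Real.cosh_neg, sinhDiv_neg_right, neg_zero]

/-- The algebra homomorphism ℂ → M₂(ℝ) sending i to Ĩ is continuous and commutes with exp. F is
arbitrary because it has coefficient zero. -/
lemma exp_smul_eq (s t : ℝ) (F : M2) :
    NormedSpace.exp (s • (Real.cos t • (1 : M2) + Real.sin t • mI)) = NW s 0 t F := by
  have hI : mI * mI = -1 := by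
    ext i j
    fin_cases i <;> fin_cases j <;> simp [mI]
  set L : ℂ →ₐ[ℝ] M2 := Complex.lift ⟨mI, hI⟩ with hL
  have hLz : ∀ z : ℂ, L z = z.re • (1 : M2) + z.im • mI := fun z => by
    rw [hL, Complex.lift_apply, Complex.liftAux_apply, Algebra.algebraMap_eq_smul_one]
  have hLc : Continuous L := L.toLinearMap.continuous_of_finiteDimensional
  have h1 : s • (Real.cos t • (1 : M2) + Real.sin t • mI) =
      L (s * Complex.exp (t * Complex.I)) := by
    rw [hLz, Complex.re_ofReal_mul, Complex.im_ofReal_mul, Complex.exp_ofReal_mul_I_re,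
      Complex.exp_ofReal_mul_I_im, smul_add, smul_smul, smul_smul]
  rw [h1, ← NormedSpace.map_exp L hLc, ← Complex.exp_eq_exp_ℂ, hLz, Complex.exp_re, Complex.exp_im,
    Complex.re_ofReal_mul, Complex.im_ofReal_mul, Complex.exp_ofReal_mul_I_re,
    Complex.exp_ofReal_mul_I_im]
  simp only [NW, rot, sinhDiv_zero_left, zero_mul, Real.cosh_zero, one_smul, sub_zero, zero_smul,
    add_zero, mul_one, smul_add, smul_smul]

end

end Magnus

namespace Magnus

noncomputable section

local notation "conj" => starRingEnd ℂ

/-! ### Minimal presentations -/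

/-- The mass-normalized form of a minimal presentation of `A`, for a Magnus exponent `p`. -/
structure IsMinimalDensity (A : M2) (p : ℝ) (f : ℝ → M2) : Prop where
  isDensity : IsDensity f p
  flow_eq : flow f p = A

/-- The cumulative norm maps [a, b] onto [0, p], so every statement about the development of φ, for
an arbitrary target G, is equivalent to one about the flow. -/
lemma IsMinimalPresentation.exists_density {A : M2} {φ : VectorMeasure ℝ M2} {a b : ℝ}
    (h : IsMinimalPresentation A φ a b) :
    ∃ f, IsMinimalDensity A (magnusExponent A).toReal f ∧
      massNormalized φ a =
        (volume.restrict (Icc 0 (magnusExponent A).toReal)).withDensityᵥ f ∧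
      ∀ G : ℝ → M2, (∀ x ∈ Icc a b, Lexp (φ.restrict (Icc a x)) = G (cumMass φ a x)) ↔
        ∀ s ∈ Icc 0 (magnusExponent A).toReal, flow f s = G s := by
  obtain ⟨f, hf, hn, hL, hx⟩ := h.isOrdered.exists_density
  have hsurj := h.isOrdered.surjOn_cumMass
  have hmem := h.isOrdered.cumMass_mem
  rw [h.mass_eq] at hf hn hL hsurj hmem
  refine ⟨f, ⟨hf, hL.symm.trans h.lexp_eq⟩, hn, fun G => ⟨fun hG s hs => ?_, fun hG x hxab => ?_⟩⟩
  · obtain ⟨x, hxab, rfl⟩ := hsurj hs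
    rw [← hx x hxab, hG x hxab]
  · rw [hx x hxab, hG _ (hmem x)]

lemma reparamEquiv_of_flow_eq {A : M2} {φ ψ : VectorMeasure ℝ M2} {a b c d : ℝ}
    (hφ : IsMinimalPresentation A φ a b) (hψ : IsMinimalPresentation A ψ c d) {G : ℝ → M2}
    (h₁ : ∀ x ∈ Icc a b, Lexp (φ.restrict (Icc a x)) = G (cumMass φ a x))
    (h₂ : ∀ x ∈ Icc c d, Lexp (ψ.restrict (Icc c x)) = G (cumMass ψ c x)) :
    ReparamEquiv φ a ψ c := by
  obtain ⟨f, hf, hfn, hfG⟩ := hφ.exists_density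
  obtain ⟨g, hg, hgn, hgG⟩ := hψ.exists_density
  rw [ReparamEquiv, hfn, hgn]
  exact WithDensityᵥEq.congr_ae (hf.isDensity.ae_eq_of_flow_eq hg.isDensity fun s hs =>
    ((hfG G).1 h₁ s hs).trans ((hgG G).1 h₂ s hs).symm)

namespace IsMinimalDensity

variable {A : M2} {p : ℝ} {f : ℝ → M2}

lemma logBounded (hf : IsMinimalDensity A p f) (hp : 0 ≤ p) (hpi : p < Real.pi) :
    LogBounded (chiralCenter A) ‖antilin A‖ p :=
  hf.flow_eq ▸ hf.isDensity.logBounded_flow hp hpi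

lemma flow_eq_NW (hf : IsMinimalDensity A p f) (hp : 0 ≤ p) (hpi : p < Real.pi) {u : ℂ}
    (hu : u ≠ 0) {t : ℝ} (h : act A u = u * gammaCurve p t) {s : ℝ} (hs : s ∈ Icc 0 p) :
    flow f s = NW (ellipticLength f s) (s - ellipticLength f s) t
      (rot (s * Real.sin t) * ofParts 0 (phase t u)) :=
  hf.isDensity.flow_eq_NW_of_touch hp hpi hu (by rw [hf.flow_eq, h]) hs

/-- The normal form evaluated at time p. By strict monotonicity of the relative radius, A alone then
determines the final elliptic length of every minimal density. -/
lemma parts_eq (hf : IsMinimalDensity A p f) (hp : 0 ≤ p) (hpi : p < Real.pi) {u : ℂ}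
    (hu : u ≠ 0) {t : ℝ} (h : act A u = u * gammaCurve p t) :
    ‖antilin A‖ = Real.exp (p * Real.cos t) *
      relRadius (p - ellipticLength f p) (Real.cos t) ∧
    chiralCenter A = gammaCurve p t * (1 - relRadius (p - ellipticLength f p) (Real.cos t) *
      Complex.exp (t * Complex.I)) := by
  have h1 := hf.flow_eq_NW hp hpi hu h ⟨hp, le_rfl⟩
  rw [hf.flow_eq] at h1
  have hnn : 0 ≤ p - ellipticLength f p := sub_nonneg.2 (hf.isDensity.ellipticLength_le hp)
  obtain ⟨v, hv⟩ : ∃ v, v = p - ellipticLength f p := ⟨_, rfl⟩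
  have h2 : ellipticLength f p = p - v := by rw [hv, sub_sub_cancel]
  rw [← hv] at hnn ⊢
  rw [← hv, h2] at h1
  constructor
  · have h3 := congrArg (fun M => ‖antilin M‖) h1
    simp only [antilin_NW_sub, antilin_ofParts, norm_mul, norm_exp_mul_I, norm_phase t hu,
      mul_one, Complex.norm_real, Real.norm_eq_abs, Real.abs_exp] at h3
    rw [h3, abs_of_nonneg]
    have := (strictMono_relRadius (Real.cos t)).monotone hnn
    simpa using this
  · have h3 := congrArg chiralCenter h1
    rwa [chiralCenter_NW_sub (chiralCenter_ofParts _ _)] at h3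

/-- In the hyperbolic and parabolic cases there is a touching point, and the flow has no
elliptic part. -/
lemma exists_touch_of_hyperbolic_or_parabolic (hp : 0 < p) (hpi : p < Real.pi)
    (hM : (magnusExponent A).toReal = p) (hB : LogBounded (chiralCenter A) ‖antilin A‖ p)
    (hA : IsMagnusHyperbolic A ∨ IsMagnusParabolic A) :
    ∃ u : ℂ, u ≠ 0 ∧ ∃ t : ℝ, act A u = u * gammaCurve p t ∧
      ∀ f, IsMinimalDensity A p f → ellipticLength f p = 0 := by
  rcases hA with ⟨-, z, hz, w, hw, hzw⟩ | ⟨-, t, ht, hz, hosc⟩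
  · rw [touchSet, hM] at hz hw
    obtain ⟨hz, t, rfl⟩ := hz
    obtain ⟨hw, t', rfl⟩ := hw
    obtain ⟨u, hu, h⟩ := hB.exists_act_eq hp hpi hz
    obtain ⟨u', hu', h'⟩ := hB.exists_act_eq hp hpi hw
    refine ⟨u, hu, t, h, fun f hf => ?_⟩
    refine hf.isDensity.ellipticLength_eq_zero_of_touch hp.le hpi hu hu'
      (by rw [hf.flow_eq, h]) (by rw [hf.flow_eq, h']) fun heq => hzw ?_
    rw [gammaCurve, heq, gammaCurve]
  · rw [touchSet, hM] at hz
    rw [hM] at hosc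
    obtain ⟨u, hu, h⟩ := hB.exists_act_eq hp hpi hz.1
    refine ⟨u, hu, t, h, fun f hf => ?_⟩
    have hc : Real.cos t = 0 := by rcases ht with rfl | rfl <;> simp
    -- Osculation makes the second derivative vanish; with center coefficient p − ℓ, where ℓ is the
    -- elliptic length, that derivative is a positive multiple of pℓ.
    have h1 := hosc.2.2.2
    rw [deriv_deriv_normSq_gammaCurve_sub (hf.parts_eq hp.le hpi hu h).2 hc, hc,
      relRadius_zero_right, sub_sub_cancel] at h1
    have := gammaCurve_ne_zero p t
    simpa [this, hp.ne'] using h1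

end IsMinimalDensity

/-! ### The three cases -/

/-- The hyperbolic and the parabolic case. -/
theorem exists_hyperbolicDevelopment {A : M2} {p : ℝ} (hp : 0 < p) (hpi : p < Real.pi)
    (hM : (magnusExponent A).toReal = p) (hB : LogBounded (chiralCenter A) ‖antilin A‖ p)
    (hA : IsMagnusHyperbolic A ∨ IsMagnusParabolic A) :
    ∃ t ∈ Icc (-(Real.pi / 2)) (Real.pi / 2), ∃ F ∈ kSet, ∀ f, IsMinimalDensity A p f →
      ∀ s ∈ Icc 0 p, flow f s = NW 0 s t (rot (s * Real.sin t) * F) := by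
  obtain ⟨u, hu, t, h, hell⟩ :=
    IsMinimalDensity.exists_touch_of_hyperbolic_or_parabolic hp hpi hM hB hA
  -- The touching direction may have negative cosine; this replaces it by the direction in the right
  -- half-plane with the same sine, while F keeps the original phase.
  refine ⟨Real.arcsin (Real.sin t), Real.arcsin_mem_Icc _, ofParts 0 (phase t u),
    ofParts_mem_kSet (norm_phase t hu), fun f hf s hs => ?_⟩
  have hsin : Real.sin (Real.arcsin (Real.sin t)) = Real.sin t :=
    Real.sin_arcsin (Real.neg_one_le_sin t) (Real.sin_le_one t)
  rw [hf.flow_eq_NW hp.le hpi hu h hs, hf.isDensity.ellipticLength_eq_zero (hell f hf) hs,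
    sub_zero, hsin]
  refine NW_zero_congr hsin.symm ?_ _
  rw [Real.cos_arcsin, ← Real.cos_sq', Real.sqrt_sq_eq_abs]
  rcases abs_choice (Real.cos t) with h1 | h1
  · exact .inl h1.symm
  · exact .inr (by rw [h1, neg_neg])

/-- The quasicomplex case. -/
theorem exists_complexDevelopment {A : M2} (hA : A ≠ 1) {p : ℝ} (hp : 0 < p) (hpi : p < Real.pi)
    (hM : ENNReal.ofReal p ≤ magnusExponent A)
    (hB : LogBounded (chiralCenter A) ‖antilin A‖ p) (hq : antilin A = 0) :
    ∃ t ∈ Ico 0 (2 * Real.pi), ∀ f, IsMinimalDensity A p f → ∀ s ∈ Icc 0 p,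
      flow f s = NormedSpace.exp (s • (Real.cos t • (1 : M2) + Real.sin t • mI)) := by
  obtain ⟨u, hu, t, ht, h⟩ := exists_act_eq_gammaCurve hA hpi hM hB
  refine ⟨t, ht, fun f hf s hs => ?_⟩
  have h1 := (hf.parts_eq hp.le hpi hu h).1
  rw [hq, norm_zero, zero_eq_mul, or_iff_right (Real.exp_ne_zero _)] at h1
  have h2 : p - ellipticLength f p = 0 :=
    (strictMono_relRadius (Real.cos t)).injective (by simpa using h1)
  have h3 := hf.isDensity.ellipticLength_eq_self (by linarith) hs
  rw [hf.flow_eq_NW hp.le hpi hu h hs, h3, sub_self, exp_smul_eq]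

lemma complexDevelopment_unique {p t t' : ℝ} (hp : 0 < p) (hpi : p < Real.pi)
    (ht : t ∈ Ico 0 (2 * Real.pi)) (ht' : t' ∈ Ico 0 (2 * Real.pi))
    (h : NormedSpace.exp (p • (Real.cos t • (1 : M2) + Real.sin t • mI)) =
      NormedSpace.exp (p • (Real.cos t' • (1 : M2) + Real.sin t' • mI))) : t = t' := by
  -- The phase is irrelevant at hyperbolic length zero; this shape only matches
  -- `chiralCenter_NW_sub`. The endpoint alone determines t, as p < π.
  rw [exp_smul_eq p t (rot 0 * 0), exp_smul_eq p t' (rot 0 * 0)] at h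
  have h1 := congrArg chiralCenter h
  have h0 : chiralCenter (0 : M2) = 0 := by
    apply Complex.ext <;> simp [chiralCenter]
  have h2 := chiralCenter_NW_sub h0 p 0 t 0
  have h3 := chiralCenter_NW_sub h0 p 0 t' 0
  rw [sub_zero, relRadius_zero_left, Complex.ofReal_zero, zero_mul, sub_zero, mul_one] at h2 h3
  rw [h2, h3] at h1
  refine eq_of_exp_mul_I_eq ht ht' (mul_left_cancel₀ (Complex.ofReal_ne_zero.2 hp.ne')
    (exp_injective_of_norm_lt_pi ?_ ?_ h1)) <;>
  rwa [norm_ofReal_mul_exp hp.le]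

/-- The parameter functions of a mixed development on mass-normalized level. -/
structure IsMixedFlow (f : ℝ → M2) (p t p₁ p₂ : ℝ) (F : M2) (w₁ w₂ : ℝ → ℝ) : Prop where
  t_mem : t ∈ Ico (0 : ℝ) (2 * Real.pi)
  p₁_pos : 0 < p₁
  p₂_pos : 0 < p₂
  F_mem : F ∈ kSet
  mono₁ : MonotoneOn w₁ (Icc 0 p)
  mono₂ : MonotoneOn w₂ (Icc 0 p)
  image₁ : w₁ '' Icc 0 p = Icc 0 p₁
  image₂ : w₂ '' Icc 0 p = Icc 0 p₂
  add_eq : ∀ s ∈ Icc 0 p, w₁ s + w₂ s = s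
  flow_eq : ∀ s ∈ Icc 0 p, flow f s = NW (w₁ s) (w₂ s) t (rot (s * Real.sin t) * F)

lemma apply_right_of_image {w : ℝ → ℝ} {p q : ℝ} (hp : 0 ≤ p) (hq : 0 ≤ q)
    (hw : MonotoneOn w (Icc 0 p)) (him : w '' Icc 0 p = Icc 0 q) : w p = q := by
  have h1 : w p ∈ Icc 0 q := him ▸ mem_image_of_mem w ⟨hp, le_rfl⟩
  obtain ⟨s, hs, hsq⟩ : q ∈ w '' Icc 0 p := him ▸ ⟨hq, le_rfl⟩
  exact le_antisymm h1.2 (hsq ▸ hw hs ⟨hp, le_rfl⟩ hs.2)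

lemma image_Icc_of_monotone {w : ℝ → ℝ} {p : ℝ} (hp : 0 ≤ p) (hw : Monotone w)
    (hc : Continuous w) (h0 : w 0 = 0) : w '' Icc 0 p = Icc 0 (w p) := by
  refine Subset.antisymm ?_ ?_
  · rintro _ ⟨s, hs, rfl⟩
    exact ⟨h0 ▸ hw hs.1, hw hs.2⟩
  · have := intermediate_value_Icc hp hc.continuousOn
    rwa [h0] at this

/-- A matrix in normal form is touched at the point of the direction of the normal form. -/
lemma act_NW_sub (p v t : ℝ) {u : ℂ} (hu : u ≠ 0) :
    act (NW (p - v) v t (rot (p * Real.sin t) * ofParts 0 (phase t u))) u =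
      u * gammaCurve p t := by
  have hcu : conj u ≠ 0 := by simpa using hu
  rw [act, chiralCenter_NW_sub (chiralCenter_ofParts _ _), antilin_NW_sub, antilin_ofParts, phase,
    ← gammaCurve, gammaCurve_eq]
  field_simp
  ring

/-- The mixed case. -/
theorem exists_mixedFlow {A : M2} (hA : A ≠ 1) {p : ℝ} (hp : 0 < p) (hpi : p < Real.pi)
    (hM : magnusExponent A = ENNReal.ofReal p) {f₀ : ℝ → M2} (hf₀ : IsMinimalDensity A p f₀)
    (hq : antilin A ≠ 0) (hA' : ¬ (IsMagnusHyperbolic A ∨ IsMagnusParabolic A)) :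
    ∃ (t p₁ p₂ : ℝ) (F : M2), ∀ f, IsMinimalDensity A p f →
      IsMixedFlow f p t p₁ p₂ F (ellipticLength f) (fun s => s - ellipticLength f s) := by
  have hB := hf₀.logBounded hp.le hpi
  obtain ⟨u, hu, t, ht, h⟩ := exists_act_eq_gammaCurve hA hpi hM.ge hB
  obtain ⟨hW₀, hZ₀⟩ := hf₀.parts_eq hp.le hpi hu h
  refine ⟨t, ellipticLength f₀ p, p - ellipticLength f₀ p, ofParts 0 (phase t u), fun f hf => ?_⟩
  have hpp : ellipticLength f p = ellipticLength f₀ p := by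
    have h1 := (hf.parts_eq hp.le hpi hu h).1
    rw [hW₀] at h1
    have h2 := (strictMono_relRadius (Real.cos t)).injective
      (mul_left_cancel₀ (Real.exp_ne_zero _) h1)
    linarith
  have hcont := hf.isDensity.locallyLipschitz_ellipticLength.continuous
  have h0 : ellipticLength f 0 = 0 := ellipticLength_zero f
  -- Zero elliptic length would be the extremal radius, hence the excluded hyperbolic or parabolic
  -- class; zero hyperbolic length would make A quasicomplex.
  have hne0 : ellipticLength f₀ p ≠ 0 := fun h0 => by
    rw [h0, sub_zero] at hW₀ hZ₀
    exact hA' (hyperbolic_or_parabolic hp hpi (by rw [hM, ENNReal.toReal_ofReal hp.le]) hB hW₀ hZ₀)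
  have hnep : p - ellipticLength f₀ p ≠ 0 := fun h0 => by
    rw [h0, relRadius_zero_left, mul_zero, norm_eq_zero] at hW₀
    exact hq hW₀
  exact
    { t_mem := ht
      p₁_pos := (hf₀.isDensity.ellipticLength_nonneg hp.le).lt_of_ne' hne0
      p₂_pos := (sub_nonneg.2 (hf₀.isDensity.ellipticLength_le hp.le)).lt_of_ne' hnep
      F_mem := ofParts_mem_kSet (norm_phase t hu)
      mono₁ := hf.isDensity.monotone_ellipticLength.monotoneOn _
      mono₂ := hf.isDensity.monotone_sub_ellipticLength.monotoneOn _
      image₁ := hpp ▸ image_Icc_of_monotone hp.le hf.isDensity.monotone_ellipticLength hcont h0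
      image₂ := hpp ▸ image_Icc_of_monotone hp.le hf.isDensity.monotone_sub_ellipticLength
        (continuous_id.sub hcont) (by simp [h0])
      add_eq := fun s _ => add_sub_cancel _ _
      flow_eq := fun s hs => hf.flow_eq_NW hp.le hpi hu h hs }

namespace IsMixedFlow

variable {A : M2} {f : ℝ → M2} {p t p₁ p₂ t' p₁' p₂' : ℝ} {F F' : M2} {w₁ w₂ w₁' w₂' : ℝ → ℝ}

lemma exists_touch (h : IsMixedFlow f p t p₁ p₂ F w₁ w₂) (hp : 0 ≤ p) :
    ∃ u : ℂ, u ≠ 0 ∧ F = ofParts 0 (phase t u) ∧ act (flow f p) u = u * gammaCurve p t := by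
  obtain ⟨u, hu, hF⟩ := exists_phase_eq h.F_mem t
  refine ⟨u, hu, hF, ?_⟩
  have h1 : w₁ p = p - w₂ p := by linarith [h.add_eq p ⟨hp, le_rfl⟩]
  rw [h.flow_eq p ⟨hp, le_rfl⟩, h1, hF, act_NW_sub p _ t hu]

/-- The prescribed data give one expression for the final chiral radius and the density another.
Comparing them identifies the hyperbolic lengths, so zero elliptic length would contradict p₁ > 0.
-/
lemma ellipticLength_ne_zero (h : IsMixedFlow f p t p₁ p₂ F w₁ w₂) (hf : IsDensity f p)
    (hp : 0 ≤ p) (hpi : p < Real.pi) : ellipticLength f p ≠ 0 := fun h0 => by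
  obtain ⟨u, hu, hF, hact⟩ := h.exists_touch hp
  have h1 := (IsMinimalDensity.parts_eq ⟨hf, rfl⟩ hp hpi hu hact).1
  have h2 : w₁ p = p - w₂ p := by linarith [h.add_eq p ⟨hp, le_rfl⟩]
  have h3 := congrArg (fun M => ‖antilin M‖) (h.flow_eq p ⟨hp, le_rfl⟩)
  have h4 : w₂ p = p₂ := apply_right_of_image hp h.p₂_pos.le h.mono₂ h.image₂
  have h5 : w₁ p = p₁ := apply_right_of_image hp h.p₁_pos.le h.mono₁ h.image₁
  have hnn : 0 ≤ relRadius (w₂ p) (Real.cos t) := by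
    have := (strictMono_relRadius (Real.cos t)).monotone (h4 ▸ h.p₂_pos.le : 0 ≤ w₂ p)
    simpa using this
  simp only [h2, antilin_NW_sub, hF, antilin_ofParts, norm_mul, norm_exp_mul_I, norm_phase t hu,
    mul_one, Complex.norm_real, Real.norm_eq_abs, Real.abs_exp, abs_of_nonneg hnn] at h3
  rw [h3, h0, sub_zero] at h1
  have h6 := (strictMono_relRadius (Real.cos t)).injective
    (mul_left_cancel₀ (Real.exp_ne_zero _) h1)
  linarith [h.p₁_pos]

/-- The data of a mixed development are unique. -/
theorem unique (h : IsMixedFlow f p t p₁ p₂ F w₁ w₂) (h' : IsMixedFlow f p t' p₁' p₂' F' w₁' w₂')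
    (hf : IsDensity f p) (hp : 0 ≤ p) (hpi : p < Real.pi) :
    t' = t ∧ p₁' = p₁ ∧ p₂' = p₂ ∧ F' = F ∧ EqOn w₁' w₁ (Icc 0 p) ∧ EqOn w₂' w₂ (Icc 0 p) := by
  obtain ⟨u, hu, hF, hact⟩ := h.exists_touch hp
  obtain ⟨u', hu', hF', hact'⟩ := h'.exists_touch hp
  -- Two different directions would be two touching points, which exclude an elliptic part.
  have htt : t' = t := eq_of_exp_mul_I_eq h'.t_mem h.t_mem (by
    by_contra hne
    exact h.ellipticLength_ne_zero hf hp hpi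
      (hf.ellipticLength_eq_zero_of_touch hp hpi hu' hu hact' hact hne))
  subst htt
  have hparts : ∀ s ∈ Icc 0 p, (relRadius (w₂' s) (Real.cos t') : ℂ) * antilin F' =
      relRadius (w₂ s) (Real.cos t') * antilin F := by
    intro s hs
    have h1 := congrArg antilin ((h'.flow_eq s hs).symm.trans (h.flow_eq s hs))
    rw [(by linarith [h'.add_eq s hs] : w₁' s = s - w₂' s),
      (by linarith [h.add_eq s hs] : w₁ s = s - w₂ s), antilin_NW_sub, antilin_NW_sub] at h1
    have h2 : (Real.exp (s * Real.cos t') : ℂ) *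
        Complex.exp (((s * Real.sin t' : ℝ) : ℂ) * Complex.I) ≠ 0 :=
      mul_ne_zero (Complex.ofReal_ne_zero.2 (Real.exp_ne_zero _)) (Complex.exp_ne_zero _)
    refine mul_left_cancel₀ h2 ?_
    linear_combination h1
  have hnn : ∀ {w : ℝ → ℝ} {q : ℝ}, w '' Icc 0 p = Icc 0 q → ∀ s ∈ Icc 0 p,
      0 ≤ relRadius (w s) (Real.cos t') := by
    intro w q him s hs
    have h1 : w s ∈ Icc 0 q := him ▸ mem_image_of_mem w hs
    have := (strictMono_relRadius (Real.cos t')).monotone h1.1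
    simpa using this
  have hw₂ : EqOn w₂' w₂ (Icc 0 p) := by
    intro s hs
    have h1 := congrArg norm (hparts s hs)
    rw [norm_mul, norm_mul, (mem_kSet_iff.1 h.F_mem).2, (mem_kSet_iff.1 h'.F_mem).2,
      Complex.norm_real, Complex.norm_real, Real.norm_of_nonneg (hnn h.image₂ s hs),
      Real.norm_of_nonneg (hnn h'.image₂ s hs), mul_one, mul_one] at h1
    exact (strictMono_relRadius (Real.cos t')).injective h1
  have hw₁ : EqOn w₁' w₁ (Icc 0 p) := fun s hs => by
    linarith [h'.add_eq s hs, h.add_eq s hs, hw₂ hs]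
  have hpp : p ∈ Icc 0 p := ⟨hp, le_rfl⟩
  have e₁ := apply_right_of_image hp h.p₁_pos.le h.mono₁ h.image₁
  have e₂ := apply_right_of_image hp h.p₂_pos.le h.mono₂ h.image₂
  have e₁' := apply_right_of_image hp h'.p₁_pos.le h'.mono₁ h'.image₁
  have e₂' := apply_right_of_image hp h'.p₂_pos.le h'.mono₂ h'.image₂
  refine ⟨rfl, by rw [← e₁, ← e₁', hw₁ hpp], by rw [← e₂, ← e₂', hw₂ hpp], ?_, hw₁, hw₂⟩
  -- The phase is compared at time p, where the hyperbolic length is p₂ > 0 and the factor can be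
  -- cancelled.
  refine eq_of_antilin_eq h'.F_mem h.F_mem (mul_left_cancel₀ ?_ (hw₂ hpp ▸ hparts p hpp))
  rw [e₂, Complex.ofReal_ne_zero]
  have := strictMono_relRadius (Real.cos t') h.p₂_pos
  simp only [relRadius_zero_left] at this
  exact this.ne'

end IsMixedFlow

lemma antilin_eq_zero_iff (A : M2) : (∃ z : ℂ, chiralDisk A = {z}) ↔ antilin A = 0 := by
  rw [chiralDisk, chiralRadius_eq]
  constructor
  · rintro ⟨z, hz⟩
    have h1 : chiralCenter A ∈ Metric.closedBall (chiralCenter A) ‖antilin A‖ :=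
      Metric.mem_closedBall_self (norm_nonneg _)
    have h2 : chiralCenter A + antilin A ∈ Metric.closedBall (chiralCenter A) ‖antilin A‖ := by
      simp
    rw [hz, mem_singleton_iff] at h1 h2
    rw [h1] at h2
    exact add_eq_left.1 h2
  · intro h
    exact ⟨chiralCenter A, by rw [h, norm_zero, Metric.closedBall_zero]⟩

end

end Magnus

/-! ### Transfer from normalized flows to minimal presentations -/

namespace Magnus

/-- A mixed development is the same as one on mass-normalized level. -/
lemma isMixedDevelopment_iff {φ : VectorMeasure ℝ M2} {a b p : ℝ} {f : ℝ → M2}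
    (h : ∀ G : ℝ → M2, (∀ x ∈ Icc a b, Lexp (φ.restrict (Icc a x)) = G (cumMass φ a x)) ↔
      ∀ s ∈ Icc 0 p, flow f s = G s) {t p₁ p₂ : ℝ} {F : M2} {w₁ w₂ : ℝ → ℝ} :
    IsMixedDevelopment φ a b p t p₁ p₂ F w₁ w₂ ↔ IsMixedFlow f p t p₁ p₂ F w₁ w₂ := by
  have hG := h fun s => NW (w₁ s) (w₂ s) t (rot (s * Real.sin t) * F)
  exact ⟨fun ⟨h1, h2, h3, h4, h5, h6, h7, h8, h9, h10⟩ =>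
      ⟨h1, h2, h3, h4, h5, h6, h7, h8, h9, hG.1 h10⟩,
    fun ⟨h1, h2, h3, h4, h5, h6, h7, h8, h9, h10⟩ =>
      ⟨h1, h2, h3, h4, h5, h6, h7, h8, h9, hG.2 h10⟩⟩

lemma exists_isMixedDevelopment_unique {A : M2} (hA : A ≠ 1)
    (hpi : (magnusExponent A).toReal < Real.pi)
    (hpr : ENNReal.ofReal (magnusExponent A).toReal = magnusExponent A)
    (hpos : ∀ f, IsMinimalDensity A (magnusExponent A).toReal f → 0 < (magnusExponent A).toReal)
    (hA' : ¬ (IsMagnusHyperbolic A ∨ IsMagnusParabolic A)) (hq : antilin A ≠ 0) :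
    ∃ (t p₁ p₂ : ℝ) (F : M2), ∀ (φ : VectorMeasure ℝ M2) (a b : ℝ),
      IsMinimalPresentation A φ a b → ∃ w₁ w₂ : ℝ → ℝ,
        IsMixedDevelopment φ a b (magnusExponent A).toReal t p₁ p₂ F w₁ w₂ ∧
        ∀ (t' p₁' p₂' : ℝ) (F' : M2) (w₁' w₂' : ℝ → ℝ),
          IsMixedDevelopment φ a b (magnusExponent A).toReal t' p₁' p₂' F' w₁' w₂' →
          t' = t ∧ p₁' = p₁ ∧ p₂' = p₂ ∧ F' = F ∧
          EqOn w₁' w₁ (Icc 0 (magnusExponent A).toReal) ∧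
          EqOn w₂' w₂ (Icc 0 (magnusExponent A).toReal) := by
  by_cases hex : ∃ f₀, IsMinimalDensity A (magnusExponent A).toReal f₀
  · obtain ⟨f₀, hf₀⟩ := hex
    obtain ⟨t, p₁, p₂, F, hall⟩ := exists_mixedFlow hA (hpos f₀ hf₀) hpi hpr.symm hf₀ hq hA'
    refine ⟨t, p₁, p₂, F, fun φ a b hφ => ?_⟩
    obtain ⟨f, hf, -, hG⟩ := hφ.exists_density
    refine ⟨_, _, (isMixedDevelopment_iff hG).2 (hall f hf), fun t' p₁' p₂' F' w₁' w₂' h' => ?_⟩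
    exact (hall f hf).unique ((isMixedDevelopment_iff hG).1 h') hf.isDensity
      (hpos f hf).le hpi
  -- Without any minimal density there is no minimal presentation, so the data may be arbitrary.
  · refine ⟨0, 0, 0, 0, fun φ a b hφ => ?_⟩
    obtain ⟨f, hf, -⟩ := hφ.exists_density
    exact absurd ⟨f, hf⟩ hex

end Magnus

theorem mainTheorem3 (A : Magnus.M2) (hA : A ≠ 1)
    (hp : Magnus.magnusExponent A < ENNReal.ofReal Real.pi) :
    -- (a) Magnus hyperbolic or parabolic matrices
    ((Magnus.IsMagnusHyperbolic A ∨ Magnus.IsMagnusParabolic A) →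
      (∃ t ∈ Set.Icc (-(Real.pi / 2)) (Real.pi / 2), ∃ F ∈ Magnus.kSet,
        ∀ (φ : MeasureTheory.VectorMeasure ℝ Magnus.M2) (a b : ℝ),
          Magnus.IsMinimalPresentation A φ a b →
          Magnus.IsHyperbolicDevelopment φ a b t F ∧
          ∀ t' ∈ Set.Icc (-(Real.pi / 2)) (Real.pi / 2), ∀ F' ∈ Magnus.kSet,
            Magnus.IsHyperbolicDevelopment φ a b t' F' → t' = t ∧ F' = F) ∧
      (∀ (φ ψ : MeasureTheory.VectorMeasure ℝ Magnus.M2) (a b c d : ℝ),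
        Magnus.IsMinimalPresentation A φ a b → Magnus.IsMinimalPresentation A ψ c d →
        Magnus.ReparamEquiv φ a ψ c)) ∧
    -- (b) quasicomplex matrices
    ((∃ z : ℂ, Magnus.chiralDisk A = {z}) →
      (∃ t ∈ Set.Ico (0 : ℝ) (2 * Real.pi),
        ∀ (φ : MeasureTheory.VectorMeasure ℝ Magnus.M2) (a b : ℝ),
          Magnus.IsMinimalPresentation A φ a b →
          Magnus.IsComplexDevelopment φ a b t ∧
          ∀ t' ∈ Set.Ico (0 : ℝ) (2 * Real.pi),
            Magnus.IsComplexDevelopment φ a b t' → t' = t) ∧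
      (∀ (φ ψ : MeasureTheory.VectorMeasure ℝ Magnus.M2) (a b c d : ℝ),
        Magnus.IsMinimalPresentation A φ a b → Magnus.IsMinimalPresentation A ψ c d →
        Magnus.ReparamEquiv φ a ψ c)) ∧
    -- (c) the general case
    (¬ (Magnus.IsMagnusHyperbolic A ∨ Magnus.IsMagnusParabolic A) →
      ¬ (∃ z : ℂ, Magnus.chiralDisk A = {z}) →
      (∃ (t p₁ p₂ : ℝ) (F : Magnus.M2),
        ∀ (φ : MeasureTheory.VectorMeasure ℝ Magnus.M2) (a b : ℝ),
          Magnus.IsMinimalPresentation A φ a b →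
          ∃ w₁ w₂ : ℝ → ℝ,
            Magnus.IsMixedDevelopment φ a b (Magnus.magnusExponent A).toReal t p₁ p₂ F w₁ w₂ ∧
            ∀ (t' p₁' p₂' : ℝ) (F' : Magnus.M2) (w₁' w₂' : ℝ → ℝ),
              Magnus.IsMixedDevelopment φ a b (Magnus.magnusExponent A).toReal
                t' p₁' p₂' F' w₁' w₂' →
              t' = t ∧ p₁' = p₁ ∧ p₂' = p₂ ∧ F' = F ∧
              Set.EqOn w₁' w₁ (Set.Icc 0 (Magnus.magnusExponent A).toReal) ∧
              Set.EqOn w₂' w₂ (Set.Icc 0 (Magnus.magnusExponent A).toReal)) ∧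
      (∀ (φ ψ : MeasureTheory.VectorMeasure ℝ Magnus.M2) (a b c d : ℝ),
        Magnus.IsMinimalPresentation A φ a b → Magnus.IsMinimalPresentation A ψ c d →
        ∀ (t p₁ p₂ : ℝ) (F : Magnus.M2) (w₁ w₂ : ℝ → ℝ),
          Magnus.IsMixedDevelopment φ a b (Magnus.magnusExponent A).toReal t p₁ p₂ F w₁ w₂ →
          Magnus.IsMixedDevelopment ψ c d (Magnus.magnusExponent A).toReal t p₁ p₂ F w₁ w₂ →
          Magnus.ReparamEquiv φ a ψ c)) := by
  have hpr : ENNReal.ofReal (Magnus.magnusExponent A).toReal = Magnus.magnusExponent A :=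
    ENNReal.ofReal_toReal hp.ne_top
  have hpi : (Magnus.magnusExponent A).toReal < Real.pi := by
    rwa [← hpr, ENNReal.ofReal_lt_ofReal_iff Real.pi_pos] at hp
  have hpos : ∀ f, Magnus.IsMinimalDensity A (Magnus.magnusExponent A).toReal f →
      0 < (Magnus.magnusExponent A).toReal := fun f hf =>
    hf.isDensity.ne_one_pos ENNReal.toReal_nonneg (hf.flow_eq.trans_ne hA)
  rw [Magnus.antilin_eq_zero_iff]
  refine ⟨fun hA' => ?_, fun hq => ?_, fun hA' hq => ⟨?_, ?_⟩⟩
  · obtain ⟨t, ht, F, hF, hall⟩ : ∃ t ∈ Icc (-(Real.pi / 2)) (Real.pi / 2), ∃ F ∈ Magnus.kSet,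
        ∀ f, Magnus.IsMinimalDensity A (Magnus.magnusExponent A).toReal f →
          ∀ s ∈ Icc 0 (Magnus.magnusExponent A).toReal,
            Magnus.flow f s = Magnus.NW 0 s t (Magnus.rot (s * Real.sin t) * F) := by
      by_cases hex : ∃ f₀, Magnus.IsMinimalDensity A (Magnus.magnusExponent A).toReal f₀
      · obtain ⟨f₀, hf₀⟩ := hex
        exact Magnus.exists_hyperbolicDevelopment (hpos f₀ hf₀) hpi rfl
          (hf₀.logBounded (hpos f₀ hf₀).le hpi) hA'
      -- No minimal density exists here, so any admissible direction and phase will do.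
      · exact ⟨0, ⟨by linarith [Real.pi_pos], by linarith [Real.pi_pos]⟩, Magnus.mK,
          Magnus.mK_mem_kSet, fun f hf => absurd ⟨f, hf⟩ hex⟩
    have hdev : ∀ (φ : VectorMeasure ℝ Magnus.M2) (a b : ℝ),
        Magnus.IsMinimalPresentation A φ a b → Magnus.IsHyperbolicDevelopment φ a b t F := by
      intro φ a b hφ
      obtain ⟨f, hf, -, hG⟩ := hφ.exists_density
      exact (hG fun s => Magnus.NW 0 s t (Magnus.rot (s * Real.sin t) * F)).2 (hall f hf)
    refine ⟨⟨t, ht, F, hF, fun φ a b hφ => ⟨hdev φ a b hφ, fun t' ht' F' hF' h' => ?_⟩⟩,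
      fun φ ψ a b c d hφ hψ => Magnus.reparamEquiv_of_flow_eq hφ hψ
        (G := fun s => Magnus.NW 0 s t (Magnus.rot (s * Real.sin t) * F))
        (hdev φ a b hφ) (hdev ψ c d hψ)⟩
    obtain ⟨f, hf, -, hG⟩ := hφ.exists_density
    have h1 := (hG fun s => Magnus.NW 0 s t' (Magnus.rot (s * Real.sin t') * F')).1 h'
    exact Magnus.eq_of_NW_zero_eq (hpos f hf) hpi ht' ht hF' hF fun s hs =>
      (h1 s hs).symm.trans (hall f hf s hs)
  · obtain ⟨t, ht, hall⟩ : ∃ t ∈ Ico (0 : ℝ) (2 * Real.pi),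
        ∀ f, Magnus.IsMinimalDensity A (Magnus.magnusExponent A).toReal f →
          ∀ s ∈ Icc 0 (Magnus.magnusExponent A).toReal, Magnus.flow f s =
            NormedSpace.exp (s • (Real.cos t • (1 : Magnus.M2) + Real.sin t • Magnus.mI)) := by
      by_cases hex : ∃ f₀, Magnus.IsMinimalDensity A (Magnus.magnusExponent A).toReal f₀
      · obtain ⟨f₀, hf₀⟩ := hex
        exact Magnus.exists_complexDevelopment hA (hpos f₀ hf₀) hpi hpr.le
          (hf₀.logBounded (hpos f₀ hf₀).le hpi) hq
      · exact ⟨0, ⟨le_rfl, Real.two_pi_pos⟩, fun f hf => absurd ⟨f, hf⟩ hex⟩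
    have hdev : ∀ (φ : VectorMeasure ℝ Magnus.M2) (a b : ℝ),
        Magnus.IsMinimalPresentation A φ a b → Magnus.IsComplexDevelopment φ a b t := by
      intro φ a b hφ
      obtain ⟨f, hf, -, hG⟩ := hφ.exists_density
      exact (hG fun s => NormedSpace.exp
        (s • (Real.cos t • (1 : Magnus.M2) + Real.sin t • Magnus.mI))).2 (hall f hf)
    refine ⟨⟨t, ht, fun φ a b hφ => ⟨hdev φ a b hφ, fun t' ht' h' => ?_⟩⟩,
      fun φ ψ a b c d hφ hψ => Magnus.reparamEquiv_of_flow_eq hφ hψ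
        (G := fun s => NormedSpace.exp
          (s • (Real.cos t • (1 : Magnus.M2) + Real.sin t • Magnus.mI)))
        (hdev φ a b hφ) (hdev ψ c d hψ)⟩
    obtain ⟨f, hf, -, hG⟩ := hφ.exists_density
    have h1 := (hG fun s => NormedSpace.exp
      (s • (Real.cos t' • (1 : Magnus.M2) + Real.sin t' • Magnus.mI))).1 h'
    have hmem : (Magnus.magnusExponent A).toReal ∈ Icc 0 (Magnus.magnusExponent A).toReal :=
      ⟨(hpos f hf).le, le_rfl⟩
    exact Magnus.complexDevelopment_unique (hpos f hf) hpi ht' ht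
      ((h1 _ hmem).symm.trans (hall f hf _ hmem))
  · exact Magnus.exists_isMixedDevelopment_unique hA hpi hpr hpos hA' hq
  · intro φ ψ a b c d hφ hψ t p₁ p₂ F w₁ w₂ h₁ h₂
    exact Magnus.reparamEquiv_of_flow_eq hφ hψ
      (G := fun s => Magnus.NW (w₁ s) (w₂ s) t (Magnus.rot (s * Real.sin t) * F))
      h₁.lexp_eq h₂.lexp_eq
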